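/- **Setting.** Let $H$ be a finite-dimensional $\mathbb{Q}$-vector space with a symplectic form $\omega$ (for instance $H_\mathbb{Q}=H_1(\Sigma_{g,1};\mathbb{Q})$ with the intersection pairing), and let $\mathfrak g$ be a metrized Lie algebra: a finite-dimensional Lie algebra over $\mathbb{Q}$ with a symmetric, invariant, non-degenerate bilinear form $\kappa$. Equip $\mathfrak g\otimes H$ with the symplectic form $\kappa\otimes\omega$. A *Jacobi diagram* is a finite graph whose vertices have valence $1$ (external) or $3$ (internal), with a cyclic order of the edges at each internal vertex; it is colored by $H$ if each external vertex carries an element of $H$. A strut is a component consisting of two external vertices joined by an edge. The internal degree of a diagram is its number of internal vertices. All diagrams below have no strut component and are colored by $H$. Let $\mathcal A(H)$ be the $\mathbb{Q}$-vector space spanned by these diagrams (up to isomorphism) modulo the relations AS, IHX and multilinearity in the colors. Let $\mathcal A^<(H)$ be the $\mathbb{Q}$-vector space spanned by such diagrams with totally ordered external vertices (up to order-preserving isomorphism), modulo AS, IHX, multilinearity and the STU-like relation $D-D'=\omega(x,y)\,D''$, where $v<w$ are consecutive external vertices of $D$ colored by $x,y$, the diagram $D'$ is obtained by exchanging the order of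 $v$ and $w$, and $D''$ by gluing $v$ to $w$. Both spaces are graded by the internal degree. The disjoint union $D\sqcup^< E$, the external vertices of $E$ being larger than those of $D$, makes $\mathcal A^<(H)$ an associative algebra with unit the empty diagram $\varnothing$. Let $\chi:\mathcal A(H)\to\mathcal A^<(H)$ send a diagram with $e$ external vertices to $\frac1{e!}$ times the sum of all ways of ordering its external vertices. For a symplectic vector space $(V,s)$ let $\mathcal W(V)=T(V)/\langle u\otimes v-v\otimes u-s(u,v)\rangle$ be the Weyl algebra, and let $\chi:S(V)\to\mathcal W(V)$ be the linear map $\chi(v_1\cdots v_n)=\frac1{n!}\sum_{\sigma\in S_n}v_{\sigma(1)}\otimes\cdots\otimes v_{\sigma(n)}$. For a diagram $D$ with external vertices numbered $1,\dots,e$, let $\widetilde w_{\mathfrak g}(D)\in(\mathfrak g\otimes H)^{\otimes e}\subset T(\mathfrak g\otimes H)$ be the tensor obtained by replacing each internal vertex by the alternating form $B(x,y,z)=\kappa([x,y],z)$ and each edge by the symmetric tensor $K=\sum_i b_i\otimes b_i^*\in\mathfrak g\otimes\mathfrak g$ (where $(b_i)$ is any basis of $\mathfrak g$ and $(b_i^*)$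 its $\kappa$-dual basis), performing all contractions, and tensoring with the colors. **Theorem.** The maps $\chi:\mathcal A(H)\to\mathcal A^<(H)$ and $\chi:S(\mathfrak g\otimes H)\to\mathcal W(\mathfrak g\otimes H)$ are bijective. Let $\star$ denote the products on $\mathcal A(H)$ and on $S(\mathfrak g\otimes H)$ (the latter being the Moyal–Weyl product, extended to $S(\mathfrak g\otimes H)[t]$ with $t$ central) which are pulled back by $\chi$ from the products of $\mathcal A^<(H)$ and of $\mathcal W(\mathfrak g\otimes H)$. There are homomorphisms of unital algebras $$W_{\mathfrak g}:\big(\mathcal A^<(H),\sqcup^<\big)\to\big(\mathcal W(\mathfrak g\otimes H)[t],\otimes\big),\qquad W_{\mathfrak g}:\big(\mathcal A(H),\star\big)\to\big(S(\mathfrak g\otimes H)[t],\star\big)$$ which send a diagram $D$ with $i$ internal vertices to the class of $\widetilde w_{\mathfrak g}(D)$ times $t^i$ (in the unordered case, for any numbering of the external vertices). Both send the internal degree $i$ part into the multiples of $t^i$. The map $\chi:\mathcal A(H)\to\mathcal A^<(H)$ preserves the internal degree, and $$W_{\mathfrak g}\circ\chi=\chi\circ W_{\mathfrak g}:\mathcal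 A(H)\to\mathcal W(\mathfrak g\otimes H)[t],$$ where $\chi$ is applied coefficientwise on the right-hand side. The two maps $W_{\mathfrak g}$ are non-zero. Moreover, if $\mathfrak g$ is non-abelian and $\dim H\ge 3$, or if the Killing form of $\mathfrak g$ is non-zero and $H\neq 0$, then the maps are non-trivial in positive degree: for some $i>0$ there is $x\in\mathcal A(H)$ of internal degree $i$ with $W_{\mathfrak g}(x)\neq0$ and $W_{\mathfrak g}(\chi(x))\neq0$. -/

import Mathlib

open scoped TensorProduct Polynomial

noncomputable section

/-- A Jacobi diagram without strut component, with set of internal vertices `I`, set of external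
vertices `E`, and external vertices colored by `H`.

The three half-edges at the internal vertex `v` are `(v, 0)`, `(v, 1)`, `(v, 2)`, in this cyclic
order.  Since there is no strut, every external vertex `k` is joined by an edge to an internal
half-edge, called `leg k`.  The involution `edge` fixes the half-edges that are joined to an
external vertex, and otherwise exchanges the two halves of every edge joining internal vertices
(loops and multiple edges are allowed). -/
@[ext]
structure JacobiDiagram (I E : Type) (H : Type*) where
  edge : I × Fin 3 → I × Fin 3
  leg : E → I × Fin 3
  color : E → H
  edge_edge : ∀ h, edge (edge h) = h
  leg_injective : Function.Injective leg
  edge_eq_self_iff : ∀ h, edge h = h ↔ ∃ k, leg k = h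

/-- The self-bijection of the set of half-edges that reverses the cyclic order at `v`. -/
def halfEdgeFlip {I : Type} [DecidableEq I] (v : I) : Equiv.Perm (I × Fin 3) :=
  Equiv.swap (v, 1) (v, 2)

/-- The cyclic permutation `(u, 1) ↦ (u, 2) ↦ (v, 1) ↦ (u, 1)` of half-edges (for `u ≠ v`). -/
def halfEdgeCycle {I : Type} [DecidableEq I] (u v : I) : Equiv.Perm (I × Fin 3) :=
  Equiv.swap (u, 1) (u, 2) * Equiv.swap (u, 2) (v, 1)

/-- The bijection of half-edges `(v, i) ↦ (π v, i + s v)`: these are the bijections that come from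
a bijection of the vertices and preserve the cyclic order at each vertex. -/
def halfEdgeIso {I I' : Type} (π : I ≃ I') (s : I → Fin 3) : I × Fin 3 ≃ I' × Fin 3 :=
  Equiv.prodShear π fun v => Equiv.addRight (s v)

namespace JacobiDiagram

universe u

variable {I I' I'' E E' E'' : Type} {H : Type u}

/-- Transport of a diagram along a bijection `φ` of the half-edges and a bijection `ψ` of the
external vertices. -/
def relabel (D : JacobiDiagram I E H) (φ : I × Fin 3 ≃ I' × Fin 3) (ψ : E ≃ E') :
    JacobiDiagram I' E' H where
  edge h := φ (D.edge (φ.symm h))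
  leg k := φ (D.leg (ψ.symm k))
  color k := D.color (ψ.symm k)
  edge_edge h := by simp [D.edge_edge]
  leg_injective := φ.injective.comp (D.leg_injective.comp ψ.symm.injective)
  edge_eq_self_iff h := by
    rw [← φ.eq_symm_apply, D.edge_eq_self_iff]
    constructor
    · rintro ⟨k, hk⟩
      exact ⟨ψ k, by simp [hk]⟩
    · rintro ⟨k, rfl⟩
      exact ⟨ψ.symm k, by simp⟩

/-- The same diagram with the color of the external vertex `k` replaced by `x`. -/
def setColor [DecidableEq E] (D : JacobiDiagram I E H) (k : E) (x : H) : JacobiDiagram I E H :=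
  { D with color := Function.update D.color k x }

/-- The diagram obtained by gluing the two distinct external vertices `i` and `j`: the two
half-edges that were joined to them now form an edge. -/
def glue [DecidableEq I] (D : JacobiDiagram I E H) (i j : E) (hij : i ≠ j) :
    JacobiDiagram I {k : E // k ≠ i ∧ k ≠ j} H where
  edge h := Equiv.swap (D.leg i) (D.leg j) (D.edge h)
  leg k := D.leg k
  color k := D.color k
  edge_edge h := by
    have hi : D.edge (D.leg i) = D.leg i := (D.edge_eq_self_iff _).2 ⟨i, rfl⟩
    have hj : D.edge (D.leg j) = D.leg j := (D.edge_eq_self_iff _).2 ⟨j, rfl⟩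
    by_cases h1 : h = D.leg i
    · subst h1; simp [hi, hj]
    by_cases h2 : h = D.leg j
    · subst h2; simp [hi, hj]
    have h3 : D.edge h ≠ D.leg i := fun hc => h1 (by rw [← D.edge_edge h, hc, hi])
    have h4 : D.edge h ≠ D.leg j := fun hc => h2 (by rw [← D.edge_edge h, hc, hj])
    rw [Equiv.swap_apply_of_ne_of_ne h3 h4, D.edge_edge, Equiv.swap_apply_of_ne_of_ne h1 h2]
  leg_injective a b hab := Subtype.ext (D.leg_injective hab)
  edge_eq_self_iff h := by
    have hi : D.edge (D.leg i) = D.leg i := (D.edge_eq_self_iff _).2 ⟨i, rfl⟩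
    have hj : D.edge (D.leg j) = D.leg j := (D.edge_eq_self_iff _).2 ⟨j, rfl⟩
    have hne : D.leg i ≠ D.leg j := fun hc => hij (D.leg_injective hc)
    by_cases h1 : h = D.leg i
    · subst h1
      simp only [hi, Equiv.swap_apply_left]
      exact ⟨fun hc => absurd hc.symm hne, fun ⟨k, hk⟩ => absurd (D.leg_injective hk) k.2.1⟩
    by_cases h2 : h = D.leg j
    · subst h2
      simp only [hj, Equiv.swap_apply_right]
      exact ⟨fun hc => absurd hc hne, fun ⟨k, hk⟩ => absurd (D.leg_injective hk) k.2.2⟩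
    have h3 : D.edge h ≠ D.leg i := fun hc => h1 (by rw [← D.edge_edge h, hc, hi])
    have h4 : D.edge h ≠ D.leg j := fun hc => h2 (by rw [← D.edge_edge h, hc, hj])
    rw [Equiv.swap_apply_of_ne_of_ne h3 h4, D.edge_eq_self_iff]
    constructor
    · rintro ⟨k, rfl⟩
      exact ⟨⟨k, fun hc => h1 (by rw [hc]), fun hc => h2 (by rw [hc])⟩, rfl⟩
    · rintro ⟨k, hk⟩
      exact ⟨k, hk⟩

/-- Disjoint union of diagrams. -/
def sum (D : JacobiDiagram I E H) (D' : JacobiDiagram I' E' H) :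
    JacobiDiagram (I ⊕ I') (E ⊕ E') H where
  edge h := (Equiv.sumProdDistrib I I' (Fin 3)).symm
    (Sum.map D.edge D'.edge (Equiv.sumProdDistrib I I' (Fin 3) h))
  leg k := (Equiv.sumProdDistrib I I' (Fin 3)).symm (Sum.map D.leg D'.leg k)
  color := Sum.elim D.color D'.color
  edge_edge h := by
    obtain ⟨h | h, i⟩ := h <;> simp [D.edge_edge, D'.edge_edge]
  leg_injective := (Equiv.injective _).comp
    (Sum.map_injective.2 ⟨D.leg_injective, D'.leg_injective⟩)
  edge_eq_self_iff h := by
    obtain ⟨k, rfl⟩ := (Equiv.sumProdDistrib I I' (Fin 3)).symm.surjective h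
    rw [Equiv.apply_symm_apply, Equiv.apply_eq_iff_eq]
    simp only [Equiv.apply_eq_iff_eq]
    rcases k with k | k
    · simp [D.edge_eq_self_iff]
    · simp [D'.edge_eq_self_iff]

/-- The empty diagram. -/
def empty (H : Type u) : JacobiDiagram (Fin 0) (Fin 0) H where
  edge := id
  leg k := k.elim0
  color k := k.elim0
  edge_edge _ := rfl
  leg_injective k := k.elim0
  edge_eq_self_iff h := h.1.elim0

/-- Disjoint union of diagrams whose external vertices are numbered (hence totally ordered): the
external vertices of `D'` are considered to be larger than those of `D`. -/
def union {n e n' e' : ℕ} (D : JacobiDiagram (Fin n) (Fin e) H)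
    (D' : JacobiDiagram (Fin n') (Fin e') H) : JacobiDiagram (Fin (n + n')) (Fin (e + e')) H :=
  (D.sum D').relabel (Equiv.prodCongr finSumFinEquiv (Equiv.refl _)) finSumFinEquiv

end JacobiDiagram

/-- The vector space freely spanned by the Jacobi diagrams without strut component and with
external vertices colored by `H`; the set of internal vertices is some `Fin n` and the set of
external vertices some `Fin e`. -/
abbrev FreeJacobi (H : Type*) : Type _ :=
  (Σ n e : ℕ, JacobiDiagram (Fin n) (Fin e) H) →₀ ℚ

namespace JacobiDiagram

/-- A diagram as a basis element of the free vector space. -/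
def toFree {H : Type*} {n e : ℕ} (D : JacobiDiagram (Fin n) (Fin e) H) : FreeJacobi H :=
  Finsupp.single ⟨n, e, D⟩ 1

end JacobiDiagram

section Relations

variable {H : Type*} [AddCommGroup H] [Module ℚ H]

open JacobiDiagram

/-- The antisymmetry relation AS, the relation IHX (for an edge between the distinct vertices `u`
and `v`, in its cyclically symmetric form), and the multilinearity relations. -/
inductive LocalRelation : FreeJacobi H → Prop
  | antisymmetry {n e : ℕ} (D : JacobiDiagram (Fin n) (Fin e) H) (v : Fin n) :
      LocalRelation (D.toFree + (D.relabel (halfEdgeFlip v) (Equiv.refl _)).toFree)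
  | ihx {n e : ℕ} (D : JacobiDiagram (Fin n) (Fin e) H) (u v : Fin n) (huv : u ≠ v)
      (h : D.edge (u, 0) = (v, 0)) :
      LocalRelation (D.toFree + (D.relabel (halfEdgeCycle u v) (Equiv.refl _)).toFree
        + (D.relabel (halfEdgeCycle u v)⁻¹ (Equiv.refl _)).toFree)
  | add {n e : ℕ} (D : JacobiDiagram (Fin n) (Fin e) H) (k : Fin e) (x y : H) :
      LocalRelation ((D.setColor k (x + y)).toFree - (D.setColor k x).toFree
        - (D.setColor k y).toFree)
  | smul {n e : ℕ} (D : JacobiDiagram (Fin n) (Fin e) H) (k : Fin e) (q : ℚ) (x : H) :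
      LocalRelation ((D.setColor k (q • x)).toFree - q • (D.setColor k x).toFree)

/-- The relations between diagrams with unordered external vertices: diagrams that are isomorphic
are identified, and AS, IHX and multilinearity are imposed. -/
inductive UnorderedRelation : FreeJacobi H → Prop
  | of_local {x : FreeJacobi H} (hx : LocalRelation x) : UnorderedRelation x
  | iso {n n' e e' : ℕ} (D : JacobiDiagram (Fin n) (Fin e) H) (π : Fin n ≃ Fin n')
      (s : Fin n → Fin 3) (ψ : Fin e ≃ Fin e') :
      UnorderedRelation (D.toFree - (D.relabel (halfEdgeIso π s) ψ).toFree)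

/-- The relations between diagrams with totally ordered external vertices: diagrams are identified
if they are isomorphic through an isomorphism that preserves the order of the external vertices,
and AS, IHX, multilinearity and the STU-like relation are imposed.  In the latter, `i` and `j` are
consecutive external vertices, which are exchanged, respectively glued. -/
inductive OrderedRelation (ω : LinearMap.BilinForm ℚ H) : FreeJacobi H → Prop
  | of_local {x : FreeJacobi H} (hx : LocalRelation x) : OrderedRelation ω x
  | iso {n n' e e' : ℕ} (D : JacobiDiagram (Fin n) (Fin e) H) (π : Fin n ≃ Fin n')
      (s : Fin n → Fin 3) (ψ : Fin e ≃o Fin e') :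
      OrderedRelation ω (D.toFree - (D.relabel (halfEdgeIso π s) ψ.toEquiv).toFree)
  | stu {n m e : ℕ} (D : JacobiDiagram (Fin n) (Fin m) H) (i j : Fin m) (hij : i ≠ j)
      (hj : (i : ℕ) + 1 = j) (ψ : {k : Fin m // k ≠ i ∧ k ≠ j} ≃o Fin e) :
      OrderedRelation ω (D.toFree - (D.relabel (Equiv.refl _) (Equiv.swap i j)).toFree
        - ω (D.color i) (D.color j) •
          ((D.glue i j hij).relabel (Equiv.refl _) ψ.toEquiv).toFree)

variable (H) in
/-- The space `𝒜(H)`: Jacobi diagrams without strut component and with external vertices colored by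
`H`, modulo AS, IHX and multilinearity. -/
def UnorderedJacobi : Type _ :=
  FreeJacobi H ⧸ Submodule.span ℚ {x : FreeJacobi H | UnorderedRelation x}

/-- The space `𝒜^<(H)`: Jacobi diagrams without strut component and with external vertices totally
ordered and colored by `H`, modulo AS, IHX, STU-like and multilinearity. -/
def OrderedJacobi (ω : LinearMap.BilinForm ℚ H) : Type _ :=
  FreeJacobi H ⧸ Submodule.span ℚ {x : FreeJacobi H | OrderedRelation ω x}

instance : AddCommGroup (UnorderedJacobi H) :=
  inferInstanceAs (AddCommGroup (FreeJacobi H ⧸ Submodule.span ℚ {x | UnorderedRelation x}))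

instance : Module ℚ (UnorderedJacobi H) :=
  inferInstanceAs (Module ℚ (FreeJacobi H ⧸ Submodule.span ℚ {x | UnorderedRelation x}))

instance (ω : LinearMap.BilinForm ℚ H) : AddCommGroup (OrderedJacobi ω) :=
  inferInstanceAs (AddCommGroup (FreeJacobi H ⧸ Submodule.span ℚ {x | OrderedRelation ω x}))

instance (ω : LinearMap.BilinForm ℚ H) : Module ℚ (OrderedJacobi ω) :=
  inferInstanceAs (Module ℚ (FreeJacobi H ⧸ Submodule.span ℚ {x | OrderedRelation ω x}))

end Relations

namespace JacobiDiagram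

universe v

section Relabel

variable {I I' I'' I₁ I₂ I₃ E E' E'' : Type} {H : Type v}

theorem relabel_relabel (D : JacobiDiagram I E H) (φ : I × Fin 3 ≃ I' × Fin 3) (ψ : E ≃ E')
    (φ' : I' × Fin 3 ≃ I'' × Fin 3) (ψ' : E' ≃ E'') :
    (D.relabel φ ψ).relabel φ' ψ' = D.relabel (φ.trans φ') (ψ.trans ψ') := rfl

theorem setColor_relabel [DecidableEq E] [DecidableEq E'] (D : JacobiDiagram I E H) (k : E) (x : H)
    (φ : I × Fin 3 ≃ I' × Fin 3) (ψ : E ≃ E') :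
    (D.setColor k x).relabel φ ψ = (D.relabel φ ψ).setColor (ψ k) x := by
  ext1
  · rfl
  · rfl
  · funext j
    simp only [relabel, setColor, Function.update_apply, Equiv.symm_apply_eq]

/-- The bijection of the half-edges of a disjoint union given by bijections on both parts. -/
def sumHalf (φ : I × Fin 3 ≃ I₁ × Fin 3) (φ' : I' × Fin 3 ≃ I₂ × Fin 3) :
    (I ⊕ I') × Fin 3 ≃ (I₁ ⊕ I₂) × Fin 3 :=
  (Equiv.sumProdDistrib I I' (Fin 3)).trans
    ((Equiv.sumCongr φ φ').trans (Equiv.sumProdDistrib I₁ I₂ (Fin 3)).symm)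

theorem relabel_sum_relabel (D : JacobiDiagram I E H) (D' : JacobiDiagram I' E' H)
    {E₁ E₂ : Type}
    (φ : I × Fin 3 ≃ I₁ × Fin 3) (ψ : E ≃ E₁) (φ' : I' × Fin 3 ≃ I₂ × Fin 3) (ψ' : E' ≃ E₂) :
    (D.relabel φ ψ).sum (D'.relabel φ' ψ') =
      (D.sum D').relabel (sumHalf φ φ') (Equiv.sumCongr ψ ψ') := by
  ext1
  · funext h
    obtain ⟨h | h, i⟩ := h <;> simp [sum, relabel, sumHalf]
  · funext k
    rcases k with k | k <;> simp [sum, relabel, sumHalf]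
  · funext k
    rcases k with k | k <;> simp [sum, relabel]

/-- The bijection of half-edges used in the definition of `union`. -/
def unionHalf (n n' : ℕ) : (Fin n ⊕ Fin n') × Fin 3 ≃ Fin (n + n') × Fin 3 :=
  Equiv.prodCongr finSumFinEquiv (Equiv.refl _)

/-- The bijection of the half-edges of a union given by bijections on both parts. -/
def unionMap {n n' m m' : ℕ} (φ : Fin n × Fin 3 ≃ Fin m × Fin 3)
    (φ' : Fin n' × Fin 3 ≃ Fin m' × Fin 3) :
    Fin (n + n') × Fin 3 ≃ Fin (m + m') × Fin 3 :=
  (unionHalf n n').symm.trans ((sumHalf φ φ').trans (unionHalf m m'))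

/-- The bijection of the external vertices of a union given by bijections on both parts. -/
def unionExt {e e' f f' : ℕ} (ψ : Fin e ≃ Fin f) (ψ' : Fin e' ≃ Fin f') :
    Fin (e + e') ≃ Fin (f + f') :=
  finSumFinEquiv.symm.trans ((Equiv.sumCongr ψ ψ').trans finSumFinEquiv)

theorem relabel_union_relabel {n n' m m' e e' f f' : ℕ}
    (D : JacobiDiagram (Fin n) (Fin e) H) (D' : JacobiDiagram (Fin n') (Fin e') H)
    (φ : Fin n × Fin 3 ≃ Fin m × Fin 3) (ψ : Fin e ≃ Fin f)
    (φ' : Fin n' × Fin 3 ≃ Fin m' × Fin 3) (ψ' : Fin e' ≃ Fin f') :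
    (D.relabel φ ψ).union (D'.relabel φ' ψ') =
      (D.union D').relabel (unionMap φ φ') (unionExt ψ ψ') := by
  unfold union
  rw [relabel_sum_relabel, relabel_relabel, relabel_relabel]
  congr 1
  · ext1 x
    change _ = unionHalf m m' (sumHalf φ φ' ((unionHalf n n').symm (unionHalf n n' x)))
    rw [Equiv.symm_apply_apply]
    rfl
  · ext1 x
    simp [unionExt]

theorem relabel_refl (D : JacobiDiagram I E H) :
    D.relabel (Equiv.refl _) (Equiv.refl _) = D := rfl

theorem unionExt_refl (e e' : ℕ) :
    unionExt (Equiv.refl (Fin e)) (Equiv.refl (Fin e')) = Equiv.refl _ := by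
  ext1 x; simp [unionExt]

theorem unionMap_refl (n n' : ℕ) :
    unionMap (Equiv.refl (Fin n × Fin 3)) (Equiv.refl (Fin n' × Fin 3)) = Equiv.refl _ := by
  ext1 x
  obtain ⟨y, rfl⟩ := (unionHalf n n').surjective x
  obtain ⟨z, rfl⟩ := (Equiv.sumProdDistrib (Fin n) (Fin n') (Fin 3)).symm.surjective y
  rcases z with z | z <;> simp [unionMap, sumHalf]

theorem unionMap_swap_left {n n' : ℕ} (a b : Fin n × Fin 3) :
    unionMap (Equiv.swap a b) (Equiv.refl (Fin n' × Fin 3)) =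
      Equiv.swap (Fin.castAdd n' a.1, a.2) (Fin.castAdd n' b.1, b.2) := by
  have h : sumHalf (Equiv.swap a b) (Equiv.refl (Fin n' × Fin 3)) =
      Equiv.swap (Sum.inl a.1, a.2) (Sum.inl b.1, b.2) := by
    unfold sumHalf
    rw [show Equiv.sumCongr (Equiv.swap a b) (Equiv.refl (Fin n' × Fin 3)) = _ from
      Equiv.Perm.sumCongr_swap_refl a b, ← Equiv.trans_assoc]
    exact (Equiv.symm_trans_swap_trans _ _ (Equiv.sumProdDistrib _ _ (Fin 3)).symm)
  unfold unionMap
  rw [h, ← Equiv.trans_assoc, Equiv.symm_trans_swap_trans]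
  simp [unionHalf]

theorem unionMap_swap_right {n n' : ℕ} (a b : Fin n' × Fin 3) :
    unionMap (Equiv.refl (Fin n × Fin 3)) (Equiv.swap a b) =
      Equiv.swap (Fin.natAdd n a.1, a.2) (Fin.natAdd n b.1, b.2) := by
  have h : sumHalf (Equiv.refl (Fin n × Fin 3)) (Equiv.swap a b) =
      Equiv.swap (Sum.inr a.1, a.2) (Sum.inr b.1, b.2) := by
    unfold sumHalf
    rw [show Equiv.sumCongr (Equiv.refl (Fin n × Fin 3)) (Equiv.swap a b) = _ from
      Equiv.Perm.sumCongr_refl_swap a b, ← Equiv.trans_assoc]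
    exact (Equiv.symm_trans_swap_trans _ _ (Equiv.sumProdDistrib _ _ (Fin 3)).symm)
  unfold unionMap
  rw [h, ← Equiv.trans_assoc, Equiv.symm_trans_swap_trans]
  simp [unionHalf]

theorem unionExt_swap_left {e e' : ℕ} (a b : Fin e) :
    unionExt (Equiv.swap a b) (Equiv.refl (Fin e')) =
      Equiv.swap (Fin.castAdd e' a) (Fin.castAdd e' b) := by
  unfold unionExt
  rw [show Equiv.sumCongr (Equiv.swap a b) (Equiv.refl (Fin e')) = _ from
    Equiv.Perm.sumCongr_swap_refl a b, ← Equiv.trans_assoc, Equiv.symm_trans_swap_trans]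
  simp

theorem unionExt_swap_right {e e' : ℕ} (a b : Fin e') :
    unionExt (Equiv.refl (Fin e)) (Equiv.swap a b) =
      Equiv.swap (Fin.natAdd e a) (Fin.natAdd e b) := by
  unfold unionExt
  rw [show Equiv.sumCongr (Equiv.refl (Fin e)) (Equiv.swap a b) = _ from
    Equiv.Perm.sumCongr_refl_swap a b, ← Equiv.trans_assoc, Equiv.symm_trans_swap_trans]
  simp

theorem unionMap_trans {n n' m m' p p' : ℕ} (φ : Fin n × Fin 3 ≃ Fin m × Fin 3)
    (φ' : Fin n' × Fin 3 ≃ Fin m' × Fin 3) (χ : Fin m × Fin 3 ≃ Fin p × Fin 3)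
    (χ' : Fin m' × Fin 3 ≃ Fin p' × Fin 3) :
    (unionMap φ φ').trans (unionMap χ χ') = unionMap (φ.trans χ) (φ'.trans χ') := by
  ext1 x
  obtain ⟨y, rfl⟩ := (unionHalf n n').surjective x
  obtain ⟨z, rfl⟩ := (Equiv.sumProdDistrib (Fin n) (Fin n') (Fin 3)).symm.surjective y
  rcases z with z | z <;> simp [unionMap, sumHalf]

theorem unionMap_flip_left {n n' : ℕ} (v : Fin n) :
    unionMap (halfEdgeFlip v) (Equiv.refl (Fin n' × Fin 3)) = halfEdgeFlip (Fin.castAdd n' v) :=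
  unionMap_swap_left _ _

theorem unionMap_flip_right {n n' : ℕ} (v : Fin n') :
    unionMap (Equiv.refl (Fin n × Fin 3)) (halfEdgeFlip v) = halfEdgeFlip (Fin.natAdd n v) :=
  unionMap_swap_right _ _

theorem unionMap_cycle_left {n n' : ℕ} (u v : Fin n) :
    unionMap (halfEdgeCycle u v) (Equiv.refl (Fin n' × Fin 3)) =
      halfEdgeCycle (Fin.castAdd n' u) (Fin.castAdd n' v) := by
  have := unionMap_trans (Equiv.swap (u, 2) (v, 1)) (Equiv.refl (Fin n' × Fin 3))
    (Equiv.swap (u, 1) (u, 2)) (Equiv.refl (Fin n' × Fin 3))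
  rw [unionMap_swap_left, unionMap_swap_left] at this
  exact this.symm

theorem unionMap_cycle_right {n n' : ℕ} (u v : Fin n') :
    unionMap (Equiv.refl (Fin n × Fin 3)) (halfEdgeCycle u v) =
      halfEdgeCycle (Fin.natAdd n u) (Fin.natAdd n v) := by
  have := unionMap_trans (Equiv.refl (Fin n × Fin 3)) (Equiv.swap (u, 2) (v, 1))
    (Equiv.refl (Fin n × Fin 3)) (Equiv.swap (u, 1) (u, 2))
  rw [unionMap_swap_right, unionMap_swap_right] at this
  exact this.symm

theorem unionMap_symm {n n' m m' : ℕ} (φ : Fin n × Fin 3 ≃ Fin m × Fin 3)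
    (φ' : Fin n' × Fin 3 ≃ Fin m' × Fin 3) :
    unionMap φ.symm φ'.symm = (unionMap φ φ').symm := rfl

theorem unionMap_iso {n n' m m' : ℕ} (π : Fin n ≃ Fin m) (s : Fin n → Fin 3)
    (π' : Fin n' ≃ Fin m') (s' : Fin n' → Fin 3) :
    unionMap (halfEdgeIso π s) (halfEdgeIso π' s') =
      halfEdgeIso (unionExt π π') (Sum.elim s s' ∘ finSumFinEquiv.symm) := by
  ext1 x
  obtain ⟨y, rfl⟩ := (unionHalf n n').surjective x
  obtain ⟨z, rfl⟩ := (Equiv.sumProdDistrib (Fin n) (Fin n') (Fin 3)).symm.surjective y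
  rcases z with z | z <;> simp [unionMap, sumHalf, unionHalf, halfEdgeIso, unionExt]

theorem halfEdgeIso_refl (n : ℕ) :
    halfEdgeIso (Equiv.refl (Fin n)) 0 = Equiv.refl _ := by
  ext1 x; simp [halfEdgeIso]

theorem relabel_union_relabel_iso {n n' m m' e e' f f' : ℕ}
    (D : JacobiDiagram (Fin n) (Fin e) H) (D' : JacobiDiagram (Fin n') (Fin e') H)
    (π : Fin n ≃ Fin m) (s : Fin n → Fin 3) (ψ : Fin e ≃o Fin f)
    (π' : Fin n' ≃ Fin m') (s' : Fin n' → Fin 3) (ψ' : Fin e' ≃o Fin f') :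
    ∃ (π'' : Fin (n + n') ≃ Fin (m + m')) (s'' : Fin (n + n') → Fin 3)
      (ψ'' : Fin (e + e') ≃o Fin (f + f')),
      (D.relabel (halfEdgeIso π s) ψ.toEquiv).union (D'.relabel (halfEdgeIso π' s') ψ'.toEquiv) =
        (D.union D').relabel (halfEdgeIso π'' s'') ψ''.toEquiv := by
  obtain rfl : e = f := by simpa using Fintype.card_congr ψ.toEquiv
  obtain rfl : e' = f' := by simpa using Fintype.card_congr ψ'.toEquiv
  obtain rfl : ψ = OrderIso.refl _ := Subsingleton.elim _ _
  obtain rfl : ψ' = OrderIso.refl _ := Subsingleton.elim _ _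
  refine ⟨unionExt π π', Sum.elim s s' ∘ finSumFinEquiv.symm, OrderIso.refl _, ?_⟩
  rw [relabel_union_relabel, unionMap_iso]
  congr 1
  exact unionExt_refl e e'

theorem setColor_union {n n' e e' : ℕ} (D : JacobiDiagram (Fin n) (Fin e) H)
    (D' : JacobiDiagram (Fin n') (Fin e') H) (k : Fin e) (x : H) :
    (D.setColor k x).union D' = (D.union D').setColor (Fin.castAdd e' k) x := by
  have h : (D.setColor k x).sum D' = (D.sum D').setColor (Sum.inl k) x := by
    ext1
    · rfl
    · rfl
    · exact (Sum.update_elim_inl).symm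
  unfold union
  rw [h, setColor_relabel]
  simp

theorem union_setColor {n n' e e' : ℕ} (D : JacobiDiagram (Fin n) (Fin e) H)
    (D' : JacobiDiagram (Fin n') (Fin e') H) (k : Fin e') (x : H) :
    D.union (D'.setColor k x) = (D.union D').setColor (Fin.natAdd e k) x := by
  have h : D.sum (D'.setColor k x) = (D.sum D').setColor (Sum.inr k) x := by
    ext1
    · rfl
    · rfl
    · exact (Sum.update_elim_inr).symm
  unfold union
  rw [h, setColor_relabel]
  simp

theorem union_edge_castAdd {n n' e e' : ℕ} (D : JacobiDiagram (Fin n) (Fin e) H)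
    (D' : JacobiDiagram (Fin n') (Fin e') H) (h : Fin n × Fin 3) :
    (D.union D').edge (Fin.castAdd n' h.1, h.2) =
      (Fin.castAdd n' (D.edge h).1, (D.edge h).2) := by
  simp [union, relabel, sum]

theorem union_edge_natAdd {n n' e e' : ℕ} (D : JacobiDiagram (Fin n) (Fin e) H)
    (D' : JacobiDiagram (Fin n') (Fin e') H) (h : Fin n' × Fin 3) :
    (D.union D').edge (Fin.natAdd n h.1, h.2) =
      (Fin.natAdd n (D'.edge h).1, (D'.edge h).2) := by
  simp [union, relabel, sum]

theorem union_leg_castAdd {n n' e e' : ℕ} (D : JacobiDiagram (Fin n) (Fin e) H)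
    (D' : JacobiDiagram (Fin n') (Fin e') H) (k : Fin e) :
    (D.union D').leg (Fin.castAdd e' k) = (Fin.castAdd n' (D.leg k).1, (D.leg k).2) := by
  simp [union, relabel, sum]

theorem union_leg_natAdd {n n' e e' : ℕ} (D : JacobiDiagram (Fin n) (Fin e) H)
    (D' : JacobiDiagram (Fin n') (Fin e') H) (k : Fin e') :
    (D.union D').leg (Fin.natAdd e k) = (Fin.natAdd n (D'.leg k).1, (D'.leg k).2) := by
  simp [union, relabel, sum]

theorem union_color_castAdd {n n' e e' : ℕ} (D : JacobiDiagram (Fin n) (Fin e) H)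
    (D' : JacobiDiagram (Fin n') (Fin e') H) (k : Fin e) :
    (D.union D').color (Fin.castAdd e' k) = D.color k := by
  simp [union, relabel, sum]

theorem union_color_natAdd {n n' e e' : ℕ} (D : JacobiDiagram (Fin n) (Fin e) H)
    (D' : JacobiDiagram (Fin n') (Fin e') H) (k : Fin e') :
    (D.union D').color (Fin.natAdd e k) = D'.color k := by
  simp [union, relabel, sum]

theorem eq_relabel_of {n n' e e' : ℕ} {D₁ : JacobiDiagram (Fin n) (Fin e) H}
    {D₂ : JacobiDiagram (Fin n') (Fin e') H} (φ : Fin n' × Fin 3 ≃ Fin n × Fin 3)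
    (ψ : Fin e' ≃ Fin e)
    (h1 : ∀ h, D₁.edge (φ h) = φ (D₂.edge h)) (h2 : ∀ k, D₁.leg (ψ k) = φ (D₂.leg k))
    (h3 : ∀ k, D₁.color (ψ k) = D₂.color k) : D₁ = D₂.relabel φ ψ := by
  ext1
  · funext h
    simpa [relabel] using h1 (φ.symm h)
  · funext k
    simpa [relabel] using h2 (ψ.symm k)
  · funext k
    simpa [relabel] using h3 (ψ.symm k)

theorem union_assoc_iso {n n' n'' e e' e'' : ℕ} (D : JacobiDiagram (Fin n) (Fin e) H)
    (D' : JacobiDiagram (Fin n') (Fin e') H) (D'' : JacobiDiagram (Fin n'') (Fin e'') H) :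
    D.union (D'.union D'') = ((D.union D').union D'').relabel
      (halfEdgeIso (finCongr (Nat.add_assoc n n' n'')) 0)
      (Fin.castOrderIso (Nat.add_assoc e e' e'')).toEquiv := by
  set φ := halfEdgeIso (finCongr (Nat.add_assoc n n' n'')) 0 with hφ
  set ψ := (Fin.castOrderIso (Nat.add_assoc e e' e'')).toEquiv with hψ
  have p1 : ∀ (x : Fin n × Fin 3), φ (Fin.castAdd n'' (Fin.castAdd n' x.1), x.2) =
      (Fin.castAdd (n' + n'') x.1, x.2) := fun x => by
    simp [hφ, halfEdgeIso, Fin.ext_iff]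
  have p2 : ∀ (x : Fin n' × Fin 3), φ (Fin.castAdd n'' (Fin.natAdd n x.1), x.2) =
      (Fin.natAdd n (Fin.castAdd n'' x.1), x.2) := fun x => by
    simp [hφ, halfEdgeIso, Fin.ext_iff]
  have p3 : ∀ (x : Fin n'' × Fin 3), φ (Fin.natAdd (n + n') x.1, x.2) =
      (Fin.natAdd n (Fin.natAdd n' x.1), x.2) := fun x => by
    simp [hφ, halfEdgeIso, Fin.ext_iff, Nat.add_assoc]
  have q1 : ∀ k : Fin e, ψ (Fin.castAdd e'' (Fin.castAdd e' k)) = Fin.castAdd (e' + e'') k :=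
    fun k => by simp [hψ, Fin.ext_iff]
  have q2 : ∀ k : Fin e', ψ (Fin.castAdd e'' (Fin.natAdd e k)) =
      Fin.natAdd e (Fin.castAdd e'' k) := fun k => by simp [hψ, Fin.ext_iff]
  have q3 : ∀ k : Fin e'', ψ (Fin.natAdd (e + e') k) = Fin.natAdd e (Fin.natAdd e' k) :=
    fun k => by simp [hψ, Fin.ext_iff, Nat.add_assoc]
  apply eq_relabel_of
  · rintro ⟨h, i⟩
    induction h using Fin.addCases with
    | left h =>
      induction h using Fin.addCases with
      | left h =>
        rw [p1 (h, i), union_edge_castAdd D _ (h, i),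
          union_edge_castAdd (D.union D') D'' (Fin.castAdd n' h, i),
          union_edge_castAdd D D' (h, i), p1]
      | right h =>
        rw [p2 (h, i), union_edge_natAdd D _ (Fin.castAdd n'' h, i),
          union_edge_castAdd D' D'' (h, i),
          union_edge_castAdd (D.union D') D'' (Fin.natAdd n h, i),
          union_edge_natAdd D D' (h, i), p2]
    | right h =>
      rw [p3 (h, i), union_edge_natAdd D _ (Fin.natAdd n' h, i), union_edge_natAdd D' D'' (h, i),
        union_edge_natAdd (D.union D') D'' (h, i), p3]
  · intro k
    induction k using Fin.addCases with
    | left k =>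
      induction k using Fin.addCases with
      | left k => rw [q1, union_leg_castAdd, union_leg_castAdd, union_leg_castAdd, p1]
      | right k =>
        rw [q2, union_leg_natAdd, union_leg_castAdd, union_leg_castAdd, union_leg_natAdd, p2]
    | right k => rw [q3, union_leg_natAdd, union_leg_natAdd, union_leg_natAdd, p3]
  · intro k
    induction k using Fin.addCases with
    | left k =>
      induction k using Fin.addCases with
      | left k => rw [q1, union_color_castAdd, union_color_castAdd, union_color_castAdd]
      | right k =>
        rw [q2, union_color_natAdd, union_color_castAdd, union_color_castAdd, union_color_natAdd]
    | right k => rw [q3, union_color_natAdd, union_color_natAdd, union_color_natAdd]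

theorem empty_union_iso {n e : ℕ} (D : JacobiDiagram (Fin n) (Fin e) H) :
    D = ((empty H).union D).relabel (halfEdgeIso (finCongr (Nat.zero_add n)) 0)
      (Fin.castOrderIso (Nat.zero_add e)).toEquiv := by
  set φ := halfEdgeIso (finCongr (Nat.zero_add n)) 0 with hφ
  set ψ := (Fin.castOrderIso (Nat.zero_add e)).toEquiv with hψ
  have p : ∀ (x : Fin n × Fin 3), φ (Fin.natAdd 0 x.1, x.2) = x := fun x => by
    simp [hφ, halfEdgeIso]
  have q : ∀ k : Fin e, ψ (Fin.natAdd 0 k) = k := fun k => by simp [hψ]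
  apply eq_relabel_of
  · rintro ⟨h, i⟩
    induction h using Fin.addCases with
    | left h => exact h.elim0
    | right h => rw [p (h, i), union_edge_natAdd _ D (h, i), p]
  · intro k
    induction k using Fin.addCases with
    | left k => exact k.elim0
    | right k => rw [q, union_leg_natAdd, p]
  · intro k
    induction k using Fin.addCases with
    | left k => exact k.elim0
    | right k => rw [q, union_color_natAdd]

theorem union_empty_eq {n e : ℕ} (D : JacobiDiagram (Fin n) (Fin e) H) :
    D.union (empty H) = D := by
  ext1
  · funext h
    exact union_edge_castAdd D (empty H) h
  · funext k
    exact union_leg_castAdd D (empty H) k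
  · funext k
    exact union_color_castAdd D (empty H) k

theorem swap_castAdd {n n' : ℕ} (a b x : Fin n × Fin 3) :
    Equiv.swap (Fin.castAdd n' a.1, a.2) (Fin.castAdd n' b.1, b.2) (Fin.castAdd n' x.1, x.2) =
      (Fin.castAdd n' (Equiv.swap a b x).1, (Equiv.swap a b x).2) := by
  have hinj : Function.Injective fun y : Fin n × Fin 3 => (Fin.castAdd n' y.1, y.2) :=
    fun y z hyz => by simpa [Prod.ext_iff] using hyz
  exact (hinj.swap_apply a b x)

theorem swap_natAdd {n n' : ℕ} (a b x : Fin n × Fin 3) :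
    Equiv.swap (Fin.natAdd n' a.1, a.2) (Fin.natAdd n' b.1, b.2) (Fin.natAdd n' x.1, x.2) =
      (Fin.natAdd n' (Equiv.swap a b x).1, (Equiv.swap a b x).2) := by
  have hinj : Function.Injective fun y : Fin n × Fin 3 => (Fin.natAdd n' y.1, y.2) :=
    fun y z hyz => by simpa [Prod.ext_iff] using hyz
  exact (hinj.swap_apply a b x)

theorem exists_union_glue {n n' m m' e : ℕ} (D : JacobiDiagram (Fin n) (Fin m) H)
    (D' : JacobiDiagram (Fin n') (Fin m') H) (i j : Fin m) (hij : i ≠ j)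
    (hij' : Fin.castAdd m' i ≠ Fin.castAdd m' j)
    (ψ : {k : Fin m // k ≠ i ∧ k ≠ j} ≃o Fin e) :
    ∃ ψ' : {k : Fin (m + m') // k ≠ Fin.castAdd m' i ∧ k ≠ Fin.castAdd m' j} ≃o Fin (e + m'),
      ((D.glue i j hij).relabel (Equiv.refl _) ψ.toEquiv).union D' =
        ((D.union D').glue _ _ hij').relabel (Equiv.refl _) ψ'.toEquiv := by
  let f : Fin (e + m') → {k : Fin (m + m') // k ≠ Fin.castAdd m' i ∧ k ≠ Fin.castAdd m' j} :=
    Fin.addCases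
      (fun k => ⟨Fin.castAdd m' (ψ.symm k).1,
        fun h => (ψ.symm k).2.1 (by simpa [Fin.ext_iff] using h),
        fun h => (ψ.symm k).2.2 (by simpa [Fin.ext_iff] using h)⟩)
      (fun k => ⟨Fin.natAdd m k,
        fun h => by have := i.2; simp only [Fin.ext_iff, Fin.val_natAdd, Fin.val_castAdd] at h; omega,
        fun h => by have := j.2; simp only [Fin.ext_iff, Fin.val_natAdd, Fin.val_castAdd] at h; omega⟩)
  have f1 : ∀ k : Fin e, (f (Fin.castAdd m' k)).1 = Fin.castAdd m' (ψ.symm k).1 := fun k => by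
    simp [f]
  have f2 : ∀ k : Fin m', (f (Fin.natAdd e k)).1 = Fin.natAdd m k := fun k => by
    simp [f]
  have hf : StrictMono f := by
    intro a b hab
    rw [← Subtype.coe_lt_coe, Fin.lt_def]
    induction a using Fin.addCases with
    | left a =>
      induction b using Fin.addCases with
      | left b =>
        rw [f1, f1]
        have : a < b := Fin.lt_def.2 (Fin.lt_def.1 hab)
        exact ψ.symm.strictMono this
      | right b =>
        rw [f1, f2]
        have := (ψ.symm a).1.2
        simp only [Fin.val_natAdd, Fin.val_castAdd]; omega
    | right a =>
      induction b using Fin.addCases with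
      | left b =>
        have := b.2
        simp only [Fin.lt_def, Fin.val_natAdd, Fin.val_castAdd] at hab; omega
      | right b =>
        rw [f2, f2]
        have h1 : a < b := by
          simp only [Fin.lt_def, Fin.val_natAdd] at hab; omega
        simp only [Fin.val_natAdd]; omega
  have hs : Function.Surjective f := by
    rintro ⟨k, hk1, hk2⟩
    induction k using Fin.addCases with
    | left k =>
      refine ⟨Fin.castAdd m' (ψ ⟨k, fun h => hk1 (by rw [h]), fun h => hk2 (by rw [h])⟩), ?_⟩
      apply Subtype.ext
      rw [f1]
      simp
    | right k => exact ⟨Fin.natAdd e k, Subtype.ext (f2 k)⟩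
  refine ⟨(hf.orderIsoOfSurjective f hs).symm, ?_⟩
  ext1
  · funext ⟨h, x⟩
    change _ = Equiv.swap ((D.union D').leg _) ((D.union D').leg _) ((D.union D').edge (h, x))
    rw [union_leg_castAdd, union_leg_castAdd]
    induction h using Fin.addCases with
    | left h =>
      rw [union_edge_castAdd _ D' (h, x), union_edge_castAdd D D' (h, x), swap_castAdd]
      rfl
    | right h =>
      rw [union_edge_natAdd _ D' (h, x), union_edge_natAdd D D' (h, x),
        Equiv.swap_apply_of_ne_of_ne] <;>
      · intro hc
        have := congrArg (fun y => (y.1 : ℕ)) hc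
        simp only [Fin.val_natAdd, Fin.val_castAdd] at this
        omega
  · funext k
    change _ = (D.union D').leg (f k).1
    induction k using Fin.addCases with
    | left k => rw [f1, union_leg_castAdd, union_leg_castAdd]; rfl
    | right k => rw [f2, union_leg_natAdd, union_leg_natAdd]
  · funext k
    change _ = (D.union D').color (f k).1
    induction k using Fin.addCases with
    | left k => rw [f1, union_color_castAdd, union_color_castAdd]; rfl
    | right k => rw [f2, union_color_natAdd, union_color_natAdd]

theorem exists_glue_union {n n' m m' e : ℕ} (D : JacobiDiagram (Fin n) (Fin m) H)
    (D' : JacobiDiagram (Fin n') (Fin m') H) (i j : Fin m) (hij : i ≠ j)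
    (hij' : Fin.natAdd m' i ≠ Fin.natAdd m' j)
    (ψ : {k : Fin m // k ≠ i ∧ k ≠ j} ≃o Fin e) :
    ∃ ψ' : {k : Fin (m' + m) // k ≠ Fin.natAdd m' i ∧ k ≠ Fin.natAdd m' j} ≃o Fin (m' + e),
      D'.union ((D.glue i j hij).relabel (Equiv.refl _) ψ.toEquiv) =
        ((D'.union D).glue _ _ hij').relabel (Equiv.refl _) ψ'.toEquiv := by
  let f : Fin (m' + e) → {k : Fin (m' + m) // k ≠ Fin.natAdd m' i ∧ k ≠ Fin.natAdd m' j} :=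
    Fin.addCases
      (fun k => ⟨Fin.castAdd m k,
        fun h => by have := k.2; simp only [Fin.ext_iff, Fin.val_natAdd, Fin.val_castAdd] at h; omega,
        fun h => by have := k.2; simp only [Fin.ext_iff, Fin.val_natAdd, Fin.val_castAdd] at h; omega⟩)
      (fun k => ⟨Fin.natAdd m' (ψ.symm k).1,
        fun h => (ψ.symm k).2.1 (by simpa [Fin.ext_iff] using h),
        fun h => (ψ.symm k).2.2 (by simpa [Fin.ext_iff] using h)⟩)
  have f1 : ∀ k : Fin m', (f (Fin.castAdd e k)).1 = Fin.castAdd m k := fun k => by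
    simp [f]
  have f2 : ∀ k : Fin e, (f (Fin.natAdd m' k)).1 = Fin.natAdd m' (ψ.symm k).1 := fun k => by
    simp [f]
  have hf : StrictMono f := by
    intro a b hab
    rw [← Subtype.coe_lt_coe, Fin.lt_def]
    induction a using Fin.addCases with
    | left a =>
      induction b using Fin.addCases with
      | left b =>
        rw [f1, f1]
        exact Fin.lt_def.1 hab
      | right b =>
        rw [f1, f2]
        have := a.2
        simp only [Fin.val_natAdd, Fin.val_castAdd]; omega
    | right a =>
      induction b using Fin.addCases with
      | left b =>
        have := b.2
        simp only [Fin.lt_def, Fin.val_natAdd, Fin.val_castAdd] at hab; omega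
      | right b =>
        rw [f2, f2]
        have h1 : a < b := by
          simp only [Fin.lt_def, Fin.val_natAdd] at hab; omega
        have h2 : (ψ.symm a).1.val < (ψ.symm b).1.val := ψ.symm.strictMono h1
        simp only [Fin.val_natAdd]; omega
  have hs : Function.Surjective f := by
    rintro ⟨k, hk1, hk2⟩
    induction k using Fin.addCases with
    | left k => exact ⟨Fin.castAdd e k, Subtype.ext (f1 k)⟩
    | right k =>
      refine ⟨Fin.natAdd m' (ψ ⟨k, fun h => hk1 (by rw [h]), fun h => hk2 (by rw [h])⟩), ?_⟩
      apply Subtype.ext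
      rw [f2]
      simp
  refine ⟨(hf.orderIsoOfSurjective f hs).symm, ?_⟩
  ext1
  · funext ⟨h, x⟩
    change _ = Equiv.swap ((D'.union D).leg _) ((D'.union D).leg _) ((D'.union D).edge (h, x))
    rw [union_leg_natAdd, union_leg_natAdd]
    induction h using Fin.addCases with
    | left h =>
      rw [union_edge_castAdd D' _ (h, x), union_edge_castAdd D' D (h, x),
        Equiv.swap_apply_of_ne_of_ne] <;>
      · intro hc
        have := congrArg (fun y => (y.1 : ℕ)) hc
        simp only [Fin.val_natAdd, Fin.val_castAdd] at this
        omega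
    | right h =>
      rw [union_edge_natAdd D' _ (h, x), union_edge_natAdd D' D (h, x), swap_natAdd]
      rfl
  · funext k
    change _ = (D'.union D).leg (f k).1
    induction k using Fin.addCases with
    | left k => rw [f1, union_leg_castAdd, union_leg_castAdd]
    | right k => rw [f2, union_leg_natAdd, union_leg_natAdd]; rfl
  · funext k
    change _ = (D'.union D).color (f k).1
    induction k using Fin.addCases with
    | left k => rw [f1, union_color_castAdd, union_color_castAdd]
    | right k => rw [f2, union_color_natAdd, union_color_natAdd]; rfl

end Relabel

end JacobiDiagram

namespace OrderedJacobi

universe w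

variable {H : Type w} [AddCommGroup H] [Module ℚ H] {ω : LinearMap.BilinForm ℚ H}

/-- The canonical projection onto `𝒜^<(H)`. -/
def proj (ω : LinearMap.BilinForm ℚ H) : FreeJacobi H →ₗ[ℚ] OrderedJacobi ω :=
  Submodule.mkQ _

/-- The class of a diagram with totally ordered external vertices. -/
def cls (ω : LinearMap.BilinForm ℚ H) {n e : ℕ} (D : JacobiDiagram (Fin n) (Fin e) H) :
    OrderedJacobi ω :=
  proj ω D.toFree

theorem proj_eq_zero {x : FreeJacobi H} (hx : OrderedRelation ω x) : proj ω x = 0 :=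
  (Submodule.Quotient.mk_eq_zero _).2 (Submodule.subset_span hx)

theorem cls_iso {n n' e e' : ℕ} (D : JacobiDiagram (Fin n) (Fin e) H) (π : Fin n ≃ Fin n')
    (s : Fin n → Fin 3) (ψ : Fin e ≃o Fin e') :
    cls ω (D.relabel (halfEdgeIso π s) ψ.toEquiv) = cls ω D := by
  have h := proj_eq_zero (ω := ω) (OrderedRelation.iso D π s ψ)
  rw [map_sub, sub_eq_zero] at h
  exact h.symm

theorem cls_antisymmetry {n e : ℕ} (D : JacobiDiagram (Fin n) (Fin e) H) (v : Fin n) :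
    cls ω D + cls ω (D.relabel (halfEdgeFlip v) (Equiv.refl _)) = 0 := by
  have h := proj_eq_zero (ω := ω) (.of_local (.antisymmetry D v))
  rwa [map_add] at h

theorem cls_ihx {n e : ℕ} (D : JacobiDiagram (Fin n) (Fin e) H) (u v : Fin n) (huv : u ≠ v)
    (h : D.edge (u, 0) = (v, 0)) :
    cls ω D + cls ω (D.relabel (halfEdgeCycle u v) (Equiv.refl _))
      + cls ω (D.relabel (halfEdgeCycle u v)⁻¹ (Equiv.refl _)) = 0 := by
  have h := proj_eq_zero (ω := ω) (.of_local (.ihx D u v huv h))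
  rwa [map_add, map_add] at h

theorem cls_add {n e : ℕ} (D : JacobiDiagram (Fin n) (Fin e) H) (k : Fin e) (x y : H) :
    cls ω (D.setColor k (x + y)) - cls ω (D.setColor k x) - cls ω (D.setColor k y) = 0 := by
  have h := proj_eq_zero (ω := ω) (.of_local (.add D k x y))
  rwa [map_sub, map_sub] at h

theorem cls_smul {n e : ℕ} (D : JacobiDiagram (Fin n) (Fin e) H) (k : Fin e) (q : ℚ) (x : H) :
    cls ω (D.setColor k (q • x)) - q • cls ω (D.setColor k x) = 0 := by
  have h := proj_eq_zero (ω := ω) (.of_local (.smul D k q x))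
  rwa [map_sub, map_smul] at h

theorem cls_stu {n m e : ℕ} (D : JacobiDiagram (Fin n) (Fin m) H) (i j : Fin m) (hij : i ≠ j)
    (hj : (i : ℕ) + 1 = j) (ψ : {k : Fin m // k ≠ i ∧ k ≠ j} ≃o Fin e) :
    cls ω D - cls ω (D.relabel (Equiv.refl _) (Equiv.swap i j))
      - ω (D.color i) (D.color j) •
        cls ω ((D.glue i j hij).relabel (Equiv.refl _) ψ.toEquiv) = 0 := by
  have h := proj_eq_zero (ω := ω) (.stu D i j hij hj ψ)
  rwa [map_sub, map_sub, map_smul] at h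

open JacobiDiagram

/-- A function on diagrams that respects the relations defines a linear map. -/
def liftLin {M : Type*} [AddCommGroup M] [Module ℚ M]
    (f : (Σ n e : ℕ, JacobiDiagram (Fin n) (Fin e) H) → M)
    (hf : ∀ x, OrderedRelation ω x → Finsupp.linearCombination ℚ f x = 0) :
    OrderedJacobi ω →ₗ[ℚ] M :=
  Submodule.liftQ _ (Finsupp.linearCombination ℚ f) (Submodule.span_le.2 hf)

theorem linearCombination_toFree {H : Type w} {M : Type*} [AddCommGroup M] [Module ℚ M]
    (f : (Σ n e : ℕ, JacobiDiagram (Fin n) (Fin e) H) → M) {n e : ℕ}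
    (D : JacobiDiagram (Fin n) (Fin e) H) :
    Finsupp.linearCombination ℚ f D.toFree = f ⟨n, e, D⟩ := by
  simp [toFree]

theorem liftLin_cls {M : Type*} [AddCommGroup M] [Module ℚ M]
    (f : (Σ n e : ℕ, JacobiDiagram (Fin n) (Fin e) H) → M)
    (hf : ∀ x, OrderedRelation ω x → Finsupp.linearCombination ℚ f x = 0)
    {n e : ℕ} (D : JacobiDiagram (Fin n) (Fin e) H) :
    liftLin f hf (cls ω D) = f ⟨n, e, D⟩ :=
  linearCombination_toFree f D

theorem hom_ext {M : Type*} [AddCommGroup M] [Module ℚ M] {f g : OrderedJacobi ω →ₗ[ℚ] M}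
    (h : ∀ (n e : ℕ) (D : JacobiDiagram (Fin n) (Fin e) H), f (cls ω D) = g (cls ω D)) :
    f = g := by
  apply Submodule.linearMap_qext
  apply Finsupp.lhom_ext'
  rintro ⟨n, e, D⟩
  apply LinearMap.ext_ring
  exact h n e D

/-- Disjoint union on the left with a given diagram, with values in `𝒜^<(H)`. -/
def leftUnion (ω : LinearMap.BilinForm ℚ H) {n e : ℕ} (D : JacobiDiagram (Fin n) (Fin e) H) :
    OrderedJacobi ω →ₗ[ℚ] OrderedJacobi ω :=
  liftLin (fun D' => cls ω (D.union D'.2.2)) (by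
    rintro x (@⟨_, hx⟩ | ⟨D', π, s, ψ⟩ | ⟨D', i, j, hij, hj, ψ⟩)
    · rcases hx with (⟨D', v⟩ | ⟨D', u, v, huv, h⟩ | ⟨D', k, a, b⟩ | ⟨D', k, q, a⟩)
      · simp only [map_add, linearCombination_toFree]
        rw [← D.relabel_refl, relabel_union_relabel, unionMap_flip_right, unionExt_refl]
        exact cls_antisymmetry _ _
      · simp only [map_add, linearCombination_toFree]
        have h1 := relabel_union_relabel D D' (Equiv.refl _) (Equiv.refl _)
          (halfEdgeCycle u v) (Equiv.refl _)
        have h2 := relabel_union_relabel D D' (Equiv.refl _).symm (Equiv.refl _)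
          (halfEdgeCycle u v).symm (Equiv.refl _)
        rw [unionMap_cycle_right, unionExt_refl, relabel_refl] at h1
        rw [unionMap_symm, unionMap_cycle_right, unionExt_refl, Equiv.refl_symm, relabel_refl] at h2
        rw [h1]
        erw [h2]
        refine cls_ihx _ _ _ (fun hc => huv (by simpa [Fin.ext_iff] using hc)) ?_
        rw [union_edge_natAdd D D' (u, 0), h]
      · simp only [map_sub, linearCombination_toFree, union_setColor]
        exact cls_add _ _ _ _
      · simp only [map_sub, map_smul, linearCombination_toFree, union_setColor]
        exact cls_smul _ _ _ _
    · simp only [map_sub, linearCombination_toFree]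
      obtain ⟨π', s', ψ', h⟩ := relabel_union_relabel_iso D D' (Equiv.refl _) 0 (OrderIso.refl _)
        π s ψ
      rw [halfEdgeIso_refl] at h
      change (D.union _) = _ at h
      rw [h, cls_iso, sub_self]
    · simp only [map_sub, map_smul, linearCombination_toFree]
      have hij' : Fin.natAdd e i ≠ Fin.natAdd e j := fun hc => hij (by simpa [Fin.ext_iff] using hc)
      obtain ⟨ψ', hψ'⟩ := exists_glue_union D' D i j hij hij' ψ
      have h1 := relabel_union_relabel D D' (Equiv.refl _) (Equiv.refl _)
          (Equiv.refl _) (Equiv.swap i j)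
      rw [relabel_refl, unionExt_swap_right, unionMap_refl] at h1
      rw [hψ', h1]
      have h2 := cls_stu (ω := ω) (D.union D') _ _ hij' (by simp [← hj, Nat.add_assoc]) ψ'
      rw [union_color_natAdd, union_color_natAdd] at h2
      exact h2)

theorem leftUnion_cls {n e n' e' : ℕ} (D : JacobiDiagram (Fin n) (Fin e) H)
    (D' : JacobiDiagram (Fin n') (Fin e') H) :
    leftUnion ω D (cls ω D') = cls ω (D.union D') :=
  liftLin_cls _ _ D'

/-- The multiplication of `𝒜^<(H)`, induced by the disjoint union of diagrams. -/
def mulLin (ω : LinearMap.BilinForm ℚ H) :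
    OrderedJacobi ω →ₗ[ℚ] OrderedJacobi ω →ₗ[ℚ] OrderedJacobi ω :=
  liftLin (fun D => leftUnion ω D.2.2) (by
    rintro x hx
    refine hom_ext fun n e D' => ?_
    revert hx
    rintro (@⟨_, hx⟩ | ⟨D, π, s, ψ⟩ | ⟨D, i, j, hij, hj, ψ⟩)
    · rcases hx with (⟨D, v⟩ | ⟨D, u, v, huv, h⟩ | ⟨D, k, a, b⟩ | ⟨D, k, q, a⟩)
      · simp only [map_add, linearCombination_toFree, LinearMap.add_apply, leftUnion_cls,
          LinearMap.zero_apply]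
        rw [← D'.relabel_refl, relabel_union_relabel, unionMap_flip_left, unionExt_refl]
        exact cls_antisymmetry _ _
      · simp only [map_add, linearCombination_toFree, LinearMap.add_apply, leftUnion_cls,
          LinearMap.zero_apply]
        have h1 := relabel_union_relabel D D' (halfEdgeCycle u v) (Equiv.refl _)
          (Equiv.refl _) (Equiv.refl _)
        have h2 := relabel_union_relabel D D' (halfEdgeCycle u v).symm (Equiv.refl _)
          (Equiv.refl _).symm (Equiv.refl _)
        rw [unionMap_cycle_left, unionExt_refl, relabel_refl] at h1
        rw [unionMap_symm, unionMap_cycle_left, unionExt_refl, Equiv.refl_symm, relabel_refl] at h2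
        rw [h1]
        erw [h2]
        refine cls_ihx _ _ _ (fun hc => huv (by simpa [Fin.ext_iff] using hc)) ?_
        rw [union_edge_castAdd D D' (u, 0), h]
      · simp only [map_sub, linearCombination_toFree, LinearMap.sub_apply, leftUnion_cls,
          LinearMap.zero_apply, setColor_union]
        exact cls_add _ _ _ _
      · simp only [map_sub, map_smul, linearCombination_toFree, LinearMap.sub_apply,
          LinearMap.smul_apply, leftUnion_cls, LinearMap.zero_apply, setColor_union]
        exact cls_smul _ _ _ _
    · simp only [map_sub, linearCombination_toFree, LinearMap.sub_apply, leftUnion_cls,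
          LinearMap.zero_apply]
      obtain ⟨π', s', ψ', h⟩ := relabel_union_relabel_iso D D' π s ψ (Equiv.refl _) 0
        (OrderIso.refl _)
      rw [halfEdgeIso_refl] at h
      change (JacobiDiagram.union _ D') = _ at h
      rw [h, cls_iso, sub_self]
    · simp only [map_sub, map_smul, linearCombination_toFree, LinearMap.sub_apply,
          LinearMap.smul_apply, leftUnion_cls, LinearMap.zero_apply]
      have hij' : Fin.castAdd e i ≠ Fin.castAdd e j :=
        fun hc => hij (by simpa [Fin.ext_iff] using hc)
      obtain ⟨ψ', hψ'⟩ := exists_union_glue D D' i j hij hij' ψ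
      have h1 := relabel_union_relabel D D' (Equiv.refl _) (Equiv.swap i j)
          (Equiv.refl _) (Equiv.refl _)
      rw [relabel_refl, unionExt_swap_left, unionMap_refl] at h1
      rw [hψ', h1]
      have h2 := cls_stu (ω := ω) (D.union D') _ _ hij' (by simpa using hj) ψ'
      rw [union_color_castAdd, union_color_castAdd] at h2
      exact h2)

theorem mulLin_cls {n e n' e' : ℕ} (D : JacobiDiagram (Fin n) (Fin e) H)
    (D' : JacobiDiagram (Fin n') (Fin e') H) :
    mulLin ω (cls ω D) (cls ω D') = cls ω (D.union D') := by
  rw [mulLin, liftLin_cls, leftUnion_cls]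

theorem mulLin_assoc (x y z : OrderedJacobi ω) :
    mulLin ω (mulLin ω x y) z = mulLin ω x (mulLin ω y z) := by
  have h : ((LinearMap.llcomp ℚ _ _ _).comp (mulLin ω)).compl₂ (mulLin ω) =
      (mulLin ω).compr₂ (mulLin ω) := by
    refine hom_ext fun n e D => hom_ext fun n' e' D' => hom_ext fun n'' e'' D'' => ?_
    simp only [LinearMap.compl₂_apply, LinearMap.comp_apply, LinearMap.llcomp_apply,
      LinearMap.compr₂_apply, mulLin_cls]
    rw [union_assoc_iso, cls_iso]
  exact (congrArg (fun f => f x y z) h).symm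

theorem empty_mulLin (x : OrderedJacobi ω) : mulLin ω (cls ω (empty H)) x = x := by
  have h : mulLin ω (cls ω (empty H)) = LinearMap.id := by
    refine hom_ext fun n e D => ?_
    rw [mulLin_cls]
    conv_rhs => rw [empty_union_iso D]
    exact (cls_iso _ _ _ _).symm
  rw [h, LinearMap.id_apply]

theorem mulLin_empty (x : OrderedJacobi ω) : mulLin ω x (cls ω (empty H)) = x := by
  have h : (mulLin ω).flip (cls ω (empty H)) = LinearMap.id := by
    refine hom_ext fun n e D => ?_
    rw [LinearMap.flip_apply, mulLin_cls, union_empty_eq, LinearMap.id_apply]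
  exact congrArg (fun f => f x) h

/-- The ring structure of `𝒜^<(H)`: the product of two diagrams is their disjoint union, the
external vertices of the second one being larger than those of the first one, and the unit is the
empty diagram. -/
instance : Ring (OrderedJacobi ω) where
  __ := (inferInstance : AddCommGroup (OrderedJacobi ω))
  mul x y := mulLin ω x y
  one := cls ω (empty H)
  mul_assoc := mulLin_assoc
  one_mul := empty_mulLin
  mul_one := mulLin_empty
  left_distrib x y z := map_add (mulLin ω x) y z
  right_distrib x y z := LinearMap.map_add₂ (mulLin ω) x y z
  zero_mul x := LinearMap.map_zero₂ (mulLin ω) x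
  mul_zero x := map_zero (mulLin ω x)

instance : Algebra ℚ (OrderedJacobi ω) :=
  Algebra.ofModule (fun q x y => LinearMap.map_smul₂ (mulLin ω) q x y)
    (fun q x y => map_smul (mulLin ω x) q y)

/-- The part of internal degree `n`, spanned by the diagrams with `n` internal vertices. -/
def degreePart (ω : LinearMap.BilinForm ℚ H) (n : ℕ) : Submodule ℚ (OrderedJacobi ω) :=
  Submodule.span ℚ {x | ∃ (e : ℕ) (D : JacobiDiagram (Fin n) (Fin e) H), x = cls ω D}

end OrderedJacobi

namespace UnorderedJacobi

universe w

variable {H : Type w} [AddCommGroup H] [Module ℚ H]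

open JacobiDiagram

/-- The class of a diagram, the order of its external vertices being forgotten. -/
def cls {n e : ℕ} (D : JacobiDiagram (Fin n) (Fin e) H) : UnorderedJacobi H :=
  Submodule.mkQ (Submodule.span ℚ {x : FreeJacobi H | UnorderedRelation x}) D.toFree

variable (H) in
/-- The part of internal degree `n`, spanned by the diagrams with `n` internal vertices. -/
def degreePart (n : ℕ) : Submodule ℚ (UnorderedJacobi H) :=
  Submodule.span ℚ {x | ∃ (e : ℕ) (D : JacobiDiagram (Fin n) (Fin e) H), x = cls D}

/-- The average, in `𝒜^<(H)`, of all ways of ordering the external vertices of a diagram. -/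
def average (ω : LinearMap.BilinForm ℚ H) {n e : ℕ} (D : JacobiDiagram (Fin n) (Fin e) H) :
    OrderedJacobi ω :=
  (e.factorial : ℚ)⁻¹ •
    ∑ σ : Equiv.Perm (Fin e), OrderedJacobi.cls ω (D.relabel (Equiv.refl _) σ)

theorem average_relabel (ω : LinearMap.BilinForm ℚ H) {n n' e : ℕ}
    (D : JacobiDiagram (Fin n) (Fin e) H) (φ : Fin n × Fin 3 ≃ Fin n' × Fin 3)
    (τ : Equiv.Perm (Fin e)) :
    average ω (D.relabel φ τ) = (e.factorial : ℚ)⁻¹ •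
      ∑ σ : Equiv.Perm (Fin e), OrderedJacobi.cls ω (D.relabel φ σ) := by
  unfold average
  congr 1
  refine Fintype.sum_equiv (Equiv.mulRight τ) _ _ fun σ => ?_
  rw [relabel_relabel]
  rfl

/-- The symmetrization map `χ : 𝒜(H) → 𝒜^<(H)`. -/
def symmetrization (ω : LinearMap.BilinForm ℚ H) : UnorderedJacobi H →ₗ[ℚ] OrderedJacobi ω :=
  Submodule.liftQ _ (Finsupp.linearCombination ℚ fun D => average ω D.2.2)
    (Submodule.span_le.2 (by
      rintro x (@⟨_, hx⟩ | ⟨D, π, s, ψ⟩)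
      · change Finsupp.linearCombination ℚ _ x = 0
        rcases hx with (⟨D, v⟩ | ⟨D, u, v, huv, h⟩ | ⟨D, k, a, b⟩ | ⟨D, k, q, a⟩)
        · simp only [map_add, OrderedJacobi.linearCombination_toFree]
          rw [average_relabel, average, ← smul_add, ← Finset.sum_add_distrib]
          rw [Finset.sum_eq_zero, smul_zero]
          intro σ _
          exact OrderedJacobi.cls_antisymmetry (D.relabel (Equiv.refl _) σ) v
        · simp only [map_add, OrderedJacobi.linearCombination_toFree]
          rw [average_relabel, average_relabel, average, ← smul_add, ← smul_add,
            ← Finset.sum_add_distrib, ← Finset.sum_add_distrib]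
          rw [Finset.sum_eq_zero, smul_zero]
          intro σ _
          exact OrderedJacobi.cls_ihx (D.relabel (Equiv.refl _) σ) u v huv h
        · simp only [map_sub, OrderedJacobi.linearCombination_toFree]
          rw [average, average, average, ← smul_sub, ← smul_sub,
            ← Finset.sum_sub_distrib, ← Finset.sum_sub_distrib]
          rw [Finset.sum_eq_zero, smul_zero]
          intro σ _
          rw [setColor_relabel, setColor_relabel, setColor_relabel]
          exact OrderedJacobi.cls_add _ _ _ _
        · simp only [map_sub, map_smul, OrderedJacobi.linearCombination_toFree]
          rw [average, average, smul_comm q, ← smul_sub, Finset.smul_sum,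
            ← Finset.sum_sub_distrib]
          rw [Finset.sum_eq_zero, smul_zero]
          intro σ _
          rw [setColor_relabel, setColor_relabel]
          exact OrderedJacobi.cls_smul _ _ _ _
      · change Finsupp.linearCombination ℚ _ _ = 0
        simp only [map_sub, OrderedJacobi.linearCombination_toFree]
        rename_i n n' e e'
        obtain rfl : e = e' := by simpa using Fintype.card_congr ψ
        rw [average_relabel, average, sub_eq_zero]
        congr 1
        refine Finset.sum_congr rfl fun σ _ => ?_
        exact (OrderedJacobi.cls_iso (D.relabel (Equiv.refl _) σ) π s (OrderIso.refl _)).symm))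

theorem symmetrization_cls (ω : LinearMap.BilinForm ℚ H) {n e : ℕ}
    (D : JacobiDiagram (Fin n) (Fin e) H) :
    symmetrization ω (cls D) = (e.factorial : ℚ)⁻¹ •
      ∑ σ : Equiv.Perm (Fin e), OrderedJacobi.cls ω (D.relabel (Equiv.refl _) σ) :=
  OrderedJacobi.linearCombination_toFree (fun D => average ω D.2.2) D

/-- The multiplication `⋆` of symplectic Jacobi diagrams: the product of `𝒜^<(H)` pulled back by
the symmetrization map (which is bijective). -/
def star (ω : LinearMap.BilinForm ℚ H) (x y : UnorderedJacobi H) : UnorderedJacobi H :=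
  Function.invFun (symmetrization ω) (symmetrization ω x * symmetrization ω y)

end UnorderedJacobi

section Weyl

universe w

variable {V : Type w} [AddCommGroup V] [Module ℚ V]

/-- The relations `u ⊗ v - v ⊗ u = s(u, v)` in the tensor algebra. -/
inductive WeylRelation (s : LinearMap.BilinForm ℚ V) : TensorAlgebra ℚ V → TensorAlgebra ℚ V → Prop
  | of (u v : V) : WeylRelation s
      (TensorAlgebra.ι ℚ u * TensorAlgebra.ι ℚ v - TensorAlgebra.ι ℚ v * TensorAlgebra.ι ℚ u)
      (algebraMap ℚ _ (s u v))

/-- The Weyl algebra generated by a vector space `V` with a bilinear form `s`. -/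
def WeylAlgebra (s : LinearMap.BilinForm ℚ V) : Type w :=
  RingQuot (WeylRelation s)

namespace WeylAlgebra

instance (s : LinearMap.BilinForm ℚ V) : Ring (WeylAlgebra s) :=
  inferInstanceAs (Ring (RingQuot (WeylRelation s)))

instance (s : LinearMap.BilinForm ℚ V) : Algebra ℚ (WeylAlgebra s) :=
  inferInstanceAs (Algebra ℚ (RingQuot (WeylRelation s)))

/-- The canonical projection of the tensor algebra onto the Weyl algebra. -/
def proj (s : LinearMap.BilinForm ℚ V) : TensorAlgebra ℚ V →ₐ[ℚ] WeylAlgebra s :=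
  RingQuot.mkAlgHom ℚ (WeylRelation s)

/-- The multilinear map `(v₁, …, vₙ) ↦ (1/n!) ∑_σ v_{σ(1)} ⊗ ⋯ ⊗ v_{σ(n)}` with values in the Weyl
algebra. -/
def averageMultilinear (s : LinearMap.BilinForm ℚ V) (n : ℕ) :
    MultilinearMap ℚ (fun _ : Fin n => V) (WeylAlgebra s) :=
  (n.factorial : ℚ)⁻¹ • ∑ σ : Equiv.Perm (Fin n),
    ((proj s).toLinearMap.compMultilinearMap (TensorAlgebra.tprod ℚ V n)).domDomCongr σ

theorem averageMultilinear_apply (s : LinearMap.BilinForm ℚ V) {n : ℕ} (v : Fin n → V) :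
    averageMultilinear s n v = (n.factorial : ℚ)⁻¹ • ∑ σ : Equiv.Perm (Fin n),
      proj s (TensorAlgebra.tprod ℚ V n fun i => v (σ i)) := by
  simp [averageMultilinear]

theorem averageMultilinear_perm (s : LinearMap.BilinForm ℚ V) {n : ℕ} (v : Fin n → V)
    (τ : Equiv.Perm (Fin n)) :
    averageMultilinear s n (fun i => v (τ i)) = averageMultilinear s n v := by
  rw [averageMultilinear_apply, averageMultilinear_apply]
  congr 1
  exact Fintype.sum_equiv (Equiv.mulLeft τ) _ _ fun σ => rfl

/-- The linear extension of the maps `averageMultilinear` to the tensor algebra. -/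
def averageTensor (s : LinearMap.BilinForm ℚ V) : TensorAlgebra ℚ V →ₗ[ℚ] WeylAlgebra s :=
  (DirectSum.toModule ℚ ℕ _ fun n => PiTensorProduct.lift (averageMultilinear s n)) ∘ₗ
    (TensorAlgebra.equivDirectSum (R := ℚ) (M := V)).toLinearMap

theorem averageTensor_tprod (s : LinearMap.BilinForm ℚ V) {n : ℕ} (v : Fin n → V) :
    averageTensor s (TensorAlgebra.tprod ℚ V n v) = averageMultilinear s n v := by
  have h : TensorAlgebra.equivDirectSum (TensorAlgebra.tprod ℚ V n v) =
      DirectSum.of (fun n => PiTensorProduct ℚ fun _ : Fin n => V) n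
        (PiTensorProduct.tprod ℚ v) := TensorAlgebra.toDirectSum_tensorPower_tprod v
  simp only [averageTensor, LinearMap.comp_apply, AlgEquiv.toLinearMap_apply, h]
  erw [DirectSum.toModule_lof]
  simp

theorem tprod_append {p q : ℕ} (a : Fin p → V) (b : Fin q → V) :
    TensorAlgebra.tprod ℚ V (p + q) (Fin.append a b) =
      TensorAlgebra.tprod ℚ V p a * TensorAlgebra.tprod ℚ V q b := by
  simp only [TensorAlgebra.tprod_apply]
  rw [← List.prod_append, ← List.ofFn_fin_append]
  congr 2
  funext i
  induction i using Fin.addCases <;> simp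

theorem span_tprod : Submodule.span ℚ
    {x : TensorAlgebra ℚ V | ∃ (n : ℕ) (v : Fin n → V), x = TensorAlgebra.tprod ℚ V n v} = ⊤ := by
  rw [eq_top_iff]
  rintro x -
  induction x using TensorAlgebra.induction with
  | algebraMap r =>
    rw [Algebra.algebraMap_eq_smul_one]
    exact Submodule.smul_mem _ _ (Submodule.subset_span ⟨0, Fin.elim0, by simp⟩)
  | ι v => exact Submodule.subset_span ⟨1, fun _ => v, by simp⟩
  | mul a b ha hb =>
    have := Submodule.mul_mem_mul ha hb
    rw [Submodule.span_mul_span] at this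
    refine Submodule.span_mono ?_ this
    rintro _ ⟨_, ⟨n, v, rfl⟩, _, ⟨m, w, rfl⟩, rfl⟩
    exact ⟨n + m, Fin.append v w, (tprod_append v w).symm⟩
  | add a b ha hb => exact Submodule.add_mem _ ha hb

theorem averageTensor_comm (s : LinearMap.BilinForm ℚ V) (u v : V) (a b : TensorAlgebra ℚ V) :
    averageTensor s (a * (TensorAlgebra.ι ℚ u * TensorAlgebra.ι ℚ v) * b) =
      averageTensor s (a * (TensorAlgebra.ι ℚ v * TensorAlgebra.ι ℚ u) * b) := by
  have ha : a ∈ Submodule.span ℚ _ := (span_tprod (V := V)).symm ▸ Submodule.mem_top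
  have hb : b ∈ Submodule.span ℚ _ := (span_tprod (V := V)).symm ▸ Submodule.mem_top
  induction ha using Submodule.span_induction with
  | zero => simp
  | add x y _ _ hx hy => simp only [add_mul, map_add, hx, hy]
  | smul q x _ hx => simp only [smul_mul_assoc, map_smul, hx]
  | mem x hx =>
    obtain ⟨p, x, rfl⟩ := hx
    induction hb using Submodule.span_induction with
    | zero => simp
    | add x y _ _ hx hy => simp only [mul_add, map_add, hx, hy]
    | smul q x _ hx => simp only [mul_smul_comm, map_smul, hx]
    | mem y hy =>
      obtain ⟨q, y, rfl⟩ := hy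
      have h2 : ∀ u v : V, TensorAlgebra.ι ℚ u * TensorAlgebra.ι ℚ v =
          TensorAlgebra.tprod ℚ V 2 ![u, v] := fun u v => by simp [TensorAlgebra.tprod_apply]
      rw [h2, h2, ← tprod_append, ← tprod_append, ← tprod_append, ← tprod_append,
        averageTensor_tprod, averageTensor_tprod,
        ← averageMultilinear_perm s _ (Equiv.swap (Fin.castAdd q (Fin.natAdd p (0 : Fin 2)))
          (Fin.castAdd q (Fin.natAdd p (1 : Fin 2))))]
      congr 1
      funext i
      induction i using Fin.addCases with
      | left i =>
        induction i using Fin.addCases with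
        | left i =>
          rw [Equiv.swap_apply_of_ne_of_ne]
          · simp
          · simp [Fin.ext_iff]; omega
          · simp [Fin.ext_iff]; omega
        | right i =>
          fin_cases i
          · simp [Fin.append_left, Fin.append_right]
          · simp [Fin.append_left, Fin.append_right]
      | right i =>
        rw [Equiv.swap_apply_of_ne_of_ne]
        · simp
        · simp [Fin.ext_iff]; omega
        · simp [Fin.ext_iff]; omega

/-- The congruence used to descend `averageTensor` to the symmetric algebra. -/
def averageCon (s : LinearMap.BilinForm ℚ V) : RingCon (TensorAlgebra ℚ V) where
  r x y := ∀ a b, averageTensor s (a * x * b) = averageTensor s (a * y * b)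
  iseqv := ⟨fun _ _ _ => rfl, fun h a b => (h a b).symm, fun h h' a b => (h a b).trans (h' a b)⟩
  add' h h' a b := by simp only [mul_add, add_mul, map_add, h a b, h' a b]
  mul' {w x y z} h h' a b := by
    have h1 := h a (y * b)
    have h2 := h' (a * x) b
    simp only [← mul_assoc] at h1 h2 ⊢
    rw [h1, h2]

theorem averageTensor_eq (s : LinearMap.BilinForm ℚ V) {x y : TensorAlgebra ℚ V}
    (h : SymmetricAlgebra.algHom ℚ V x = SymmetricAlgebra.algHom ℚ V y) :
    averageTensor s x = averageTensor s y := by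
  have h1 : TensorAlgebra.symRingCon ℚ V x y := (RingCon.eq _).1 h
  have h2 : TensorAlgebra.symRingCon ℚ V ≤ averageCon s := by
    refine RingCon.ringConGen_le.2 ?_
    rintro _ _ ⟨u, v⟩
    exact averageTensor_comm s u v
  simpa using h2 h1 1 1

/-- The symmetrization map `χ : S(V) → 𝒲(V)`,
`v₁ ⋯ vₙ ↦ (1/n!) ∑_σ v_{σ(1)} ⊗ ⋯ ⊗ v_{σ(n)}`. -/
def symmetrization (s : LinearMap.BilinForm ℚ V) : SymmetricAlgebra ℚ V →ₗ[ℚ] WeylAlgebra s :=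
  Submodule.liftQ _ (averageTensor s) (fun x hx => by
      rw [LinearMap.mem_ker] at hx ⊢
      rw [averageTensor_eq s (y := 0) (by simpa using hx), map_zero]) ∘ₗ
    ((SymmetricAlgebra.algHom ℚ V).toLinearMap.quotKerEquivOfSurjective
      (SymmetricAlgebra.algHom_surjective ℚ V)).symm.toLinearMap

theorem symmetrization_prod (s : LinearMap.BilinForm ℚ V) {n : ℕ} (v : Fin n → V) :
    symmetrization s (∏ i, SymmetricAlgebra.ι ℚ V (v i)) =
      (n.factorial : ℚ)⁻¹ • ∑ σ : Equiv.Perm (Fin n),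
        (List.ofFn fun i => proj s (TensorAlgebra.ι ℚ (v (σ i)))).prod := by
  have h : ∏ i, SymmetricAlgebra.ι ℚ V (v i) =
      (SymmetricAlgebra.algHom ℚ V).toLinearMap (TensorAlgebra.tprod ℚ V n v) := by
    rw [AlgHom.toLinearMap_apply, TensorAlgebra.tprod_apply, map_list_prod, List.map_ofFn,
      List.prod_ofFn]
    rfl
  have h3 : ((SymmetricAlgebra.algHom ℚ V).toLinearMap.quotKerEquivOfSurjective
      (SymmetricAlgebra.algHom_surjective ℚ V)).symm
      ((SymmetricAlgebra.algHom ℚ V).toLinearMap (TensorAlgebra.tprod ℚ V n v)) =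
      Submodule.Quotient.mk (TensorAlgebra.tprod ℚ V n v) := by
    rw [LinearEquiv.symm_apply_eq]
    rfl
  rw [h, symmetrization, LinearMap.comp_apply, LinearEquiv.coe_coe, h3, Submodule.liftQ_apply,
    averageTensor_tprod, averageMultilinear_apply]
  congr 1
  refine Finset.sum_congr rfl fun σ _ => ?_
  rw [TensorAlgebra.tprod_apply, map_list_prod, List.map_ofFn]
  rfl

/-- The Moyal–Weyl product on `S(V)`: the product of the Weyl algebra pulled back by the
symmetrization map (which is bijective if `s` is alternating). -/
def moyal (s : LinearMap.BilinForm ℚ V) (a b : SymmetricAlgebra ℚ V) : SymmetricAlgebra ℚ V :=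
  Function.invFun (symmetrization s) (symmetrization s a * symmetrization s b)

/-- The extension of the Moyal–Weyl product to `S(V)[t]`, with `t` central. -/
def moyalPoly (s : LinearMap.BilinForm ℚ V) (p q : (SymmetricAlgebra ℚ V)[X]) :
    (SymmetricAlgebra ℚ V)[X] :=
  p.sum fun i a => q.sum fun j b => Polynomial.monomial (i + j) (moyal s a b)

/-- The extension `χ : S(V)[t] → 𝒲(V)[t]` of the symmetrization map, coefficient by
coefficient. -/
def symmetrizationPoly (s : LinearMap.BilinForm ℚ V) (p : (SymmetricAlgebra ℚ V)[X]) :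
    (WeylAlgebra s)[X] :=
  p.sum fun i a => Polynomial.monomial i (symmetrization s a)

end WeylAlgebra

end Weyl

/-- A metric on a Lie algebra over `ℚ`: a symmetric, non-degenerate, invariant bilinear form.  A
metrized Lie algebra is a finite-dimensional Lie algebra with a metric. -/
structure LieMetric (𝔤 : Type*) [LieRing 𝔤] [LieAlgebra ℚ 𝔤] where
  form : LinearMap.BilinForm ℚ 𝔤
  symm : ∀ x y, form x y = form y x
  nondegenerate : form.Nondegenerate
  invariant : ∀ x y z, form ⁅x, y⁆ z = form x ⁅y, z⁆

namespace JacobiDiagram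

/-- The edges joining two internal vertices, as unordered pairs of half-edges. -/
def internalEdges {n e : ℕ} {H : Type*} (D : JacobiDiagram (Fin n) (Fin e) H) :
    Finset (Sym2 (Fin n × Fin 3)) :=
  (Finset.univ.filter fun h => D.edge h ≠ h).image fun h => s(h, D.edge h)

end JacobiDiagram

section Weight

variable {𝔤 : Type*} [LieRing 𝔤] [LieAlgebra ℚ 𝔤] {H : Type*} [AddCommGroup H] [Module ℚ H]

/-- The symplectic form `κ ⊗ ω` on `𝔤 ⊗ H`. -/
abbrev LieMetric.tensorForm (κ : LieMetric 𝔤) (ω : LinearMap.BilinForm ℚ H) :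
    LinearMap.BilinForm ℚ (𝔤 ⊗[ℚ] H) :=
  LinearMap.BilinForm.tmul κ.form ω

/-- The coefficient of the `2`-tensor `K = ∑ i, bᵢ ⊗ bᵢ*` (with `b*` the basis that is dual to `b`
for `κ`) on `bᵢ ⊗ bⱼ`, as a function of the unordered pair `{i, j}`. -/
def LieMetric.casimirCoeff (κ : LieMetric 𝔤) {m : ℕ} (b : Module.Basis (Fin m) ℚ 𝔤) :
    Sym2 (Fin m) → ℚ :=
  Sym2.lift ⟨fun i j => κ.form (κ.form.dualBasis κ.nondegenerate b i)
    (κ.form.dualBasis κ.nondegenerate b j), fun _ _ => κ.symm _ _⟩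

/-- The tensor in `(𝔤 ⊗ H)^{⊗ e}` (inside the tensor algebra) associated to a diagram with external
vertices `1, …, e`: each internal vertex is replaced by the form `B(x, y, z) = κ([x, y], z)`, each
edge by the `2`-tensor `K ∈ 𝔤 ⊗ 𝔤` corresponding to `κ`, each external vertex keeps its color, and
contractions are performed.  It is written in a basis `b` of `𝔤`, by summing over all labelings `c`
of the half-edges by basis elements. -/
def weightTensor (κ : LieMetric 𝔤) {m : ℕ} (b : Module.Basis (Fin m) ℚ 𝔤) {n e : ℕ}
    (D : JacobiDiagram (Fin n) (Fin e) H) : TensorAlgebra ℚ (𝔤 ⊗[ℚ] H) :=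
  ∑ c : Fin n × Fin 3 → Fin m,
    ((∏ v : Fin n, κ.form ⁅b (c (v, 0)), b (c (v, 1))⁆ (b (c (v, 2)))) *
      ∏ p ∈ D.internalEdges, κ.casimirCoeff b (p.map c)) •
    TensorAlgebra.tprod ℚ (𝔤 ⊗[ℚ] H) e fun k =>
      κ.form.dualBasis κ.nondegenerate b (c (D.leg k)) ⊗ₜ[ℚ] D.color k

end Weight

end

/-! ### Polarization: powers of vectors span. -/

section Powers

/-! Bijectivity of χ on `S(V)`. Since χ(vⁿ) = vⁿ and the powers of vectors span the Weyl algebra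
(`span_range_pow_eq_top`, by polarization), χ is onto. Let a vector v act on `S(V)` as
multiplication by v plus half of the derivation extending s(v, ·). This is an action of the Weyl
algebra because s is alternating, and v · vⁿ = vⁿ⁺¹ because s(v, v) = 0. Hence χ(x) sends 1 to x
(`action_symmetrization`), and χ is injective.

Bijectivity of χ on diagrams. Two orderings of the same diagram differ, by STU, by diagrams with
fewer external vertices, so induction on their number gives surjectivity
(`cls_mem_range_symmetrization`). A left inverse is given by a Wick-type formula, `contraction`: sum
over all partial matchings of the external vertices, encoded as involutions μ, gluing every matched
pair with coefficient ½ω(x, y), where x colors the smaller vertex. It respects STU: exchanging two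
consecutive vertices affects only the matchings that pair them, whose coefficients change sign, and
½ω + ½ω = ω (`contraction_stu`). Averaging over all orders cancels every non-empty matching
(`sum_pairing_eq_zero`), so only the diagram itself remains.

The weight systems. Each relation between diagrams reflects a property of the metrized Lie algebra:
independence of the starting half-edge is the cyclic invariance of B, AS its antisymmetry, IHX the
Jacobi identity contracted along an edge (`weightTensor_ihx`), and STU the Weyl relation for κ ⊗ ω,
where the new edge contributes κ and the coefficient of STU contributes ω (`weightTensor_stu`).
Labelings of a disjoint union are pairs of labelings, so the ordered weight is multiplicative
(`weightTensor_union`). It commutes with χ because both sides average the same tensors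
(`symmetrization_algHom_weightTensor`). As χ is injective, multiplicativity passes to the unordered
weight, and non-vanishing passes from the unordered to the ordered one.

Non-triviality. An element of the symmetric algebra is a polynomial function, hence non-zero if some
value is. For a well-chosen linear form the tripod takes the value κ([p, q], r), and the diagram
with two vertices joined by two edges takes minus the value of the Killing form at (p, p). -/

theorem Submodule.coeff_mem_of_forall_sum_pow_smul_mem {M : Type*} [AddCommGroup M] [Module ℚ M]
    (P : Submodule ℚ M) {N : ℕ} (a : ℕ → M)
    (h : ∀ t : ℚ, ∑ k ∈ Finset.range N, t ^ k • a k ∈ P) {k : ℕ} (hk : k < N) : a k ∈ P := by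
  by_contra hc
  obtain ⟨f, hf, hP⟩ := Submodule.exists_le_ker_of_notMem hc
  refine hf ?_
  -- The form f kills `P`, so this rational polynomial vanishes at every rational t, of which there
  -- are infinitely many.
  have h1 : (∑ k ∈ Finset.range N, Polynomial.monomial k (f (a k)) : ℚ[X]) = 0 := by
    refine Polynomial.funext fun t => ?_
    have h2 := hP (h t)
    rw [LinearMap.mem_ker, map_sum] at h2
    simpa [Polynomial.eval_finsetSum, mul_comm] using h2
  have h3 := congrArg (fun p => Polynomial.coeff p k) h1
  simpa [Polynomial.finsetSum_coeff, Polynomial.coeff_monomial, hk] using h3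

theorem coeff_zero_linear_pow {A : Type*} [Ring A] (w v : A) (n : ℕ) :
    ((Polynomial.C w + Polynomial.C v * Polynomial.X) ^ n).coeff 0 = w ^ n := by
  induction n with
  | zero => simp
  | succ n ih => rw [pow_succ, Polynomial.mul_coeff_zero, ih, pow_succ]; simp

variable {A : Type*} [Ring A] [Algebra ℚ A]

theorem Polynomial.coeff_mem_of_forall_eval_mem (P : Submodule ℚ A) (p : A[X])
    (h : ∀ t : ℚ, p.eval (algebraMap ℚ A t) ∈ P) (k : ℕ) : p.coeff k ∈ P := by
  by_cases hk : k < p.natDegree + 1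
  · refine P.coeff_mem_of_forall_sum_pow_smul_mem (N := p.natDegree + 1) p.coeff (fun t => ?_) hk
    have := h t
    rw [Polynomial.eval_eq_sum_range] at this
    convert this using 2 with i
    rw [← map_pow, ← Algebra.commutes, Algebra.smul_def]
  · rw [Polynomial.coeff_eq_zero_of_natDegree_lt (by omega)]
    exact P.zero_mem

/-- The coefficient is the sum of the words wⁱ v wⁿ⁻ⁱ. Moving v to the front of such a word costs i
q wⁿ⁻¹, and these costs add up to n(n+1)/2. For n = 0 the truncated exponent is harmless, its
coefficient being zero. -/
theorem coeff_one_linear_pow {w v : A} {q : ℚ} (h : w * v = v * w + algebraMap ℚ A q) (n : ℕ) :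
    ((Polynomial.C w + Polynomial.C v * Polynomial.X) ^ (n + 1)).coeff 1 =
      (n + 1 : ℚ) • (v * w ^ n) + ((n + 1 : ℚ) * n / 2 * q) • w ^ (n - 1) := by
  induction n with
  | zero => simp
  | succ n ih =>
    rw [pow_succ', add_mul, Polynomial.coeff_add, Polynomial.coeff_C_mul, ih, mul_assoc,
      Polynomial.coeff_C_mul, Polynomial.coeff_X_mul, coeff_zero_linear_pow, mul_add,
      mul_smul_comm, mul_smul_comm, ← mul_assoc w v, h, add_mul, ← Algebra.smul_def]
    rcases n with _ | n
    · simp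
      module
    · simp only [Nat.add_sub_cancel, ← pow_succ', mul_assoc]
      push_cast
      module

/-- The coefficient of t in (w + tv)ⁿ⁺¹ lies in the span of the powers, and equals (n+1) v wⁿ up to
a multiple of a power of w. So the span is stable under left multiplication by generators and
contains 1. The case q = 0 covers symmetric algebras, the general case Weyl algebras. -/
theorem span_range_pow_eq_top {V : Type*} [AddCommGroup V] [Module ℚ V] (f : V →ₗ[ℚ] A)
    (hf : ∀ u v, ∃ q : ℚ, f u * f v = f v * f u + algebraMap ℚ A q)
    (hs : Function.Surjective (TensorAlgebra.lift ℚ f)) :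
    Submodule.span ℚ {x | ∃ (v : V) (n : ℕ), x = f v ^ n} = ⊤ := by
  set P := Submodule.span ℚ {x | ∃ (v : V) (n : ℕ), x = f v ^ n} with hP
  have hpow : ∀ v n, f v ^ n ∈ P := fun v n => Submodule.subset_span ⟨v, n, rfl⟩
  have h1 : ∀ v, ∀ x ∈ P, f v * x ∈ P := by
    intro v x hx
    induction hx using Submodule.span_induction with
    | zero => simp
    | add x y _ _ hx hy => rw [mul_add]; exact P.add_mem hx hy
    | smul q x _ hx => rw [mul_smul_comm]; exact P.smul_mem q hx
    | mem x hx =>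
      obtain ⟨w, n, rfl⟩ := hx
      obtain ⟨q, hq⟩ := hf w v
      have h2 := Polynomial.coeff_mem_of_forall_eval_mem P
        ((Polynomial.C (f w) + Polynomial.C (f v) * Polynomial.X) ^ (n + 1)) (fun t => by
          -- Evaluation is a ring homomorphism despite noncommutativity, because rational scalars
          -- are central.
          have h3 := map_pow (Polynomial.eval₂RingHom' (RingHom.id A) (algebraMap ℚ A t)
            (fun a => (Algebra.commutes t a).symm))
            (Polynomial.C (f w) + Polynomial.C (f v) * Polynomial.X) (n + 1)
          have h4 : Polynomial.eval₂RingHom' (RingHom.id A) (algebraMap ℚ A t)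
              (fun a => (Algebra.commutes t a).symm)
              (Polynomial.C (f w) + Polynomial.C (f v) * Polynomial.X) = f (w + t • v) := by
            rw [map_add, map_mul]
            simp only [Polynomial.eval₂RingHom', RingHom.coe_mk, MonoidHom.coe_mk, OneHom.coe_mk,
              Polynomial.eval₂_C, Polynomial.eval₂_X, RingHom.id_apply, map_add, map_smul]
            rw [← Algebra.commutes, Algebra.smul_def]
          rw [h4] at h3
          exact (congrArg (· ∈ P) h3).mpr (hpow _ _)) 1
      -- The power of w already lies in `P`, and n + 1 is invertible.
      rw [coeff_one_linear_pow hq, P.add_mem_iff_left (P.smul_mem _ (hpow _ _)),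
        P.smul_mem_iff (by positivity)] at h2
      exact h2
  have h2 : ∀ (x : TensorAlgebra ℚ V), ∀ y ∈ P, TensorAlgebra.lift ℚ f x * y ∈ P := by
    intro x
    induction x using TensorAlgebra.induction with
    | algebraMap r =>
      intro y hy
      rw [AlgHom.commutes, ← Algebra.smul_def]
      exact P.smul_mem _ hy
    | ι v => intro y hy; rw [TensorAlgebra.lift_ι_apply]; exact h1 v y hy
    | mul a b ha hb => intro y hy; rw [map_mul, mul_assoc]; exact ha _ (hb _ hy)
    | add a b ha hb => intro y hy; rw [map_add, add_mul]; exact P.add_mem (ha y hy) (hb y hy)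
  rw [eq_top_iff]
  rintro x -
  obtain ⟨y, rfl⟩ := hs x
  simpa using h2 y 1 (by simpa using hpow 0 0)

end Powers

/-! ### Derivations of the symmetric algebra. -/

noncomputable section

namespace SymmetricAlgebra

variable {V : Type*} [AddCommGroup V] [Module ℚ V]

/-- The derivation of the symmetric algebra that extends a linear form. -/
def linearDerivation (φ : V →ₗ[ℚ] ℚ) :
    Derivation ℚ (SymmetricAlgebra ℚ V) (SymmetricAlgebra ℚ V) :=
  -- The map v ↦ v + φ(v)ε into the dual numbers. The ε-part of an algebra map that lifts the
  -- identity is a derivation.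
  let F : SymmetricAlgebra ℚ V →ₐ[ℚ] TrivSqZeroExt (SymmetricAlgebra ℚ V) (SymmetricAlgebra ℚ V) :=
    SymmetricAlgebra.lift ((TrivSqZeroExt.inlAlgHom ℚ _ _).toLinearMap ∘ₗ SymmetricAlgebra.ι ℚ V +
      (TrivSqZeroExt.inrHom _ _).restrictScalars ℚ ∘ₗ Algebra.linearMap ℚ _ ∘ₗ φ)
  have hF : (TrivSqZeroExt.fstHom ℚ _ _).comp F = AlgHom.id ℚ _ := by
    apply SymmetricAlgebra.algHom_ext
    ext v
    simp [F]
  Derivation.mk' ((TrivSqZeroExt.sndHom _ _).restrictScalars ℚ ∘ₗ F.toLinearMap) (fun a b => by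
    have h : ∀ x, (F x).fst = x := fun x => congrArg (fun f => f x) hF
    simp [h, mul_comm])

theorem linearDerivation_ι (φ : V →ₗ[ℚ] ℚ) (v : V) :
    linearDerivation φ (SymmetricAlgebra.ι ℚ V v) = algebraMap ℚ _ (φ v) := by
  simp [linearDerivation, Algebra.algebraMap_eq_smul_one]

theorem derivation_ext {D D' : Derivation ℚ (SymmetricAlgebra ℚ V) (SymmetricAlgebra ℚ V)}
    (h : ∀ v, D (SymmetricAlgebra.ι ℚ V v) = D' (SymmetricAlgebra.ι ℚ V v)) : D = D' := by
  ext x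
  induction x using SymmetricAlgebra.induction with
  | algebraMap r => simp
  | ι v => exact h v
  | mul a b ha hb => simp [ha, hb]
  | add a b ha hb => simp [ha, hb]

/-- The commutator is again a derivation, and it kills the generators because a derivation kills
scalars. -/
theorem linearDerivation_comm (φ ψ : V →ₗ[ℚ] ℚ) (x : SymmetricAlgebra ℚ V) :
    linearDerivation φ (linearDerivation ψ x) = linearDerivation ψ (linearDerivation φ x) := by
  have h : ⁅linearDerivation φ, linearDerivation ψ⁆ = 0 := by
    apply derivation_ext
    intro v
    simp [Derivation.commutator_apply, linearDerivation_ι]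
  have := congrArg (fun D => D x) h
  simpa [Derivation.commutator_apply, sub_eq_zero] using this

theorem linearDerivation_add (φ ψ : V →ₗ[ℚ] ℚ) :
    linearDerivation (φ + ψ) = linearDerivation φ + linearDerivation ψ :=
  derivation_ext fun v => by simp [linearDerivation_ι]

theorem linearDerivation_smul (q : ℚ) (φ : V →ₗ[ℚ] ℚ) :
    linearDerivation (q • φ) = q • linearDerivation φ :=
  derivation_ext fun v => by simp [linearDerivation_ι, Algebra.smul_def]

end SymmetricAlgebra

/-! ### Symmetrization onto the Weyl algebra is bijective. -/

namespace WeylAlgebra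

variable {V : Type*} [AddCommGroup V] [Module ℚ V] (s : LinearMap.BilinForm ℚ V)

theorem proj_surjective : Function.Surjective (proj s) :=
  RingQuot.mkAlgHom_surjective ℚ _

theorem proj_ι_mul (u v : V) :
    proj s (TensorAlgebra.ι ℚ u) * proj s (TensorAlgebra.ι ℚ v) =
      proj s (TensorAlgebra.ι ℚ v) * proj s (TensorAlgebra.ι ℚ u) + algebraMap ℚ _ (s u v) := by
  have h : proj s (TensorAlgebra.ι ℚ u * TensorAlgebra.ι ℚ v -
      TensorAlgebra.ι ℚ v * TensorAlgebra.ι ℚ u) = proj s (algebraMap ℚ _ (s u v)) :=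
    RingQuot.mkAlgHom_rel ℚ (WeylRelation.of u v)
  rw [map_sub, map_mul, map_mul, sub_eq_iff_eq_add, AlgHom.commutes] at h
  rw [h, add_comm]

/-- With equal letters all n! orderings give the same word. -/
theorem symmetrization_ι_pow (v : V) (n : ℕ) :
    symmetrization s (SymmetricAlgebra.ι ℚ V v ^ n) = proj s (TensorAlgebra.ι ℚ v) ^ n := by
  have h := symmetrization_prod s (n := n) fun _ => v
  simp only [Finset.prod_const, Finset.card_univ, Fintype.card_fin, List.ofFn_const,
    List.prod_replicate, Finset.sum_const, Fintype.card_perm] at h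
  rw [h, ← Nat.cast_smul_eq_nsmul ℚ, smul_smul, inv_mul_cancel₀ (by positivity), one_smul]

theorem symmetrization_surjective : Function.Surjective (symmetrization s) := by
  rw [← LinearMap.range_eq_top, eq_top_iff, ← span_range_pow_eq_top
    ((proj s).toLinearMap ∘ₗ TensorAlgebra.ι ℚ) (fun u v => ⟨s u v, proj_ι_mul s u v⟩)
    (by
      convert proj_surjective s
      apply TensorAlgebra.hom_ext
      ext v
      simp), Submodule.span_le]
  rintro _ ⟨v, n, rfl⟩
  exact ⟨_, symmetrization_ι_pow s v n⟩

/-- The operator on the symmetric algebra by which a vector, as a generator of the Weyl algebra,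
acts. -/
def generatorAction : V →ₗ[ℚ] Module.End ℚ (SymmetricAlgebra ℚ V) where
  -- The factor ½ is forced: the commutator of the operators of u and v is ½ s(u, v) − ½ s(v, u),
  -- which is s(u, v) when s is alternating.
  toFun u := LinearMap.mulLeft ℚ (SymmetricAlgebra.ι ℚ V u) +
    (2 : ℚ)⁻¹ • (SymmetricAlgebra.linearDerivation (s u)).toLinearMap
  map_add' u v := by
    ext x
    simp [SymmetricAlgebra.linearDerivation_add, add_mul]
    abel
  map_smul' q u := by
    ext x
    simp [SymmetricAlgebra.linearDerivation_smul, smul_comm q]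

theorem generatorAction_apply (u : V) (x : SymmetricAlgebra ℚ V) :
    generatorAction s u x = SymmetricAlgebra.ι ℚ V u * x +
      (2 : ℚ)⁻¹ • SymmetricAlgebra.linearDerivation (s u) x := rfl

variable {s}

/-- The action of the Weyl algebra of an alternating form on the symmetric algebra. -/
def action (hs : s.IsAlt) : WeylAlgebra s →ₐ[ℚ] Module.End ℚ (SymmetricAlgebra ℚ V) :=
  RingQuot.liftAlgHom ℚ ⟨TensorAlgebra.lift ℚ (generatorAction s), by
    rintro _ _ ⟨u, v⟩
    have huv : s v u = - s u v := (hs.neg_eq u v).symm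
    ext x
    simp only [map_sub, map_mul, TensorAlgebra.lift_ι_apply, LinearMap.sub_apply,
      Module.End.mul_apply, generatorAction_apply, map_add, Derivation.leibniz,
      SymmetricAlgebra.linearDerivation_ι, AlgHom.commutes, Module.algebraMap_end_apply,
      huv, SymmetricAlgebra.linearDerivation_comm (s u) (s v), smul_eq_mul, map_neg,
      Algebra.smul_def, Derivation.map_algebraMap]
    have h2 : (algebraMap ℚ (SymmetricAlgebra ℚ V) 2⁻¹) * 2 = 1 := by
      rw [← map_ofNat (algebraMap ℚ (SymmetricAlgebra ℚ V)) 2, ← map_mul]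
      norm_num
    linear_combination (x * algebraMap ℚ (SymmetricAlgebra ℚ V) (s u v)) * h2⟩

theorem action_proj_ι (hs : s.IsAlt) (v : V) :
    action hs (proj s (TensorAlgebra.ι ℚ v)) = generatorAction s v := by
  have h : action hs (proj s (TensorAlgebra.ι ℚ v)) =
      TensorAlgebra.lift ℚ (generatorAction s) (TensorAlgebra.ι ℚ v) :=
    RingQuot.liftAlgHom_mkAlgHom_apply _ _ _ _
  rw [h, TensorAlgebra.lift_ι_apply]

/-- It is enough to treat x = vⁿ. There the derivation part of each factor v contributes a multiple
of s(v, v) = 0, so v acts on powers of v by plain multiplication. -/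
theorem action_symmetrization (hs : s.IsAlt) (x : SymmetricAlgebra ℚ V) :
    action hs (symmetrization s x) 1 = x := by
  have hx : x ∈ Submodule.span ℚ _ := (span_range_pow_eq_top (SymmetricAlgebra.ι ℚ V)
    (fun u v => ⟨0, by rw [mul_comm]; simp⟩) (by
      convert SymmetricAlgebra.algHom_surjective ℚ V
      apply TensorAlgebra.hom_ext
      ext v
      simp [SymmetricAlgebra.ι])).symm ▸ Submodule.mem_top
  induction hx using Submodule.span_induction with
  | zero => simp
  | add x y _ _ hx hy => simp only [map_add, LinearMap.add_apply, hx, hy]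
  | smul q x _ hx => simp only [map_smul, LinearMap.smul_apply, hx]
  | mem x hx =>
    obtain ⟨v, n, rfl⟩ := hx
    rw [symmetrization_ι_pow, map_pow, action_proj_ι]
    induction n with
    | zero => simp
    | succ n ih =>
      rw [pow_succ', Module.End.mul_apply, ih, generatorAction_apply, Derivation.leibniz_pow,
        SymmetricAlgebra.linearDerivation_ι, hs v, pow_succ']
      simp

theorem symmetrization_bijective (hs : s.IsAlt) : Function.Bijective (symmetrization s) :=
  ⟨Function.LeftInverse.injective (g := fun y => action hs y 1) (action_symmetrization hs),
    symmetrization_surjective s⟩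

theorem nontrivial_of_isAlt (hs : s.IsAlt) : Nontrivial (WeylAlgebra s) :=
  (symmetrization_bijective hs).1.nontrivial

variable (s) in
theorem symmetrization_moyal (a b : SymmetricAlgebra ℚ V) :
    symmetrization s (moyal s a b) = symmetrization s a * symmetrization s b :=
  -- Surjectivity alone makes `invFun` a right inverse.
  Function.rightInverse_invFun (symmetrization_surjective s) _

theorem symmetrizationPoly_coeff (p : (SymmetricAlgebra ℚ V)[X]) (n : ℕ) :
    (symmetrizationPoly s p).coeff n = symmetrization s (p.coeff n) := by
  rw [symmetrizationPoly, Polynomial.sum_def, Polynomial.finsetSum_coeff]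
  simp only [Polynomial.coeff_monomial, Finset.sum_ite_eq', Polynomial.mem_support_iff]
  split_ifs with h
  · rfl
  · rw [Polynomial.notMem_support_iff.1 h, map_zero]

theorem symmetrizationPoly_monomial (n : ℕ) (a : SymmetricAlgebra ℚ V) :
    symmetrizationPoly s (Polynomial.monomial n a) =
      Polynomial.monomial n (symmetrization s a) := by
  ext k
  rw [symmetrizationPoly_coeff, Polynomial.coeff_monomial, Polynomial.coeff_monomial]
  split_ifs <;> simp

theorem symmetrizationPoly_add (p q : (SymmetricAlgebra ℚ V)[X]) :
    symmetrizationPoly s (p + q) = symmetrizationPoly s p + symmetrizationPoly s q := by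
  ext k
  simp [symmetrizationPoly_coeff]

theorem symmetrizationPoly_smul (c : ℚ) (q : (SymmetricAlgebra ℚ V)[X]) :
    symmetrizationPoly s (c • q) = c • symmetrizationPoly s q := by
  ext k
  simp [symmetrizationPoly_coeff]

variable (s) in
/-- The map `symmetrizationPoly` as a linear map. -/
def symmetrizationPolyLin : (SymmetricAlgebra ℚ V)[X] →ₗ[ℚ] (WeylAlgebra s)[X] where
  toFun := symmetrizationPoly s
  map_add' := symmetrizationPoly_add
  map_smul' := symmetrizationPoly_smul

theorem symmetrizationPoly_injective (hs : s.IsAlt) :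
    Function.Injective (symmetrizationPoly s) := by
  intro p q h
  ext k
  apply (symmetrization_bijective hs).1
  rw [← symmetrizationPoly_coeff, h, symmetrizationPoly_coeff]

/-- Both products are computed monomial by monomial, t being central, which reduces the claim to
`symmetrization_moyal`. -/
theorem symmetrizationPoly_moyalPoly (p q : (SymmetricAlgebra ℚ V)[X]) :
    symmetrizationPoly s (moyalPoly s p q) = symmetrizationPoly s p * symmetrizationPoly s q := by
  change symmetrizationPolyLin s _ = _
  rw [moyalPoly, Polynomial.sum_def, map_sum, symmetrizationPoly, symmetrizationPoly,
    Polynomial.sum_def, Polynomial.sum_def, Finset.sum_mul]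
  refine Finset.sum_congr rfl fun i _ => ?_
  rw [Polynomial.sum_def, map_sum, Finset.mul_sum]
  refine Finset.sum_congr rfl fun j _ => ?_
  rw [Polynomial.monomial_mul_monomial, ← symmetrization_moyal s]
  exact symmetrizationPoly_monomial _ _

end WeylAlgebra

end

/-! ### Gluing external vertices along an involution. -/

noncomputable section

namespace JacobiDiagram

universe u

variable {I I' E E' : Type} {H : Type u}

/-- Unlike `eq_relabel_of`, the vertices may form arbitrary types: gluing leaves a subtype of the
external vertices. -/
theorem eq_relabel {D₁ : JacobiDiagram I' E' H} {D₂ : JacobiDiagram I E H}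
    (φ : I × Fin 3 ≃ I' × Fin 3) (ψ : E ≃ E')
    (h1 : ∀ h, D₁.edge (φ h) = φ (D₂.edge h)) (h2 : ∀ k, D₁.leg (ψ k) = φ (D₂.leg k))
    (h3 : ∀ k, D₁.color (ψ k) = D₂.color k) : D₁ = D₂.relabel φ ψ := by
  ext1
  · funext h
    simpa [relabel] using h1 (φ.symm h)
  · funext k
    simpa [relabel] using h2 (ψ.symm k)
  · funext k
    simpa [relabel] using h3 (ψ.symm k)

theorem edge_leg (D : JacobiDiagram I E H) (k : E) : D.edge (D.leg k) = D.leg k :=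
  (D.edge_eq_self_iff _).2 ⟨k, rfl⟩

theorem edge_ne_leg (D : JacobiDiagram I E H) {h : I × Fin 3} (hh : ∀ k, D.leg k ≠ h) (k : E) :
    D.leg k ≠ D.edge h := fun hc => hh k (by
  have := congrArg D.edge hc
  rw [D.edge_edge, D.edge_leg] at this
  exact this)

/-- The embedding of the external vertices into the half-edges. -/
def legEmbedding (D : JacobiDiagram I E H) : E ↪ I × Fin 3 := ⟨D.leg, D.leg_injective⟩

theorem viaEmbedding_leg (D : JacobiDiagram I E H) (μ : Equiv.Perm E) (k : E) :
    μ.viaEmbedding D.legEmbedding (D.leg k) = D.leg (μ k) :=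
  μ.viaEmbedding_apply D.legEmbedding k

theorem viaEmbedding_of_ne_leg (D : JacobiDiagram I E H) (μ : Equiv.Perm E) {h : I × Fin 3}
    (hh : ∀ k, D.leg k ≠ h) : μ.viaEmbedding D.legEmbedding h = h :=
  μ.viaEmbedding_apply_of_notMem D.legEmbedding h (by rintro ⟨k, hk⟩; exact hh k hk)

/-- The diagram obtained by gluing the external vertices `k` and `μ k` whenever they are distinct,
where `μ` is an involution of the external vertices. -/
def glueAlong (D : JacobiDiagram I E H) (μ : Equiv.Perm E) (hμ : μ * μ = 1) :
    JacobiDiagram I {k : E // μ k = k} H where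
  -- `viaEmbedding` extends μ to all half-edges by the identity off the legs. Matched legs become
  -- the two ends of an edge, and legs at fixed points stay legs.
  edge h := μ.viaEmbedding D.legEmbedding (D.edge h)
  leg k := D.leg k
  color k := D.color k
  edge_edge h := by
    by_cases hh : ∃ k, D.leg k = h
    · obtain ⟨k, rfl⟩ := hh
      have : μ (μ k) = k := Equiv.congr_fun hμ k
      rw [edge_leg, viaEmbedding_leg, edge_leg, viaEmbedding_leg, this]
    · rw [not_exists] at hh
      rw [viaEmbedding_of_ne_leg _ _ (D.edge_ne_leg hh), D.edge_edge,
        viaEmbedding_of_ne_leg _ _ hh]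
  leg_injective a b hab := Subtype.ext (D.leg_injective hab)
  edge_eq_self_iff h := by
    by_cases hh : ∃ k, D.leg k = h
    · obtain ⟨k, rfl⟩ := hh
      rw [edge_leg, viaEmbedding_leg, D.leg_injective.eq_iff]
      refine ⟨fun hk => ⟨⟨k, hk⟩, rfl⟩, ?_⟩
      rintro ⟨⟨l, hl⟩, hk⟩
      obtain rfl := D.leg_injective hk
      exact hl
    · have hh' := hh
      rw [not_exists] at hh
      rw [viaEmbedding_of_ne_leg _ _ (D.edge_ne_leg hh), D.edge_eq_self_iff]
      exact ⟨fun h => absurd h hh', fun ⟨k, hk⟩ => absurd ⟨_, hk⟩ hh'⟩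

section

variable (D : JacobiDiagram I E H) {μ : Equiv.Perm E} (hμ : μ * μ = 1)

theorem glueAlong_edge_leg (k : E) : (D.glueAlong μ hμ).edge (D.leg k) = D.leg (μ k) := by
  change μ.viaEmbedding D.legEmbedding (D.edge (D.leg k)) = _
  rw [edge_leg, viaEmbedding_leg]

theorem glueAlong_edge_of_ne {h : I × Fin 3} (hh : ∀ k, D.leg k ≠ h) :
    (D.glueAlong μ hμ).edge h = D.edge h :=
  viaEmbedding_of_ne_leg _ _ (D.edge_ne_leg hh)

theorem glueAlong_relabel (φ : I × Fin 3 ≃ I' × Fin 3) (ψ : E ≃ E') {ν : Equiv.Perm E'}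
    (hν : ν * ν = 1) (h : ∀ k, ν (ψ k) = ψ (μ k)) :
    (D.relabel φ ψ).glueAlong ν hν = (D.glueAlong μ hμ).relabel φ
      (ψ.subtypeEquiv fun k => by rw [h, ψ.injective.eq_iff]) := by
  have hleg : ∀ k, (D.relabel φ ψ).leg (ψ k) = φ (D.leg k) := fun k => by simp [relabel]
  apply eq_relabel
  · intro x
    by_cases hx : ∃ k, D.leg k = x
    · obtain ⟨k, rfl⟩ := hx
      rw [glueAlong_edge_leg, ← hleg, ← hleg, glueAlong_edge_leg, h]
    · rw [not_exists] at hx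
      rw [glueAlong_edge_of_ne _ _ hx, glueAlong_edge_of_ne]
      · simp [relabel]
      · intro k
        obtain ⟨k, rfl⟩ := ψ.surjective k
        rw [hleg, ne_eq, φ.injective.eq_iff]
        exact hx k
  · intro k
    exact hleg k
  · intro k
    simp [glueAlong, relabel]

theorem glueAlong_one_eq : D.glueAlong 1 (one_mul 1) =
    D.relabel (Equiv.refl _)
      (Equiv.subtypeUnivEquiv (p := fun k => (1 : Equiv.Perm E) k = k) fun _ => rfl).symm := by
  apply eq_relabel
  · intro x
    by_cases hx : ∃ k, D.leg k = x
    · obtain ⟨k, rfl⟩ := hx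
      change (D.glueAlong 1 (one_mul 1)).edge (D.leg k) = _
      rw [glueAlong_edge_leg, edge_leg]
      rfl
    · rw [not_exists] at hx
      exact glueAlong_edge_of_ne _ _ hx
  · intro k; rfl
  · intro k; rfl

theorem glueAlong_relabel_left (φ : I × Fin 3 ≃ I' × Fin 3) :
    (D.relabel φ (Equiv.refl _)).glueAlong μ hμ =
      (D.glueAlong μ hμ).relabel φ (Equiv.refl _) :=
  glueAlong_relabel D hμ φ (Equiv.refl _) hμ fun _ => rfl

variable [DecidableEq E]

theorem glueAlong_setColor_of_eq {k : E} (hk : μ k = k) (x : H) :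
    (D.setColor k x).glueAlong μ hμ = (D.glueAlong μ hμ).setColor ⟨k, hk⟩ x := by
  ext1
  · rfl
  · rfl
  · funext l
    simp [glueAlong, setColor, Function.update_apply, Subtype.ext_iff]

/-- A glued vertex disappears, and its color with it; that color survives only in the coefficient
`pairing`. -/
theorem glueAlong_setColor_of_ne {k : E} (hk : μ k ≠ k) (x : H) :
    (D.setColor k x).glueAlong μ hμ = D.glueAlong μ hμ := by
  ext1
  · rfl
  · rfl
  · funext l
    have : (l : E) ≠ k := fun hc => hk (hc ▸ l.2)
    simp [glueAlong, setColor, Function.update_apply, this]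

end

/-- Conjugation of involutions by a bijection. -/
def conjInvolution (ψ : E ≃ E') :
    {μ : Equiv.Perm E // μ * μ = 1} ≃ {μ : Equiv.Perm E' // μ * μ = 1} :=
  ψ.permCongrHom.toEquiv.subtypeEquiv fun μ => by
    change _ ↔ ψ.permCongrHom μ * ψ.permCongrHom μ = 1
    rw [← map_mul, map_eq_one_iff _ ψ.permCongrHom.injective]

theorem conjInvolution_apply (ψ : E ≃ E') (μ : {μ : Equiv.Perm E // μ * μ = 1}) (k : E) :
    (conjInvolution ψ μ).1 (ψ k) = ψ (μ.1 k) := by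
  change ψ (μ.1 (ψ.symm (ψ k))) = _
  rw [ψ.symm_apply_apply]

/-- The extension of a permutation of the complement of `{i, j}` by the transposition of `i` and
`j`. -/
def extendBySwap [DecidableEq E] (i j : E) (ν : Equiv.Perm {k : E // k ≠ i ∧ k ≠ j}) :
    Equiv.Perm E :=
  Equiv.Perm.ofSubtype ν * Equiv.swap i j

section ExtendBySwap

variable [DecidableEq E] {i j : E} (ν : Equiv.Perm {k : E // k ≠ i ∧ k ≠ j})

theorem extendBySwap_left : extendBySwap i j ν i = j := by
  simp [extendBySwap, Equiv.Perm.ofSubtype_apply_of_not_mem]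

theorem extendBySwap_right : extendBySwap i j ν j = i := by
  simp [extendBySwap, Equiv.Perm.ofSubtype_apply_of_not_mem]

theorem extendBySwap_coe (k : {k : E // k ≠ i ∧ k ≠ j}) : extendBySwap i j ν k = ν k := by
  simp [extendBySwap, Equiv.swap_apply_of_ne_of_ne k.2.1 k.2.2]

theorem extendBySwap_injective : Function.Injective (extendBySwap i j) := by
  intro ν ν' h
  ext k
  rw [← extendBySwap_coe, h, extendBySwap_coe]

theorem extendBySwap_mul_self (hν : ν * ν = 1) :
    extendBySwap i j ν * extendBySwap i j ν = 1 := by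
  ext k
  rw [Equiv.Perm.mul_apply, Equiv.Perm.one_apply]
  by_cases h1 : k = i
  · rw [h1, extendBySwap_left, extendBySwap_right]
  by_cases h2 : k = j
  · rw [h2, extendBySwap_right, extendBySwap_left]
  have h3 := extendBySwap_coe ν ⟨k, h1, h2⟩
  change extendBySwap i j ν k = _ at h3
  rw [h3, extendBySwap_coe, ← Equiv.Perm.mul_apply, hν]
  rfl

/-- An involution that sends i to j exchanges them, so it preserves their complement and restricts
to an involution there. -/
theorem exists_extendBySwap {μ : Equiv.Perm E} (hμ : μ * μ = 1) (h : μ i = j) :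
    ∃ ν : Equiv.Perm {k : E // k ≠ i ∧ k ≠ j}, ν * ν = 1 ∧ extendBySwap i j ν = μ := by
  have hμ' : ∀ k, μ (μ k) = k := fun k => Equiv.congr_fun hμ k
  have hj : μ j = i := by rw [← h, hμ']
  have hp : ∀ k, (μ k ≠ i ∧ μ k ≠ j) ↔ (k ≠ i ∧ k ≠ j) := by
    intro k
    have h1 : μ k = i ↔ k = j := by rw [← hj, μ.injective.eq_iff]
    have h2 : μ k = j ↔ k = i := by rw [← h, μ.injective.eq_iff]
    rw [ne_eq, ne_eq, h1, h2]
    tauto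
  refine ⟨μ.subtypePerm hp, ?_, ?_⟩
  · ext k
    exact hμ' k
  · ext k
    by_cases h1 : k = i
    · rw [h1, extendBySwap_left, h]
    by_cases h2 : k = j
    · rw [h2, extendBySwap_right, hj]
    exact extendBySwap_coe (μ.subtypePerm hp) ⟨k, h1, h2⟩

/-- The fixed points of the extended involution are those of the original one. -/
def fixedEquiv (hij : i ≠ j) : {k // ν k = k} ≃ {k : E // extendBySwap i j ν k = k} where
  toFun k := ⟨k.1.1, by rw [extendBySwap_coe, k.2]⟩
  invFun k := ⟨⟨k.1, fun h => hij (by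
      have := k.2
      rw [h, extendBySwap_left] at this
      exact this.symm), fun h => hij (by
      have := k.2
      rw [h, extendBySwap_right] at this
      exact this)⟩, Subtype.ext (by rw [← extendBySwap_coe]; exact k.2)⟩
  left_inv _ := rfl
  right_inv _ := rfl

/-- Disjoint pairs can be glued in stages. This matches the matchings of the glued diagram in STU
with the matchings of the original one that pair i with j. -/
theorem glueAlong_extendBySwap [DecidableEq I] (D : JacobiDiagram I E H) (hij : i ≠ j)
    (hν : ν * ν = 1) :
    D.glueAlong (extendBySwap i j ν) (extendBySwap_mul_self ν hν) =
      ((D.glue i j hij).glueAlong ν hν).relabel (Equiv.refl _) (fixedEquiv ν hij) := by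
  have hedge : ∀ x, (D.glue i j hij).edge x = Equiv.swap (D.leg i) (D.leg j) (D.edge x) :=
    fun _ => rfl
  have hleg : ∀ k, (D.glue i j hij).leg k = D.leg k := fun _ => rfl
  apply eq_relabel
  · intro x
    rw [Equiv.refl_apply, Equiv.refl_apply]
    by_cases hx : ∃ k, D.leg k = x
    · obtain ⟨k, rfl⟩ := hx
      rw [glueAlong_edge_leg]
      by_cases h1 : k = i
      · subst h1
        rw [extendBySwap_left, glueAlong_edge_of_ne, hedge, edge_leg, Equiv.swap_apply_left]
        intro l hl
        exact l.2.1 (D.leg_injective hl)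
      by_cases h2 : k = j
      · subst h2
        rw [extendBySwap_right, glueAlong_edge_of_ne, hedge, edge_leg, Equiv.swap_apply_right]
        intro l hl
        exact l.2.2 (D.leg_injective hl)
      have h3 := glueAlong_edge_leg (D.glue i j hij) hν ⟨k, h1, h2⟩
      rw [hleg, hleg, ← extendBySwap_coe] at h3
      exact h3.symm
    · rw [not_exists] at hx
      rw [glueAlong_edge_of_ne _ _ hx, glueAlong_edge_of_ne (D.glue i j hij) _ (fun k => hx k),
        hedge, Equiv.swap_apply_of_ne_of_ne (D.edge_ne_leg hx i).symm (D.edge_ne_leg hx j).symm]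
  · intro k; rfl
  · intro k; rfl

end ExtendBySwap

/-- The product of the numbers `ω(x k, x (μ k)) / 2` over the pairs of vertices that are exchanged
by the involution `μ`, where `k` comes before `μ k` for the order given by `r`. -/
def pairing {H : Type u} [AddCommGroup H] [Module ℚ H] (ω : LinearMap.BilinForm ℚ H) [Fintype E]
    (x : E → H) (r : E → ℕ) (μ : Equiv.Perm E) : ℚ :=
  ∏ k, if r k < r (μ k) then 2⁻¹ * ω (x k) (x (μ k)) else 1

section Pairing

variable [AddCommGroup H] [Module ℚ H] {ω : LinearMap.BilinForm ℚ H} [Fintype E]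

theorem pairing_congr (x : E → H) {r r' : E → ℕ} (h : ∀ k l, r k < r l ↔ r' k < r' l)
    (μ : Equiv.Perm E) : pairing ω x r μ = pairing ω x r' μ := by
  simp only [pairing, h]

theorem pairing_one (x : E → H) (r : E → ℕ) : pairing ω x r 1 = 1 := by
  simp [pairing]

theorem pairing_comp [Fintype E'] (x : E' → H) (r : E' → ℕ) (ψ : E ≃ E') {μ : Equiv.Perm E}
    {ν : Equiv.Perm E'} (h : ∀ k, ν (ψ k) = ψ (μ k)) :
    pairing ω (x ∘ ψ) (r ∘ ψ) μ = pairing ω x r ν := by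
  refine Fintype.prod_equiv ψ _ _ fun k => ?_
  simp [h]

variable [DecidableEq E]

/-- Of the two factors indexed by i and j, the one at the smaller vertex carries the value of ω and
the other one is 1. -/
theorem pairing_eq_mul (x : E → H) (r : E → ℕ) {μ : Equiv.Perm E} (hμ : μ * μ = 1)
    {i j : E} (hij : i ≠ j) (h : μ i = j) (hr : r i ≠ r j) :
    pairing ω x r μ = (if r i < r j then 2⁻¹ * ω (x i) (x j) else 2⁻¹ * ω (x j) (x i)) *
      ∏ k : {k : E // k ≠ i ∧ k ≠ j},
        if r k < r (μ k) then 2⁻¹ * ω (x k) (x (μ k)) else 1 := by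
  have hj : μ j = i := by rw [← h]; exact Equiv.congr_fun hμ i
  have h1 := Finset.prod_subtype (F := inferInstance) ((Finset.univ.erase i).erase j)
    (p := fun k => k ≠ i ∧ k ≠ j) (by intro k; simp [and_comm])
    (fun k => if r k < r (μ k) then 2⁻¹ * ω (x k) (x (μ k)) else 1)
  rw [← h1, pairing, ← Finset.mul_prod_erase _ _ (Finset.mem_univ i),
    ← Finset.mul_prod_erase _ _ (Finset.mem_erase.2 ⟨hij.symm, Finset.mem_univ j⟩), h, hj,
    ← mul_assoc]
  congr 1
  rcases lt_or_gt_of_ne hr with h | h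
  · simp [h, h.le]
  · simp [h, h.not_gt]

/-- The factor of the pair {i, j} has its arguments exchanged, which changes the sign of ω. The
other matched pairs avoid i and j, so their order is unaffected. -/
theorem pairing_comp_swap (hω : ω.IsAlt) (x : E → H) {r : E → ℕ} (hr : Function.Injective r)
    {μ : Equiv.Perm E} (hμ : μ * μ = 1) {i j : E} (hij : i ≠ j) (h : μ i = j) :
    pairing ω x (r ∘ Equiv.swap i j) μ = - pairing ω x r μ := by
  have hr' : r i ≠ r j := fun hc => hij (hr hc)
  have hμ' : ∀ k, μ (μ k) = k := fun k => Equiv.congr_fun hμ k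
  rw [pairing_eq_mul x r hμ hij h hr', pairing_eq_mul x _ hμ hij h (by simpa using hr'.symm),
    ← neg_mul]
  congr 1
  · simp only [Function.comp_apply, Equiv.swap_apply_left, Equiv.swap_apply_right]
    have := hω.neg_eq (x i) (x j)
    rcases lt_or_gt_of_ne hr' with h | h
    · simp [h, h.le, ← this]
    · simp [h, h.not_gt, ← this]
  · refine Finset.prod_congr rfl fun k _ => ?_
    have h1 : μ k ≠ i := fun hc => k.2.2 (by rw [← hμ' k, hc, h])
    have h2 : μ k ≠ j := fun hc => k.2.1 (by rw [← μ.injective.eq_iff, hc, h])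
    simp only [Function.comp_apply, Equiv.swap_apply_of_ne_of_ne k.2.1 k.2.2,
      Equiv.swap_apply_of_ne_of_ne h1 h2]

theorem pairing_extendBySwap (x : E → H) {r : E → ℕ} {i j : E} (hij : i ≠ j) (hr : r i < r j)
    {ν : Equiv.Perm {k : E // k ≠ i ∧ k ≠ j}} (hν : ν * ν = 1) :
    pairing ω x r (extendBySwap i j ν) =
      2⁻¹ * ω (x i) (x j) * pairing ω (fun k => x k.1) (fun k => r k.1) ν := by
  rw [pairing_eq_mul x r (extendBySwap_mul_self ν hν) hij (extendBySwap_left ν) hr.ne, if_pos hr]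
  simp only [extendBySwap_coe]
  rfl

theorem pairing_update_of_eq (x : E → H) (r : E → ℕ) {μ : Equiv.Perm E} {k : E} (hk : μ k = k)
    (y : H) : pairing ω (Function.update x k y) r μ = pairing ω x r μ := by
  refine Finset.prod_congr rfl fun l _ => ?_
  by_cases hl : l = k
  · subst hl; simp [hk]
  · have : μ l ≠ k := fun hc => hl (μ.injective (by rw [hc, hk]))
    simp [hl, this]

/-- The color of k enters only the factor of the pair {k, μ k}, where it is one argument of ω. -/
theorem exists_pairing_update (x : E → H) {r : E → ℕ} (hr : Function.Injective r)
    {μ : Equiv.Perm E} (hμ : μ * μ = 1) {k : E} (hk : μ k ≠ k) :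
    ∃ f : H →ₗ[ℚ] ℚ, ∀ y, pairing ω (Function.update x k y) r μ = f y := by
  have hμ' : ∀ k, μ (μ k) = k := fun k => Equiv.congr_fun hμ k
  set c := ∏ l : {l : E // l ≠ k ∧ l ≠ μ k},
        if r l < r (μ l) then 2⁻¹ * ω (x l) (x (μ l)) else 1 with hc
  have hy : ∀ y, pairing ω (Function.update x k y) r μ =
      (if r k < r (μ k) then 2⁻¹ * ω y (x (μ k)) else 2⁻¹ * ω (x (μ k)) y) * c := by
    intro y
    rw [pairing_eq_mul _ r hμ (Ne.symm hk) rfl (fun h => hk (hr h).symm), hc]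
    congr 1
    · simp [hk]
    · refine Finset.prod_congr rfl fun l _ => ?_
      have : μ l ≠ k := fun hc => l.2.2 ((hμ' l).symm.trans (congrArg μ hc))
      simp [l.2.1, this]
  by_cases h : r k < r (μ k)
  · refine ⟨(2⁻¹ * c) • ω.flip (x (μ k)), fun y => ?_⟩
    rw [hy, if_pos h]
    change _ = 2⁻¹ * c * ω y (x (μ k))
    ring
  · refine ⟨(2⁻¹ * c) • ω (x (μ k)), fun y => ?_⟩
    rw [hy, if_neg h]
    simp only [LinearMap.smul_apply, smul_eq_mul]
    ring

end Pairing

end JacobiDiagram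

end

/-! ### Symmetrization of diagrams is bijective. -/

noncomputable section

namespace UnorderedJacobi

universe w

variable {H : Type w} [AddCommGroup H] [Module ℚ H]

open JacobiDiagram

theorem mkQ_eq_zero {x : FreeJacobi H} (hx : UnorderedRelation x) :
    Submodule.mkQ (Submodule.span ℚ {x : FreeJacobi H | UnorderedRelation x}) x = 0 :=
  (Submodule.Quotient.mk_eq_zero _).2 (Submodule.subset_span hx)

theorem cls_iso {n n' e e' : ℕ} (D : JacobiDiagram (Fin n) (Fin e) H) (π : Fin n ≃ Fin n')
    (s : Fin n → Fin 3) (ψ : Fin e ≃ Fin e') :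
    cls (D.relabel (halfEdgeIso π s) ψ) = cls D := by
  have h := mkQ_eq_zero (UnorderedRelation.iso D π s ψ)
  rw [map_sub, sub_eq_zero] at h
  exact h.symm

theorem cls_antisymmetry {n e : ℕ} (D : JacobiDiagram (Fin n) (Fin e) H) (v : Fin n) :
    cls D + cls (D.relabel (halfEdgeFlip v) (Equiv.refl _)) = 0 := by
  have h := mkQ_eq_zero (.of_local (.antisymmetry D v))
  rwa [map_add] at h

theorem cls_ihx {n e : ℕ} (D : JacobiDiagram (Fin n) (Fin e) H) (u v : Fin n) (huv : u ≠ v)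
    (h : D.edge (u, 0) = (v, 0)) :
    cls D + cls (D.relabel (halfEdgeCycle u v) (Equiv.refl _))
      + cls (D.relabel (halfEdgeCycle u v)⁻¹ (Equiv.refl _)) = 0 := by
  have h := mkQ_eq_zero (.of_local (.ihx D u v huv h))
  rwa [map_add, map_add] at h

theorem cls_add {n e : ℕ} (D : JacobiDiagram (Fin n) (Fin e) H) (k : Fin e) (x y : H) :
    cls (D.setColor k (x + y)) = cls (D.setColor k x) + cls (D.setColor k y) := by
  have h := mkQ_eq_zero (.of_local (.add D k x y))
  rwa [map_sub, map_sub, sub_sub, sub_eq_zero] at h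

theorem cls_smul {n e : ℕ} (D : JacobiDiagram (Fin n) (Fin e) H) (k : Fin e) (q : ℚ) (x : H) :
    cls (D.setColor k (q • x)) = q • cls (D.setColor k x) := by
  have h := mkQ_eq_zero (.of_local (.smul D k q x))
  rwa [map_sub, map_smul, sub_eq_zero] at h

/-- A function on diagrams that respects the relations defines a linear map. -/
def liftLin {M : Type*} [AddCommGroup M] [Module ℚ M]
    (f : (Σ n e : ℕ, JacobiDiagram (Fin n) (Fin e) H) → M)
    (hf : ∀ x, UnorderedRelation x → Finsupp.linearCombination ℚ f x = 0) :
    UnorderedJacobi H →ₗ[ℚ] M :=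
  Submodule.liftQ _ (Finsupp.linearCombination ℚ f) (Submodule.span_le.2 hf)

theorem liftLin_cls {M : Type*} [AddCommGroup M] [Module ℚ M]
    (f : (Σ n e : ℕ, JacobiDiagram (Fin n) (Fin e) H) → M)
    (hf : ∀ x, UnorderedRelation x → Finsupp.linearCombination ℚ f x = 0)
    {n e : ℕ} (D : JacobiDiagram (Fin n) (Fin e) H) :
    liftLin f hf (cls D) = f ⟨n, e, D⟩ :=
  OrderedJacobi.linearCombination_toFree f D

theorem hom_ext {M : Type*} [AddCommGroup M] [Module ℚ M] {f g : UnorderedJacobi H →ₗ[ℚ] M}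
    (h : ∀ (n e : ℕ) (D : JacobiDiagram (Fin n) (Fin e) H), f (cls D) = g (cls D)) :
    f = g := by
  apply Submodule.linearMap_qext
  apply Finsupp.lhom_ext'
  rintro ⟨n, e, D⟩
  apply LinearMap.ext_ring
  exact h n e D

variable {n n' : ℕ} {E E' : Type} [Fintype E] [Fintype E']

/-- The class of a diagram whose external vertices form an arbitrary finite set. -/
def finCls (D : JacobiDiagram (Fin n) E H) : UnorderedJacobi H :=
  cls (D.relabel (Equiv.refl _) (Fintype.equivFin E))

/-- Two enumerations of the external vertices give isomorphic diagrams, so the choice made by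
`Fintype.equivFin` is immaterial. -/
theorem finCls_relabel (D : JacobiDiagram (Fin n) E H) (π : Fin n ≃ Fin n') (s : Fin n → Fin 3)
    (ψ : E ≃ E') : finCls (D.relabel (halfEdgeIso π s) ψ) = finCls D := by
  have h := cls_iso (D.relabel (Equiv.refl _) (Fintype.equivFin E)) π s
    ((Fintype.equivFin E).symm.trans (ψ.trans (Fintype.equivFin E')))
  rw [relabel_relabel] at h
  rw [finCls, finCls, ← h, relabel_relabel]
  congr 1
  congr 1
  ext1 k
  simp

theorem finCls_relabel_refl (D : JacobiDiagram (Fin n) E H) (ψ : E ≃ E') :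
    finCls (D.relabel (Equiv.refl _) ψ) = finCls D := by
  rw [← halfEdgeIso_refl, finCls_relabel]

theorem finCls_eq_cls {e : ℕ} (D : JacobiDiagram (Fin n) (Fin e) H) : finCls D = cls D := by
  rw [finCls, ← halfEdgeIso_refl, cls_iso]

theorem finCls_antisymmetry (D : JacobiDiagram (Fin n) E H) (v : Fin n) :
    finCls D + finCls (D.relabel (halfEdgeFlip v) (Equiv.refl _)) = 0 :=
  cls_antisymmetry (D.relabel (Equiv.refl _) (Fintype.equivFin E)) v

theorem finCls_ihx (D : JacobiDiagram (Fin n) E H) (u v : Fin n) (huv : u ≠ v)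
    (h : D.edge (u, 0) = (v, 0)) :
    finCls D + finCls (D.relabel (halfEdgeCycle u v) (Equiv.refl _))
      + finCls (D.relabel (halfEdgeCycle u v)⁻¹ (Equiv.refl _)) = 0 :=
  cls_ihx (D.relabel (Equiv.refl _) (Fintype.equivFin E)) u v huv h

variable [DecidableEq E] [DecidableEq E']

theorem finCls_add (D : JacobiDiagram (Fin n) E H) (k : E) (x y : H) :
    finCls (D.setColor k (x + y)) = finCls (D.setColor k x) + finCls (D.setColor k y) := by
  simp only [finCls, setColor_relabel, cls_add]

theorem finCls_smul (D : JacobiDiagram (Fin n) E H) (k : E) (q : ℚ) (x : H) :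
    finCls (D.setColor k (q • x)) = q • finCls (D.setColor k x) := by
  simp only [finCls, setColor_relabel, cls_smul]

variable (ω : LinearMap.BilinForm ℚ H)

/-- The sum, over all ways of gluing some external vertices in pairs, of the glued diagrams with
the coefficients `pairing`; the external vertices are ordered by `r`. -/
def contraction (D : JacobiDiagram (Fin n) E H) (r : E → ℕ) : UnorderedJacobi H :=
  ∑ μ : {μ : Equiv.Perm E // μ * μ = 1},
    pairing ω D.color r μ.1 • finCls (D.glueAlong μ.1 μ.2)

theorem contraction_congr (D : JacobiDiagram (Fin n) E H) {r r' : E → ℕ}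
    (h : ∀ k l, r k < r l ↔ r' k < r' l) : contraction ω D r = contraction ω D r' := by
  simp only [contraction, pairing_congr D.color h]

theorem contraction_relabel (D : JacobiDiagram (Fin n) E H) (π : Fin n ≃ Fin n')
    (s : Fin n → Fin 3) (ψ : E ≃ E') (r : E' → ℕ) :
    contraction ω (D.relabel (halfEdgeIso π s) ψ) r = contraction ω D (r ∘ ψ) := by
  refine (Fintype.sum_equiv (conjInvolution ψ) _ _ fun μ => ?_).symm
  rw [glueAlong_relabel D μ.2 _ ψ (conjInvolution ψ μ).2 (conjInvolution_apply ψ μ),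
    finCls_relabel, ← pairing_comp _ _ ψ (conjInvolution_apply ψ μ)]
  congr 2
  funext k
  simp [relabel]

theorem contraction_relabel_refl (D : JacobiDiagram (Fin n) E H) (ψ : E ≃ E') (r : E' → ℕ) :
    contraction ω (D.relabel (Equiv.refl _) ψ) r = contraction ω D (r ∘ ψ) := by
  rw [← halfEdgeIso_refl, contraction_relabel]

theorem contraction_antisymmetry (D : JacobiDiagram (Fin n) E H) (r : E → ℕ) (v : Fin n) :
    contraction ω D r + contraction ω (D.relabel (halfEdgeFlip v) (Equiv.refl _)) r = 0 := by
  rw [contraction, contraction, ← Finset.sum_add_distrib]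
  refine Finset.sum_eq_zero fun μ _ => ?_
  rw [glueAlong_relabel_left]
  change pairing ω D.color r μ.1 • _ + pairing ω D.color r μ.1 • _ = _
  rw [← smul_add, finCls_antisymmetry, smul_zero]

theorem contraction_ihx (D : JacobiDiagram (Fin n) E H) (r : E → ℕ) (u v : Fin n) (huv : u ≠ v)
    (h : D.edge (u, 0) = (v, 0)) :
    contraction ω D r + contraction ω (D.relabel (halfEdgeCycle u v) (Equiv.refl _)) r
      + contraction ω (D.relabel (halfEdgeCycle u v)⁻¹ (Equiv.refl _)) r = 0 := by
  rw [contraction, contraction, contraction, ← Finset.sum_add_distrib, ← Finset.sum_add_distrib]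
  refine Finset.sum_eq_zero fun μ _ => ?_
  rw [glueAlong_relabel_left, glueAlong_relabel_left]
  change pairing ω D.color r μ.1 • _ + pairing ω D.color r μ.1 • _ +
    pairing ω D.color r μ.1 • _ = _
  rw [← smul_add, ← smul_add, finCls_ihx, smul_zero]
  · exact huv
  -- Gluing alters the involution only at the legs, and an end of an internal edge is not a leg. So
  -- the edge from u to v survives in every glued diagram.
  · rw [glueAlong_edge_of_ne, h]
    rintro k hk
    have := D.edge_leg k
    rw [hk, h, Prod.mk.injEq] at this
    exact huv this.1.symm

/-- Each term is linear in the color of k: through the diagram when μ fixes k, through the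
coefficient when k is matched. -/
theorem exists_contraction_setColor (D : JacobiDiagram (Fin n) E H) {r : E → ℕ}
    (hr : Function.Injective r) (k : E) :
    ∃ f : H →ₗ[ℚ] UnorderedJacobi H, ∀ x, contraction ω (D.setColor k x) r = f x := by
  have h : ∀ μ : {μ : Equiv.Perm E // μ * μ = 1}, ∃ f : H →ₗ[ℚ] UnorderedJacobi H,
      ∀ x, pairing ω (D.setColor k x).color r μ.1 •
        finCls ((D.setColor k x).glueAlong μ.1 μ.2) = f x := by
    intro μ
    by_cases hk : μ.1 k = k
    · refine ⟨pairing ω D.color r μ.1 • ⟨⟨fun x =>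
        finCls ((D.glueAlong μ.1 μ.2).setColor ⟨k, hk⟩ x), finCls_add _ _⟩, finCls_smul _ _⟩, ?_⟩
      intro x
      rw [glueAlong_setColor_of_eq D μ.2 hk]
      congr 1
      exact pairing_update_of_eq _ _ hk _
    · obtain ⟨f, hf⟩ := exists_pairing_update (ω := ω) D.color hr μ.2 hk
      refine ⟨f.smulRight (finCls (D.glueAlong μ.1 μ.2)), fun x => ?_⟩
      rw [glueAlong_setColor_of_ne D μ.2 hk, LinearMap.smulRight_apply, ← hf]
      rfl
  choose f hf using h
  refine ⟨∑ μ, f μ, fun x => ?_⟩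
  rw [LinearMap.sum_apply]
  exact Finset.sum_congr rfl fun μ _ => hf μ x

variable {ω}

/-- Matchings that do not pair i with j contribute equally to both diagrams, since exchanging
neighbours changes no other comparison. Those that do pair them change sign, and the two halves of
ω(x, y) add up. -/
theorem contraction_stu (hω : ω.IsAlt) (D : JacobiDiagram (Fin n) E H) {r : E → ℕ}
    (hr : Function.Injective r) {i j : E} (hij : r i + 1 = r j) (hne : i ≠ j) :
    contraction ω D r - contraction ω (D.relabel (Equiv.refl _) (Equiv.swap i j)) r =
      ω (D.color i) (D.color j) • contraction ω (D.glue i j hne) (fun k => r k.1) := by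
  have hμ' : ∀ μ : {μ : Equiv.Perm E // μ * μ = 1}, ∀ k, μ.1 (μ.1 k) = k :=
    fun μ k => Equiv.congr_fun μ.2 k
  -- As i and j have consecutive ranks, no other vertex lies between them: only their mutual order
  -- changes.
  have hswap : ∀ k l, k ≠ l → ¬(k = i ∧ l = j) → ¬(k = j ∧ l = i) →
      (r (Equiv.swap i j k) < r (Equiv.swap i j l) ↔ r k < r l) := by
    intro k l hkl h1 h2
    have hi : ∀ k, k ≠ i → r k ≠ r i := fun k hk hc => hk (hr hc)
    have hj : ∀ k, k ≠ j → r k ≠ r j := fun k hk hc => hk (hr hc)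
    by_cases hki : k = i
    · subst hki
      have hlj : l ≠ j := fun hc => h1 ⟨rfl, hc⟩
      have := hi l hkl.symm
      have := hj l hlj
      rw [Equiv.swap_apply_left, Equiv.swap_apply_of_ne_of_ne hkl.symm hlj]
      omega
    by_cases hkj : k = j
    · subst hkj
      have hli : l ≠ i := fun hc => h2 ⟨rfl, hc⟩
      have := hi l hli
      have := hj l hkl.symm
      rw [Equiv.swap_apply_right, Equiv.swap_apply_of_ne_of_ne hli hkl.symm]
      omega
    have := hi k hki
    have := hj k hkj
    rw [Equiv.swap_apply_of_ne_of_ne hki hkj]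
    by_cases hli : l = i
    · subst hli; rw [Equiv.swap_apply_left]; omega
    by_cases hlj : l = j
    · subst hlj; rw [Equiv.swap_apply_right]; omega
    rw [Equiv.swap_apply_of_ne_of_ne hli hlj]
  rw [contraction_relabel_refl, contraction, contraction, contraction, ← Finset.sum_sub_distrib,
    Finset.smul_sum]
  symm
  -- Matchings of the glued diagram inject into those of D; it remains that the terms outside the
  -- image vanish and that the others agree.
  refine Finset.sum_of_injOn (fun ν => ⟨extendBySwap i j ν.1, extendBySwap_mul_self ν.1 ν.2⟩)
    ?_ ?_ ?_ ?_
  · intro ν _ ν' _ h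
    exact Subtype.ext (extendBySwap_injective (Subtype.ext_iff.1 h))
  · intro ν _
    exact Finset.mem_coe.2 (Finset.mem_univ _)
  · intro μ _ hμ
    have hij' : μ.1 i ≠ j := by
      intro hc
      obtain ⟨ν, hν, hν'⟩ := exists_extendBySwap μ.2 hc
      exact hμ ⟨⟨ν, hν⟩, Finset.mem_coe.2 (Finset.mem_univ _), Subtype.ext hν'⟩
    rw [← sub_smul, sub_eq_zero.2, zero_smul]
    refine Finset.prod_congr rfl fun k _ => ?_
    by_cases hk : μ.1 k = k
    · simp [hk]
    · have := hswap k (μ.1 k) (Ne.symm hk) (fun hc => hij' (hc.1 ▸ hc.2)) (fun hc => hij' (by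
        rw [← hc.2, hμ', hc.1]))
      simp only [Function.comp_apply, this]
  · intro ν _
    rw [pairing_comp_swap hω _ hr (extendBySwap_mul_self ν.1 ν.2) hne (extendBySwap_left ν.1),
      glueAlong_extendBySwap ν.1 D hne ν.2, finCls_relabel_refl, ← sub_smul, sub_neg_eq_add,
      pairing_extendBySwap _ hne (by omega) ν.2, smul_smul]
    congr 1
    change _ * pairing ω (fun k : {k : E // k ≠ i ∧ k ≠ j} => D.color k.1) _ _ = _
    ring

/-- Take i moved by μ. Composing the order σ with the transposition of i and μ i permutes the orders
and reverses the sign of each term, so the sum equals its own opposite. -/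
theorem sum_pairing_eq_zero (hω : ω.IsAlt) {e : ℕ} (x : Fin e → H) {μ : Equiv.Perm (Fin e)}
    (hμ : μ * μ = 1) (h : μ ≠ 1) :
    ∑ σ : Equiv.Perm (Fin e), pairing ω x (fun k => (σ k : ℕ)) μ = 0 := by
  obtain ⟨i, hi⟩ : ∃ i, μ i ≠ i := by
    by_contra! hc
    exact h (Equiv.ext hc)
  have h1 : ∑ σ : Equiv.Perm (Fin e), pairing ω x (fun k => (σ k : ℕ)) μ =
      - ∑ σ : Equiv.Perm (Fin e), pairing ω x (fun k => (σ k : ℕ)) μ := by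
    rw [← Finset.sum_neg_distrib]
    refine Fintype.sum_equiv (Equiv.mulRight (Equiv.swap i (μ i))) _ _ fun σ => ?_
    have := pairing_comp_swap hω x (r := fun k => (σ k : ℕ))
      (Fin.val_injective.comp σ.injective) hμ (Ne.symm hi) rfl
    -- The rewrites turn a = −b into b = −a.
    rw [eq_neg_iff_add_eq_zero, ← eq_neg_iff_add_eq_zero, eq_neg_iff_add_eq_zero, add_comm,
      ← eq_neg_iff_add_eq_zero]
    exact this
  linarith

theorem linearCombination_contraction (hω : ω.IsAlt) {x : FreeJacobi H} (hx : OrderedRelation ω x) :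
    Finsupp.linearCombination ℚ (fun D : Σ n e : ℕ, JacobiDiagram (Fin n) (Fin e) H =>
      contraction ω D.2.2 (fun k => (k : ℕ))) x = 0 := by
  rcases hx with (@⟨_, hx⟩ | ⟨D, π, s, ψ⟩ | ⟨D, i, j, hij, hj, ψ⟩)
  · rcases hx with (⟨D, v⟩ | ⟨D, u, v, huv, h⟩ | ⟨D, k, a, b⟩ | ⟨D, k, q, a⟩)
    · simp only [map_add, OrderedJacobi.linearCombination_toFree]
      exact contraction_antisymmetry ω D _ v
    · simp only [map_add, OrderedJacobi.linearCombination_toFree]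
      exact contraction_ihx ω D _ u v huv h
    · simp only [map_sub, OrderedJacobi.linearCombination_toFree]
      obtain ⟨f, hf⟩ := exists_contraction_setColor ω D Fin.val_injective k
      rw [hf, hf, hf, map_add]
      abel
    · simp only [map_sub, map_smul, OrderedJacobi.linearCombination_toFree]
      obtain ⟨f, hf⟩ := exists_contraction_setColor ω D Fin.val_injective k
      rw [hf, hf, map_smul, sub_self]
  · simp only [map_sub, OrderedJacobi.linearCombination_toFree]
    rw [contraction_relabel, sub_eq_zero]
    refine contraction_congr ω D fun k l => ?_
    exact ψ.lt_iff_lt.symm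
  · simp only [map_sub, map_smul, OrderedJacobi.linearCombination_toFree]
    rw [contraction_stu hω D Fin.val_injective hj hij, contraction_relabel_refl, sub_eq_zero]
    congr 1
    refine contraction_congr ω _ fun k l => ?_
    exact ψ.lt_iff_lt.symm

/-- The inverse of the symmetrization map. -/
def unsymmetrization (hω : ω.IsAlt) : OrderedJacobi ω →ₗ[ℚ] UnorderedJacobi H :=
  OrderedJacobi.liftLin _ fun _ => linearCombination_contraction hω

/-- After exchanging the sums over orders and matchings, every matching μ ≠ 1 drops out. The empty
matching gives the diagram e! times, which the factor 1/e! cancels. -/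
theorem unsymmetrization_symmetrization (hω : ω.IsAlt) (x : UnorderedJacobi H) :
    unsymmetrization hω (symmetrization ω x) = x := by
  have h : unsymmetrization hω ∘ₗ symmetrization ω = LinearMap.id := by
    refine hom_ext fun n e D => ?_
    rw [LinearMap.comp_apply, symmetrization_cls, map_smul, map_sum, LinearMap.id_apply]
    have h1 : ∀ σ : Equiv.Perm (Fin e), unsymmetrization hω
        (OrderedJacobi.cls ω (D.relabel (Equiv.refl _) σ)) =
        ∑ μ : {μ : Equiv.Perm (Fin e) // μ * μ = 1},
          pairing ω D.color (fun k => (σ k : ℕ)) μ.1 • finCls (D.glueAlong μ.1 μ.2) := by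
      intro σ
      refine (OrderedJacobi.liftLin_cls _ _ _).trans ?_
      exact contraction_relabel_refl ω D σ _
    simp only [h1]
    rw [Finset.sum_comm, Finset.sum_eq_single ⟨1, one_mul 1⟩]
    · simp only [pairing_one, one_smul, Finset.sum_const, Finset.card_univ, Fintype.card_perm,
        Fintype.card_fin]
      rw [← Nat.cast_smul_eq_nsmul ℚ, smul_smul, inv_mul_cancel₀ (by positivity), one_smul,
        glueAlong_one_eq, finCls_relabel_refl, finCls_eq_cls]
    · intro μ _ hμ
      rw [← Finset.sum_smul, sum_pairing_eq_zero hω _ μ.2 (fun hc => hμ (Subtype.ext hc)),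
        zero_smul]
    · intro hc
      exact absurd (Finset.mem_univ _) hc
  exact congrArg (fun f => f x) h

/-- Induction on the number of external vertices: by STU, a diagram differs from any reordering of
it by diagrams with fewer of them, hence from its symmetrization by an element of the range. -/
theorem cls_mem_range_symmetrization (ω : LinearMap.BilinForm ℚ H) (e : ℕ) :
    ∀ {n : ℕ} (D : JacobiDiagram (Fin n) (Fin e) H),
      OrderedJacobi.cls ω D ∈ LinearMap.range (symmetrization ω) := by
  induction e using Nat.strong_induction_on with
  | _ e ih =>
    intro n D
    have h1 : ∀ σ : Equiv.Perm (Fin e), ∀ D : JacobiDiagram (Fin n) (Fin e) H,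
        OrderedJacobi.cls ω D - OrderedJacobi.cls ω (D.relabel (Equiv.refl _) σ) ∈
          LinearMap.range (symmetrization ω) := by
      rcases e with _ | e
      · intro σ D
        rw [Subsingleton.elim σ (Equiv.refl _), relabel_refl, sub_self]
        exact Submodule.zero_mem _
      intro σ
      -- Transpositions of neighbours generate all permutations, so only one exchange of neighbours
      -- has to be treated.
      have hσ : σ ∈ Submonoid.closure (Set.range fun i : Fin e =>
          Equiv.swap i.castSucc i.succ) := by
        rw [Equiv.Perm.mclosure_swap_castSucc_succ]
        exact Submonoid.mem_top σ
      induction hσ using Submonoid.closure_induction with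
      | mem σ hσ =>
        obtain ⟨i, rfl⟩ := hσ
        intro D
        have hne : i.castSucc ≠ i.succ := (Fin.castSucc_lt_succ).ne
        -- The number of remaining vertices is left as an unevaluated cardinality; the induction
        -- only needs it to be smaller than e + 1.
        have h := OrderedJacobi.cls_stu (ω := ω) D i.castSucc i.succ hne (by simp)
          (Fintype.orderIsoFinOfCardEq _ rfl).symm
        rw [sub_eq_zero] at h
        rw [h]
        refine Submodule.smul_mem _ _ (ih _ ?_ _)
        calc _ < Fintype.card (Fin (e + 1)) :=
              Fintype.card_subtype_lt (x := i.castSucc) (by simp)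
          _ = e + 1 := Fintype.card_fin _
      | one =>
        intro D
        change _ - OrderedJacobi.cls ω (D.relabel (Equiv.refl _) (Equiv.refl _)) ∈ _
        rw [relabel_refl, sub_self]
        exact Submodule.zero_mem _
      | mul σ τ _ _ hσ hτ =>
        intro D
        have := Submodule.add_mem _ (hτ D) (hσ (D.relabel (Equiv.refl _) τ))
        rwa [sub_add_sub_cancel] at this
    have h2 : OrderedJacobi.cls ω D = symmetrization ω (cls D) + (e.factorial : ℚ)⁻¹ •
        ∑ σ : Equiv.Perm (Fin e),
          (OrderedJacobi.cls ω D - OrderedJacobi.cls ω (D.relabel (Equiv.refl _) σ)) := by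
      rw [symmetrization_cls, ← smul_add, ← Finset.sum_add_distrib]
      simp only [add_sub_cancel, Finset.sum_const, Finset.card_univ, Fintype.card_perm,
        Fintype.card_fin]
      rw [← Nat.cast_smul_eq_nsmul ℚ, smul_smul, inv_mul_cancel₀ (by positivity), one_smul]
    rw [h2]
    exact Submodule.add_mem _ ⟨_, rfl⟩ (Submodule.smul_mem _ _
      (Submodule.sum_mem _ fun σ _ => h1 σ D))

theorem symmetrization_surjective (ω : LinearMap.BilinForm ℚ H) :
    Function.Surjective (symmetrization ω) := by
  -- The quotient by the range is zero because the projection kills the classes of all diagrams.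
  have h : (LinearMap.range (symmetrization ω)).mkQ = 0 := OrderedJacobi.hom_ext fun n e D =>
    (Submodule.Quotient.mk_eq_zero _).2 (cls_mem_range_symmetrization ω e D)
  rw [← LinearMap.range_eq_top, ← Submodule.ker_mkQ (LinearMap.range _), h, LinearMap.ker_zero]

theorem symmetrization_bijective (hω : ω.IsAlt) : Function.Bijective (symmetrization ω) :=
  ⟨Function.LeftInverse.injective (unsymmetrization_symmetrization hω),
    symmetrization_surjective ω⟩

theorem symmetrization_star (ω : LinearMap.BilinForm ℚ H) (x y : UnorderedJacobi H) :
    symmetrization ω (star ω x y) = symmetrization ω x * symmetrization ω y :=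
  Function.rightInverse_invFun (symmetrization_surjective ω) _

theorem symmetrization_mem_degreePart (ω : LinearMap.BilinForm ℚ H) (n : ℕ)
    {x : UnorderedJacobi H} (hx : x ∈ degreePart H n) :
    symmetrization ω x ∈ OrderedJacobi.degreePart ω n := by
  induction hx using Submodule.span_induction with
  | zero => rw [map_zero]; exact Submodule.zero_mem _
  | add x y _ _ hx hy => rw [map_add]; exact Submodule.add_mem _ hx hy
  | smul q x _ hx => rw [map_smul]; exact Submodule.smul_mem _ _ hx
  | mem x hx =>
    obtain ⟨e, D, rfl⟩ := hx
    rw [symmetrization_cls]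
    exact Submodule.smul_mem _ _ (Submodule.sum_mem _ fun σ _ =>
      Submodule.subset_span ⟨e, _, rfl⟩)

end UnorderedJacobi

end

/-! ### Products over the edges of a diagram. -/

noncomputable section

section EdgeProduct

variable {X Y : Type*} [Fintype X] [DecidableEq X] [Fintype Y] [DecidableEq Y] {M : Type*}

/-- The two-element orbits of an involution. -/
def edgePairs (σ : X → X) : Finset (Sym2 X) :=
  (Finset.univ.filter fun h => σ h ≠ h).image fun h => s(h, σ h)

theorem mem_edgePairs {σ : X → X} {p : Sym2 X} : p ∈ edgePairs σ ↔ ∃ h, σ h ≠ h ∧ s(h, σ h) = p := by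
  simp [edgePairs]

/-- The product of the values of a function over the two-element orbits of an involution. -/
def edgeProduct (f : Sym2 M → ℚ) (σ : X → X) (y : X → M) : ℚ :=
  ∏ p ∈ edgePairs σ, f (p.map y)

theorem edgeProduct_conj (f : Sym2 M → ℚ) (σ : X → X) (φ : X ≃ Y) (y : Y → M) :
    edgeProduct f (fun h => φ (σ (φ.symm h))) y = edgeProduct f σ (y ∘ φ) := by
  have h : edgePairs (fun h => φ (σ (φ.symm h))) = (edgePairs σ).image (Sym2.map φ) := by
    ext p
    simp only [mem_edgePairs, Finset.mem_image]
    constructor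
    · rintro ⟨h, h1, rfl⟩
      exact ⟨_, ⟨φ.symm h, fun hc => h1 (by rw [hc, φ.apply_symm_apply]), rfl⟩, by simp⟩
    · rintro ⟨_, ⟨h, h1, rfl⟩, rfl⟩
      exact ⟨φ h, by simpa using h1, by simp⟩
  rw [edgeProduct, h, Finset.prod_image (Sym2.map.injective φ.injective).injOn]
  simp only [Sym2.map_map]
  rfl

theorem edgeProduct_sumMap (f : Sym2 M → ℚ) (σ : X → X) (τ : Y → Y) (y : X ⊕ Y → M) :
    edgeProduct f (Sum.map σ τ) y =
      edgeProduct f σ (y ∘ Sum.inl) * edgeProduct f τ (y ∘ Sum.inr) := by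
  have h : edgePairs (Sum.map σ τ) = (edgePairs σ).image (Sym2.map Sum.inl) ∪
      (edgePairs τ).image (Sym2.map Sum.inr) := by
    ext p
    simp only [mem_edgePairs, Finset.mem_image, Finset.mem_union]
    constructor
    · rintro ⟨h | h, h1, rfl⟩
      · exact Or.inl ⟨_, ⟨h, by simpa using h1, rfl⟩, by simp⟩
      · exact Or.inr ⟨_, ⟨h, by simpa using h1, rfl⟩, by simp⟩
    · rintro (⟨_, ⟨h, h1, rfl⟩, rfl⟩ | ⟨_, ⟨h, h1, rfl⟩, rfl⟩)
      · exact ⟨Sum.inl h, by simpa using h1, by simp⟩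
      · exact ⟨Sum.inr h, by simpa using h1, by simp⟩
  have hd : Disjoint ((edgePairs σ).image (Sym2.map Sum.inl : Sym2 X → Sym2 (X ⊕ Y)))
      ((edgePairs τ).image (Sym2.map Sum.inr)) := by
    rw [Finset.disjoint_left]
    intro p hp hp'
    simp only [Finset.mem_image, mem_edgePairs] at hp hp'
    obtain ⟨_, ⟨h, -, rfl⟩, rfl⟩ := hp
    obtain ⟨_, ⟨h', -, rfl⟩, h3⟩ := hp'
    simp at h3
  rw [edgeProduct, h, Finset.prod_union hd,
    Finset.prod_image (Sym2.map.injective Sum.inl_injective).injOn,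
    Finset.prod_image (Sym2.map.injective Sum.inr_injective).injOn]
  simp only [Sym2.map_map]
  rfl

/-- Fixed points of the involution, that is legs, lie on no internal edge. -/
theorem edgeProduct_congr (f : Sym2 M → ℚ) {σ : X → X} (hσ : ∀ h, σ (σ h) = h) {y y' : X → M}
    (h : ∀ x, σ x ≠ x → y x = y' x) : edgeProduct f σ y = edgeProduct f σ y' := by
  refine Finset.prod_congr rfl fun p hp => ?_
  obtain ⟨x, hx, rfl⟩ := mem_edgePairs.1 hp
  rw [Sym2.map_mk, Sym2.map_mk]
  rw [h x hx, h (σ x) (by rw [hσ]; exact hx.symm)]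

theorem edgeProduct_eq_mul (f : Sym2 M → ℚ) {σ : X → X} {a : X} (ha : σ a ≠ a) (y : X → M) :
    edgeProduct f σ y = f s(y a, y (σ a)) *
      ∏ p ∈ (edgePairs σ).erase s(a, σ a), f (p.map y) := by
  rw [edgeProduct, ← Finset.mul_prod_erase _ _ (mem_edgePairs.2 ⟨a, ha, rfl⟩)]
  rfl

theorem prod_erase_edgePairs_congr (f : Sym2 M → ℚ) {σ : X → X} (hσ : ∀ h, σ (σ h) = h) {a : X}
    {y y' : X → M} (h : ∀ x, x ≠ a → x ≠ σ a → y x = y' x) :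
    ∏ p ∈ (edgePairs σ).erase s(a, σ a), f (p.map y) =
      ∏ p ∈ (edgePairs σ).erase s(a, σ a), f (p.map y') := by
  refine Finset.prod_congr rfl fun p hp => ?_
  obtain ⟨hp1, hp2⟩ := Finset.mem_erase.1 hp
  obtain ⟨x, hx, rfl⟩ := mem_edgePairs.1 hp2
  have h1 : x ≠ a := fun hc => hp1 (by rw [hc])
  have h2 : x ≠ σ a := fun hc => hp1 (by rw [hc, hσ, Sym2.eq_swap])
  have h3 : σ x ≠ a := fun hc => h2 (by rw [← hc, hσ])
  have h4 : σ x ≠ σ a := fun hc => h1 (by rw [← hσ x, hc, hσ])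
  rw [Sym2.map_mk, Sym2.map_mk]
  rw [h x h1 h2, h _ h3 h4]

/-- Joining two fixed points creates exactly one new edge and keeps the others: this is the effect
of gluing two legs. -/
theorem edgeProduct_swap_comp (f : Sym2 M → ℚ) {σ : X → X} (hσ : ∀ h, σ (σ h) = h) {a b : X}
    (hab : a ≠ b) (ha : σ a = a) (hb : σ b = b) (y : X → M) :
    edgeProduct f (fun h => Equiv.swap a b (σ h)) y = f s(y a, y b) * edgeProduct f σ y := by
  have h : edgePairs (fun h => Equiv.swap a b (σ h)) = insert s(a, b) (edgePairs σ) := by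
    ext p
    simp only [mem_edgePairs, Finset.mem_insert]
    constructor
    · rintro ⟨x, hx, rfl⟩
      by_cases h1 : x = a
      · subst h1; left; rw [ha, Equiv.swap_apply_left]
      by_cases h2 : x = b
      · subst h2; left; rw [hb, Equiv.swap_apply_right, Sym2.eq_swap]
      right
      have h3 : σ x ≠ a := fun hc => h1 (by rw [← hσ x, hc, ha])
      have h4 : σ x ≠ b := fun hc => h2 (by rw [← hσ x, hc, hb])
      rw [Equiv.swap_apply_of_ne_of_ne h3 h4] at hx ⊢
      exact ⟨x, hx, rfl⟩
    · rintro (rfl | ⟨x, hx, rfl⟩)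
      · exact ⟨a, by rw [ha, Equiv.swap_apply_left]; exact hab.symm,
          by rw [ha, Equiv.swap_apply_left]⟩
      · have h1 : x ≠ a := fun hc => hx (by rw [hc, ha])
        have h2 : x ≠ b := fun hc => hx (by rw [hc, hb])
        have h3 : σ x ≠ a := fun hc => h1 (by rw [← hσ x, hc, ha])
        have h4 : σ x ≠ b := fun hc => h2 (by rw [← hσ x, hc, hb])
        exact ⟨x, by rwa [Equiv.swap_apply_of_ne_of_ne h3 h4],
          by rw [Equiv.swap_apply_of_ne_of_ne h3 h4]⟩
  have h' : s(a, b) ∉ edgePairs σ := by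
    rw [mem_edgePairs]
    rintro ⟨x, hx, hc⟩
    rcases Sym2.eq_iff.1 hc with ⟨rfl, -⟩ | ⟨rfl, -⟩
    · exact hx ha
    · exact hx hb
  rw [edgeProduct, h, Finset.prod_insert h']
  rfl

end EdgeProduct

/-! ### Multilinear maps and sums over labelings. -/

section Multilinear

variable {ι M N : Type*} [AddCommGroup M] [Module ℚ M] [AddCommGroup N] [Module ℚ N]

theorem exists_multilinearMap_of_update [dec : DecidableEq ι] (F : (ι → M) → N)
    (h : ∀ (x : ι → M) (i : ι), ∃ f : M →ₗ[ℚ] N, ∀ y, F (Function.update x i y) = f y) :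
    ∃ Φ : MultilinearMap ℚ (fun _ : ι => M) N, ∀ x, Φ x = F x := by
  refine ⟨⟨F, fun {inst} x i y z => ?_, fun {inst} x i q y => ?_⟩, fun _ => rfl⟩
  -- The laws of a `MultilinearMap` are required for every decidability instance; all of them
  -- coincide.
  · obtain rfl : inst = dec := Subsingleton.elim _ _
    obtain ⟨f, hf⟩ := h x i
    rw [hf, hf, hf, map_add]
  · obtain rfl : inst = dec := Subsingleton.elim _ _
    obtain ⟨f, hf⟩ := h x i
    rw [hf, hf, map_smul]

end Multilinear

section FunctionSums

variable {ι α M : Type*} [Fintype ι] [DecidableEq ι] [Fintype α] [AddCommMonoid M]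

theorem sum_pi_eq_zero_of_sum_update (F : (ι → α) → M) (i : ι)
    (h : ∀ c, ∑ p, F (Function.update c i p) = 0) : ∑ c, F c = 0 := by
  classical
  rw [← Fintype.sum_equiv (Equiv.funSplitAt i α).symm
    (fun x => F ((Equiv.funSplitAt i α).symm x)) F (fun _ => rfl), Fintype.sum_prod_type,
    Finset.sum_comm]
  refine Finset.sum_eq_zero fun d _ => ?_
  rcases isEmpty_or_nonempty α with hα | ⟨⟨a⟩⟩
  · simp
  rw [← h ((Equiv.funSplitAt i α).symm (a, d))]
  refine Finset.sum_congr rfl fun p _ => congrArg F ?_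
  funext j
  by_cases hj : j = i
  · subst hj; simp [Equiv.funSplitAt, Equiv.piSplitAt]
  · simp [Equiv.funSplitAt, Equiv.piSplitAt, hj]

/-- Group the labelings by their values away from i and j. For IHX these two are the ends of the
distinguished edge. -/
theorem sum_pi_eq_zero_of_sum_update_update (F : (ι → α) → M) {i j : ι} (hij : i ≠ j)
    (h : ∀ c, ∑ p, ∑ q, F (Function.update (Function.update c i p) j q) = 0) : ∑ c, F c = 0 := by
  classical
  rw [← Fintype.sum_equiv (Equiv.funSplitAt j α).symm
    (fun x => F ((Equiv.funSplitAt j α).symm x)) F (fun _ => rfl), Fintype.sum_prod_type,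
    Finset.sum_comm]
  refine sum_pi_eq_zero_of_sum_update _ ⟨i, hij⟩ fun d => ?_
  rcases isEmpty_or_nonempty α with hα | ⟨⟨a⟩⟩
  · simp
  rw [← h ((Equiv.funSplitAt j α).symm (a, d))]
  refine Finset.sum_congr rfl fun p _ => Finset.sum_congr rfl fun q _ => congrArg F ?_
  funext k
  by_cases hj : k = j
  · subst hj; simp [Equiv.funSplitAt, Equiv.piSplitAt]
  · by_cases hi : k = i
    · subst hi; simp [Equiv.funSplitAt, Equiv.piSplitAt, hj]
    · simp [Equiv.funSplitAt, Equiv.piSplitAt, hj, hi]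

end FunctionSums

/-! ### Metrized Lie algebras: dual bases and the trilinear form. -/

namespace LieMetric

variable {𝔤 : Type*} [LieRing 𝔤] [LieAlgebra ℚ 𝔤] (κ : LieMetric 𝔤)

/-- The basis that is dual to `b` for the metric. -/
abbrev dual {m : ℕ} (b : Module.Basis (Fin m) ℚ 𝔤) : Module.Basis (Fin m) ℚ 𝔤 :=
  κ.form.dualBasis κ.nondegenerate b

theorem form_dual_left {m : ℕ} (b : Module.Basis (Fin m) ℚ 𝔤) (i j : Fin m) :
    κ.form (κ.dual b i) (b j) = if j = i then 1 else 0 :=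
  LinearMap.BilinForm.apply_dualBasis_left κ.nondegenerate b i j

theorem sum_form_dual_smul {m : ℕ} (b : Module.Basis (Fin m) ℚ 𝔤) (x : 𝔤) :
    ∑ i, κ.form (κ.dual b i) x • b i = x := by
  conv_rhs => rw [← b.sum_repr x]
  refine Finset.sum_congr rfl fun i _ => ?_
  congr 1
  conv_lhs => rw [← b.sum_repr x]
  simp only [map_sum, map_smul, form_dual_left, smul_eq_mul, mul_ite, mul_one, mul_zero,
    Finset.sum_ite_eq', Finset.mem_univ, if_true]

theorem sum_form_smul_dual {m : ℕ} (b : Module.Basis (Fin m) ℚ 𝔤) (x : 𝔤) :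
    ∑ i, κ.form (b i) x • κ.dual b i = x := by
  conv_rhs => rw [← (κ.dual b).sum_repr x]
  refine Finset.sum_congr rfl fun i _ => ?_
  congr 1
  rw [κ.symm, LinearMap.BilinForm.dualBasis_repr_apply]

theorem sum_form_mul_form {m : ℕ} (b : Module.Basis (Fin m) ℚ 𝔤) (x y : 𝔤) :
    ∑ i, κ.form (b i) x * κ.form (κ.dual b i) y = κ.form x y := by
  conv_rhs => rw [← κ.sum_form_smul_dual b x]
  simp

/-- Contraction along an edge: inserting K between the forms κ(·, x) and κ(·, y) gives κ(x, y). With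
brackets for x and y, two adjacent vertices merge into one product of brackets. -/
theorem sum_sum_form_dual_mul {m : ℕ} (b : Module.Basis (Fin m) ℚ 𝔤) (x y : 𝔤) :
    ∑ p, ∑ q, κ.form (κ.dual b p) (κ.dual b q) * (κ.form (b p) x * κ.form (b q) y) =
      κ.form x y := by
  rw [← κ.sum_form_mul_form b x y]
  refine Finset.sum_congr rfl fun p _ => ?_
  rw [κ.symm (κ.dual b p) y, ← κ.sum_form_mul_form b y, Finset.mul_sum]
  refine Finset.sum_congr rfl fun q _ => ?_
  rw [κ.symm (κ.dual b p) (κ.dual b q)]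
  ring

/-- A basis and its dual change by mutually contragredient matrices. Expanding b' in b, and b* in
b'*, produces the same coefficients κ(b*, b') on both sides. -/
theorem sum_smul_eq_sum_smul {ι N : Type*} [Fintype ι] [DecidableEq ι] [AddCommGroup N]
    [Module ℚ N] (Φ : MultilinearMap ℚ (fun _ : ι => 𝔤) ℚ)
    (Ψ : MultilinearMap ℚ (fun _ : ι => 𝔤) N) {m m' : ℕ} (b : Module.Basis (Fin m) ℚ 𝔤)
    (b' : Module.Basis (Fin m') ℚ 𝔤) :
    ∑ c : ι → Fin m, Φ (fun h => b (c h)) • Ψ (fun h => κ.dual b (c h)) =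
      ∑ c : ι → Fin m', Φ (fun h => b' (c h)) • Ψ (fun h => κ.dual b' (c h)) := by
  have h1 : ∀ c : ι → Fin m', Φ (fun h => b' (c h)) =
      ∑ d : ι → Fin m, (∏ h, κ.form (κ.dual b (d h)) (b' (c h))) * Φ (fun h => b (d h)) := by
    intro c
    conv_lhs => enter [2, h]; rw [← κ.sum_form_dual_smul b (b' (c h))]
    rw [MultilinearMap.map_sum]
    exact Finset.sum_congr rfl fun d _ => Φ.map_smul_univ _ _
  have h2 : ∀ d : ι → Fin m, Ψ (fun h => κ.dual b (d h)) =
      ∑ c : ι → Fin m', (∏ h, κ.form (κ.dual b (d h)) (b' (c h))) •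
        Ψ (fun h => κ.dual b' (c h)) := by
    intro d
    conv_lhs => enter [2, h]; rw [← κ.sum_form_smul_dual b' (κ.dual b (d h))]
    rw [MultilinearMap.map_sum]
    refine Finset.sum_congr rfl fun c _ => ?_
    rw [Ψ.map_smul_univ]
    simp only [κ.symm]
  simp only [h1, h2, Finset.sum_smul, Finset.smul_sum, smul_smul]
  rw [Finset.sum_comm]
  refine Finset.sum_congr rfl fun c _ => Finset.sum_congr rfl fun d _ => ?_
  rw [mul_comm]

/-- The alternating trilinear form `B(x, y, z) = κ([x, y], z)`. -/
def triple (x y z : 𝔤) : ℚ := κ.form ⁅x, y⁆ z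

theorem triple_eq_form (x y z : 𝔤) : κ.triple x y z = κ.form x ⁅y, z⁆ := κ.invariant x y z

theorem triple_rotate (x y z : 𝔤) : κ.triple y z x = κ.triple x y z := by
  rw [triple_eq_form κ x y z, triple, κ.symm]

theorem triple_flip (x y z : 𝔤) : κ.triple x z y = - κ.triple x y z := by
  rw [triple_eq_form, triple_eq_form, ← lie_skew, map_neg]

/-- By invariance each term is κ of a double bracket with d; the double brackets sum to zero by the
Jacobi identity. -/
theorem triple_jacobi (a b c d : 𝔤) :
    κ.form ⁅a, b⁆ ⁅c, d⁆ + κ.form ⁅c, a⁆ ⁅b, d⁆ + κ.form ⁅b, c⁆ ⁅a, d⁆ = 0 := by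
  rw [← κ.invariant, ← κ.invariant, ← κ.invariant, ← LinearMap.add_apply, ← LinearMap.add_apply,
    ← map_add, ← map_add]
  have h := lie_jacobi c a b
  have h2 : ⁅⁅a, b⁆, c⁆ + ⁅⁅c, a⁆, b⁆ + ⁅⁅b, c⁆, a⁆ = 0 := by
    rw [← lie_skew ⁅a, b⁆ c, ← lie_skew ⁅c, a⁆ b, ← lie_skew ⁅b, c⁆ a, ← neg_add, ← neg_add,
      neg_eq_zero, ← h]
    abel
  rw [h2, map_zero, LinearMap.zero_apply]

end LieMetric

end

/-! ### Exchanging neighbouring letters in a Weyl algebra word. -/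

noncomputable section

namespace WeylAlgebra

variable {V : Type*} [AddCommGroup V] [Module ℚ V] (s : LinearMap.BilinForm ℚ V)

theorem tprod_pair (u v : V) :
    TensorAlgebra.tprod ℚ V 2 ![u, v] = TensorAlgebra.ι ℚ u * TensorAlgebra.ι ℚ v := by
  simp [TensorAlgebra.tprod_apply]

theorem proj_tprod_append_swap {p q : ℕ} (a : Fin p → V) (c : Fin q → V) (u v : V) :
    proj s (TensorAlgebra.tprod ℚ V (p + 2 + q) (Fin.append (Fin.append a ![u, v]) c)) -
      proj s (TensorAlgebra.tprod ℚ V (p + 2 + q) (Fin.append (Fin.append a ![v, u]) c)) =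
      s u v • proj s (TensorAlgebra.tprod ℚ V (p + q) (Fin.append a c)) := by
  simp only [tprod_append, tprod_pair, map_mul]
  rw [proj_ι_mul s u v, mul_add, add_mul, add_sub_cancel_left, ← Algebra.commutes, mul_assoc,
    ← Algebra.smul_def]

/-- Splitting the word as a prefix of length i, two letters and a suffix reduces it to the defining
relation. This is the algebraic side of STU. -/
theorem proj_tprod_sub_swap {m e : ℕ} (a : Fin m → V) (i j : Fin m) (hj : (i : ℕ) + 1 = j)
    (ψ : {k : Fin m // k ≠ i ∧ k ≠ j} ≃o Fin e) :
    proj s (TensorAlgebra.tprod ℚ V m a) -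
      proj s (TensorAlgebra.tprod ℚ V m fun k => a (Equiv.swap i j k)) =
      s (a i) (a j) • proj s (TensorAlgebra.tprod ℚ V e fun k => a (ψ.symm k)) := by
  obtain ⟨p, q, rfl, hp⟩ : ∃ p q, m = p + 2 + q ∧ p = (i : ℕ) :=
    ⟨i, m - (i + 2), by have := j.2; omega, rfl⟩
  have hiv : (i : ℕ) = p := hp.symm
  have hjv : (j : ℕ) = p + 1 := by rw [← hj, hiv]
  have hi : i = Fin.castAdd q (Fin.natAdd p 0) := Fin.ext (by simp [hiv])
  have hj' : j = Fin.castAdd q (Fin.natAdd p 1) := Fin.ext (by simp [hjv])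
  -- The increasing enumeration of the remaining positions, prefix first and then suffix.
  let f : Fin (p + q) → {k : Fin (p + 2 + q) // k ≠ i ∧ k ≠ j} := Fin.addCases
    (fun k => ⟨Fin.castAdd q (Fin.castAdd 2 k), by
      have := k.2
      simp only [ne_eq, Fin.ext_iff, hiv, hjv, Fin.val_castAdd]; omega⟩)
    (fun k => ⟨Fin.natAdd (p + 2) k, by
      simp only [ne_eq, Fin.ext_iff, hiv, hjv, Fin.val_natAdd]; omega⟩)
  have f1 : ∀ k : Fin p, (f (Fin.castAdd q k)).1 = Fin.castAdd q (Fin.castAdd 2 k) := fun k => by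
    simp [f]
  have f2 : ∀ k : Fin q, (f (Fin.natAdd p k)).1 = Fin.natAdd (p + 2) k := fun k => by
    simp [f]
  have hf : StrictMono f := by
    intro x y hxy
    rw [← Subtype.coe_lt_coe, Fin.lt_def]
    rw [Fin.lt_def] at hxy
    induction x using Fin.addCases with
    | left x =>
      induction y using Fin.addCases with
      | left y => rw [f1, f1]; exact hxy
      | right y =>
        rw [f1, f2]
        simp only [Fin.val_natAdd, Fin.val_castAdd]; omega
    | right x =>
      induction y using Fin.addCases with
      | left y =>
        simp only [Fin.val_natAdd, Fin.val_castAdd] at hxy; omega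
      | right y =>
        rw [f2, f2]
        simp only [Fin.val_natAdd] at hxy ⊢; omega
  have hs : Function.Surjective f := by
    rintro ⟨k, hk1, hk2⟩
    induction k using Fin.addCases with
    | left k =>
      induction k using Fin.addCases with
      | left k => exact ⟨Fin.castAdd q k, Subtype.ext (f1 k)⟩
      | right k => fin_cases k; exacts [absurd hi.symm hk1, absurd hj'.symm hk2]
    | right k => exact ⟨Fin.natAdd p k, Subtype.ext (f2 k)⟩
  obtain rfl : e = p + q := by
    simpa using Fintype.card_congr (ψ.symm.trans (hf.orderIsoOfSurjective f hs).symm).toEquiv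
  -- There is only one order isomorphism between finite linear orders, so ψ⁻¹ must be this
  -- enumeration.
  have hψ : ∀ k, ψ.symm k = f k := fun k =>
    congrArg (fun g => g k) (Subsingleton.elim ψ.symm (hf.orderIsoOfSurjective f hs))
  have h1 : a = Fin.append (Fin.append (fun k => a (Fin.castAdd q (Fin.castAdd 2 k)))
      ![a i, a j]) (fun k => a (Fin.natAdd (p + 2) k)) := by
    funext k
    induction k using Fin.addCases with
    | left k =>
      induction k using Fin.addCases with
      | left k => simp
      | right k => fin_cases k <;> simp [hi, hj']
    | right k => simp
  have h2 : (fun k => a (Equiv.swap i j k)) = Fin.append (Fin.append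
      (fun k => a (Fin.castAdd q (Fin.castAdd 2 k))) ![a j, a i])
      (fun k => a (Fin.natAdd (p + 2) k)) := by
    funext k
    induction k using Fin.addCases with
    | left k =>
      induction k using Fin.addCases with
      | left k =>
        have h := (f (Fin.castAdd q k)).2
        rw [f1] at h
        rw [Equiv.swap_apply_of_ne_of_ne h.1 h.2]
        simp
      | right k =>
        fin_cases k
        · change a (Equiv.swap i j (Fin.castAdd q (Fin.natAdd p 0))) = _
          rw [← hi]
          simp
        · change a (Equiv.swap i j (Fin.castAdd q (Fin.natAdd p 1))) = _
          rw [← hj']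
          simp
    | right k =>
      have h := (f (Fin.natAdd p k)).2
      rw [f2] at h
      rw [Equiv.swap_apply_of_ne_of_ne h.1 h.2]
      simp
  have h3 : (fun k => a (ψ.symm k)) = Fin.append (fun k => a (Fin.castAdd q (Fin.castAdd 2 k)))
      (fun k => a (Fin.natAdd (p + 2) k)) := by
    funext k
    rw [hψ]
    induction k using Fin.addCases with
    | left k => rw [f1]; simp
    | right k => rw [f2]; simp
  rw [h2, h3, ← proj_tprod_append_swap, ← h1]

end WeylAlgebra

/-! ### The weight tensor respects isomorphisms, AS, IHX and multilinearity. -/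

section Weight

variable {𝔤 : Type*} [LieRing 𝔤] [LieAlgebra ℚ 𝔤] {H : Type*} (κ : LieMetric 𝔤)

open JacobiDiagram

/-- The metric as a function of unordered pairs. -/
def LieMetric.edgeForm : Sym2 𝔤 → ℚ :=
  Sym2.lift ⟨fun x y => κ.form x y, fun _ _ => κ.symm _ _⟩

/-- The product of the values of the trilinear form at the internal vertices. -/
def LieMetric.vertexWeight {n : ℕ} (x : Fin n × Fin 3 → 𝔤) : ℚ :=
  ∏ v, κ.triple (x (v, 0)) (x (v, 1)) (x (v, 2))

/-- The product of the values of the metric at the internal edges. -/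
def LieMetric.edgeWeight {n e : ℕ} (D : JacobiDiagram (Fin n) (Fin e) H)
    (y : Fin n × Fin 3 → 𝔤) : ℚ :=
  edgeProduct κ.edgeForm D.edge y

theorem LieMetric.edgeWeight_relabel {n n' e e' : ℕ} (D : JacobiDiagram (Fin n) (Fin e) H)
    (φ : Fin n × Fin 3 ≃ Fin n' × Fin 3) (ψ : Fin e ≃ Fin e') (y : Fin n' × Fin 3 → 𝔤) :
    κ.edgeWeight (D.relabel φ ψ) y = κ.edgeWeight D (y ∘ φ) :=
  edgeProduct_conj κ.edgeForm D.edge φ y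

/-- The colors of the external vertices, decorated by the labels of the adjacent half-edges. -/
def JacobiDiagram.legTensor [AddCommGroup H] [Module ℚ H] {n e : ℕ} (D : JacobiDiagram (Fin n) (Fin e) H)
    (y : Fin n × Fin 3 → 𝔤) (k : Fin e) : 𝔤 ⊗[ℚ] H :=
  y (D.leg k) ⊗ₜ[ℚ] D.color k

variable {m n e : ℕ} (b : Module.Basis (Fin m) ℚ 𝔤)

variable [AddCommGroup H] [Module ℚ H]

theorem weightTensor_eq (D : JacobiDiagram (Fin n) (Fin e) H) :
    weightTensor κ b D = ∑ c : Fin n × Fin 3 → Fin m,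
      (κ.vertexWeight (fun h => b (c h)) * κ.edgeWeight D fun h => κ.dual b (c h)) •
        TensorAlgebra.tprod ℚ (𝔤 ⊗[ℚ] H) e (D.legTensor fun h => κ.dual b (c h)) := by
  refine Finset.sum_congr rfl fun c _ => ?_
  congr 2
  refine Finset.prod_congr rfl fun p _ => ?_
  induction p using Sym2.inductionOn with
  | _ x y => rfl

/-- Substituting the labeling transports edges and legs back to D, so φ survives only in the vertex
factor. Isomorphisms, AS and IHX thus become identities for B alone. -/
theorem weightTensor_relabel {n' e' : ℕ} (D : JacobiDiagram (Fin n) (Fin e) H)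
    (φ : Fin n × Fin 3 ≃ Fin n' × Fin 3) (ψ : Fin e ≃ Fin e') :
    weightTensor κ b (D.relabel φ ψ) = ∑ c : Fin n × Fin 3 → Fin m,
      (κ.vertexWeight (fun h => b (c (φ.symm h))) * κ.edgeWeight D fun h => κ.dual b (c h)) •
        TensorAlgebra.tprod ℚ (𝔤 ⊗[ℚ] H) e'
          (fun k => D.legTensor (fun h => κ.dual b (c h)) (ψ.symm k)) := by
  rw [weightTensor_eq]
  refine Fintype.sum_equiv (φ.arrowCongr (Equiv.refl (Fin m))).symm _ _ fun c => ?_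
  rw [LieMetric.edgeWeight_relabel]
  congr 2
  simp

/-- A rotation of the half-edges at a vertex is absorbed by the cyclic invariance of B. -/
theorem LieMetric.vertexWeight_iso {n' : ℕ} (π : Fin n ≃ Fin n') (s : Fin n → Fin 3)
    (x : Fin n' × Fin 3 → 𝔤) :
    κ.vertexWeight (fun h => x (halfEdgeIso π s h)) = κ.vertexWeight x := by
  refine Fintype.prod_equiv π _ _ fun v => ?_
  simp only [halfEdgeIso, Equiv.prodShear_apply, Equiv.coe_addRight]
  generalize s v = i
  fin_cases i
  · rfl
  · exact κ.triple_rotate _ _ _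
  · exact (κ.triple_rotate _ _ _).symm

theorem LieMetric.vertexWeight_iso_symm {n' : ℕ} (π : Fin n ≃ Fin n') (s : Fin n → Fin 3)
    (x : Fin n × Fin 3 → 𝔤) :
    κ.vertexWeight (fun h => x ((halfEdgeIso π s).symm h)) = κ.vertexWeight x := by
  rw [← κ.vertexWeight_iso π s]
  simp

theorem weightTensor_iso {n' e' : ℕ} (D : JacobiDiagram (Fin n) (Fin e) H) (π : Fin n ≃ Fin n')
    (s : Fin n → Fin 3) (ψ : Fin e ≃ Fin e') :
    weightTensor κ b (D.relabel (halfEdgeIso π s) ψ) = ∑ c : Fin n × Fin 3 → Fin m,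
      (κ.vertexWeight (fun h => b (c h)) * κ.edgeWeight D fun h => κ.dual b (c h)) •
        TensorAlgebra.tprod ℚ (𝔤 ⊗[ℚ] H) e'
          (fun k => D.legTensor (fun h => κ.dual b (c h)) (ψ.symm k)) := by
  rw [weightTensor_relabel]
  refine Finset.sum_congr rfl fun c _ => ?_
  rw [κ.vertexWeight_iso_symm π s (fun h => b (c h))]

theorem weightTensor_perm (D : JacobiDiagram (Fin n) (Fin e) H) (σ : Equiv.Perm (Fin e)) :
    weightTensor κ b (D.relabel (Equiv.refl _) σ) = ∑ c : Fin n × Fin 3 → Fin m,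
      (κ.vertexWeight (fun h => b (c h)) * κ.edgeWeight D fun h => κ.dual b (c h)) •
        TensorAlgebra.tprod ℚ (𝔤 ⊗[ℚ] H) e
          (fun k => D.legTensor (fun h => κ.dual b (c h)) (σ.symm k)) :=
  weightTensor_relabel κ b D (Equiv.refl _) σ

theorem weightTensor_iso_order {n' e' : ℕ} (D : JacobiDiagram (Fin n) (Fin e) H)
    (π : Fin n ≃ Fin n') (s : Fin n → Fin 3) (ψ : Fin e ≃o Fin e') :
    weightTensor κ b (D.relabel (halfEdgeIso π s) ψ.toEquiv) = weightTensor κ b D := by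
  obtain rfl : e = e' := by simpa using Fintype.card_congr ψ.toEquiv
  obtain rfl : ψ = OrderIso.refl _ := Subsingleton.elim _ _
  rw [weightTensor_iso, weightTensor_eq]
  rfl

theorem LieMetric.vertexWeight_flip (v : Fin n) (x : Fin n × Fin 3 → 𝔤) :
    κ.vertexWeight (fun h => x ((halfEdgeFlip v).symm h)) = - κ.vertexWeight x := by
  rw [LieMetric.vertexWeight, LieMetric.vertexWeight,
    ← Finset.mul_prod_erase _ _ (Finset.mem_univ v),
    ← Finset.mul_prod_erase Finset.univ (fun v => κ.triple (x (v, 0)) (x (v, 1)) (x (v, 2)))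
      (Finset.mem_univ v), ← neg_mul]
  congr 1
  · rw [← κ.triple_flip]
    simp [halfEdgeFlip, Equiv.swap_apply_of_ne_of_ne]
  · refine Finset.prod_congr rfl fun w hw => ?_
    have hw' := Finset.ne_of_mem_erase hw
    simp [halfEdgeFlip, Equiv.swap_apply_of_ne_of_ne, hw']

theorem weightTensor_antisymmetry (D : JacobiDiagram (Fin n) (Fin e) H) (v : Fin n) :
    weightTensor κ b D + weightTensor κ b (D.relabel (halfEdgeFlip v) (Equiv.refl _)) = 0 := by
  rw [weightTensor_eq, weightTensor_relabel, ← Finset.sum_add_distrib]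
  refine Finset.sum_eq_zero fun c _ => ?_
  rw [κ.vertexWeight_flip v (fun h => b (c h)), neg_mul, neg_smul]
  exact add_neg_cancel _

theorem exists_weightTensor_setColor (D : JacobiDiagram (Fin n) (Fin e) H) (k : Fin e) :
    ∃ f : H →ₗ[ℚ] TensorAlgebra ℚ (𝔤 ⊗[ℚ] H), ∀ x, weightTensor κ b (D.setColor k x) = f x := by
  refine ⟨∑ c : Fin n × Fin 3 → Fin m,
    (κ.vertexWeight (fun h => b (c h)) * κ.edgeWeight D fun h => κ.dual b (c h)) •
      (TensorAlgebra.tprod ℚ (𝔤 ⊗[ℚ] H) e).toLinearMap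
        (D.legTensor fun h => κ.dual b (c h)) k ∘ₗ
        TensorProduct.mk ℚ 𝔤 H (κ.dual b (c (D.leg k))), fun x => ?_⟩
  rw [weightTensor_eq, LinearMap.sum_apply]
  refine Finset.sum_congr rfl fun c _ => ?_
  rw [LinearMap.smul_apply, LinearMap.comp_apply, MultilinearMap.toLinearMap_apply]
  congr 2
  funext l
  by_cases hl : l = k
  · subst hl; simp [legTensor, setColor]
  · simp [legTensor, setColor, hl]

/-- Only the vertices u and v are affected: the half-edges (u, 1), (u, 2), (v, 1) are permuted
cyclically, while (v, 2) and the two ends of the edge stay fixed. -/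
theorem LieMetric.vertexWeight_cycle {u v : Fin n} (huv : u ≠ v) (x : Fin n × Fin 3 → 𝔤) :
    κ.vertexWeight x + κ.vertexWeight (fun h => x ((halfEdgeCycle u v).symm h)) +
        κ.vertexWeight (fun h => x (halfEdgeCycle u v h)) =
      (κ.triple (x (u, 0)) (x (u, 1)) (x (u, 2)) * κ.triple (x (v, 0)) (x (v, 1)) (x (v, 2)) +
        κ.triple (x (u, 0)) (x (v, 1)) (x (u, 1)) * κ.triple (x (v, 0)) (x (u, 2)) (x (v, 2)) +
        κ.triple (x (u, 0)) (x (u, 2)) (x (v, 1)) * κ.triple (x (v, 0)) (x (u, 1)) (x (v, 2))) *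
      ∏ w ∈ (Finset.univ.erase u).erase v, κ.triple (x (w, 0)) (x (w, 1)) (x (w, 2)) := by
  have hsplit : ∀ y : Fin n × Fin 3 → 𝔤, κ.vertexWeight y =
      κ.triple (y (u, 0)) (y (u, 1)) (y (u, 2)) * κ.triple (y (v, 0)) (y (v, 1)) (y (v, 2)) *
      ∏ w ∈ (Finset.univ.erase u).erase v, κ.triple (y (w, 0)) (y (w, 1)) (y (w, 2)) := by
    intro y
    rw [LieMetric.vertexWeight, ← Finset.mul_prod_erase _ _ (Finset.mem_univ u),
      ← Finset.mul_prod_erase _ _ (Finset.mem_erase.2 ⟨huv.symm, Finset.mem_univ v⟩), mul_assoc]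
  have hfix : ∀ w ∈ (Finset.univ.erase u).erase v, ∀ i, halfEdgeCycle u v (w, i) = (w, i) := by
    intro w hw i
    have hw1 := Finset.ne_of_mem_erase hw
    have hw2 := Finset.ne_of_mem_erase (Finset.mem_of_mem_erase hw)
    simp [halfEdgeCycle, Equiv.swap_apply_of_ne_of_ne, hw1, hw2]
  have hrest : ∀ φ : Equiv.Perm (Fin n × Fin 3),
      (∀ w ∈ (Finset.univ.erase u).erase v, ∀ i, φ (w, i) = (w, i)) →
      ∏ w ∈ (Finset.univ.erase u).erase v,
        κ.triple (x (φ (w, 0))) (x (φ (w, 1))) (x (φ (w, 2))) =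
      ∏ w ∈ (Finset.univ.erase u).erase v, κ.triple (x (w, 0)) (x (w, 1)) (x (w, 2)) := by
    intro φ hφ
    refine Finset.prod_congr rfl fun w hw => ?_
    rw [hφ w hw, hφ w hw, hφ w hw]
  have e1 : ∀ w i, i ≠ 1 → i ≠ 2 → halfEdgeCycle u v (w, i) = (w, i) := by
    intro w i h1 h2
    simp [halfEdgeCycle, Equiv.swap_apply_of_ne_of_ne, h1, h2]
  have c1 : halfEdgeCycle u v (u, 1) = (u, 2) := by
    simp [halfEdgeCycle, Equiv.swap_apply_of_ne_of_ne, huv]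
  have c2 : halfEdgeCycle u v (u, 2) = (v, 1) := by
    simp [halfEdgeCycle, Equiv.swap_apply_of_ne_of_ne, huv.symm]
  have c3 : halfEdgeCycle u v (v, 1) = (u, 1) := by
    simp [halfEdgeCycle]
  have c4 : halfEdgeCycle u v (v, 2) = (v, 2) := by
    simp [halfEdgeCycle, Equiv.swap_apply_of_ne_of_ne, huv.symm]
  rw [hsplit x, hsplit fun h => x ((halfEdgeCycle u v).symm h),
    hsplit fun h => x (halfEdgeCycle u v h), hrest _ hfix,
    hrest _ (fun w hw i => (Equiv.symm_apply_eq _).2 (hfix w hw i).symm),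
    e1 u 0 (by decide) (by decide), e1 v 0 (by decide) (by decide), c1, c2, c3, c4,
    (Equiv.symm_apply_eq _).2 (e1 u 0 (by decide) (by decide)).symm,
    (Equiv.symm_apply_eq _).2 (e1 v 0 (by decide) (by decide)).symm,
    (Equiv.symm_apply_eq _).2 c1.symm, (Equiv.symm_apply_eq _).2 c2.symm,
    (Equiv.symm_apply_eq _).2 c3.symm, (Equiv.symm_apply_eq _).2 c4.symm]
  ring

/-- Fix all labels except the two on the edge from u to v. Summing over these contracts each pair of
vertices to κ of two brackets, and the three results cancel by `triple_jacobi`. -/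
theorem weightTensor_ihx (D : JacobiDiagram (Fin n) (Fin e) H) (u v : Fin n) (huv : u ≠ v)
    (h : D.edge (u, 0) = (v, 0)) :
    weightTensor κ b D + weightTensor κ b (D.relabel (halfEdgeCycle u v) (Equiv.refl _))
      + weightTensor κ b (D.relabel (halfEdgeCycle u v)⁻¹ (Equiv.refl _)) = 0 := by
  have hu : D.edge (u, 0) ≠ (u, 0) := by
    rw [h]; exact fun hc => huv (Prod.ext_iff.1 hc).1.symm
  rw [weightTensor_eq, weightTensor_relabel, weightTensor_relabel, ← Finset.sum_add_distrib,
    ← Finset.sum_add_distrib]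
  have h1 : ∀ c : Fin n × Fin 3 → Fin m,
      κ.vertexWeight (fun h => b (c ((halfEdgeCycle u v)⁻¹.symm h))) =
      κ.vertexWeight (fun h => b (c (halfEdgeCycle u v h))) := fun _ => rfl
  simp only [h1, Equiv.refl_symm, Equiv.refl_apply, ← add_smul, ← add_mul]
  have h2 : ∀ c : Fin n × Fin 3 → Fin m, _ :=
    fun c => κ.vertexWeight_cycle huv (fun h => b (c h))
  simp only [h2]
  refine sum_pi_eq_zero_of_sum_update_update _ (i := (u, 0)) (j := (v, 0))
    (fun hc => huv (Prod.ext_iff.1 hc).1) fun c => ?_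
  -- The two half-edges of an internal edge are not legs, so the external tensor does not see their
  -- labels.
  have hleg : ∀ p q, D.legTensor (fun h => κ.dual b
      (Function.update (Function.update c (u, 0) p) (v, 0) q h)) =
      D.legTensor (fun h => κ.dual b (c h)) := by
    intro p q
    funext k
    have hk1 : D.leg k ≠ (u, 0) := fun hc => hu (by rw [← hc, D.edge_leg])
    have hk2 : D.leg k ≠ (v, 0) := fun hc => hu (by
      have := D.edge_leg k
      rw [hc, ← h, D.edge_edge] at this
      exact this.symm)
    simp [legTensor, hk1, hk2]
  have hprod : ∀ p q, ∏ w ∈ (Finset.univ.erase u).erase v,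
      κ.triple (b (Function.update (Function.update c (u, 0) p) (v, 0) q (w, 0)))
        (b (Function.update (Function.update c (u, 0) p) (v, 0) q (w, 1)))
        (b (Function.update (Function.update c (u, 0) p) (v, 0) q (w, 2))) =
      ∏ w ∈ (Finset.univ.erase u).erase v,
        κ.triple (b (c (w, 0))) (b (c (w, 1))) (b (c (w, 2))) := by
    intro p q
    refine Finset.prod_congr rfl fun w hw => ?_
    have hw1 := Finset.ne_of_mem_erase hw
    have hw2 := Finset.ne_of_mem_erase (Finset.mem_of_mem_erase hw)
    simp [hw1, hw2]
  -- Their labels enter a single edge factor, the coefficient of K needed for the contraction.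
  have hedge : ∀ p q, (κ.edgeWeight D fun h => κ.dual b
      (Function.update (Function.update c (u, 0) p) (v, 0) q h)) =
      κ.form (κ.dual b p) (κ.dual b q) * ∏ r ∈ (edgePairs D.edge).erase s((u, 0), D.edge (u, 0)),
        κ.edgeForm (r.map fun h => κ.dual b (c h)) := by
    intro p q
    rw [LieMetric.edgeWeight, edgeProduct_eq_mul _ hu,
      prod_erase_edgePairs_congr (y' := fun h => κ.dual b (c h)) _ D.edge_edge]
    · congr 1
      rw [h]
      simp [LieMetric.edgeForm, huv]
    · intro x hx1 hx2
      rw [h] at hx2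
      simp [hx1, hx2]
  simp only [hleg, hprod, hedge, ← Finset.sum_smul]
  convert zero_smul ℚ _
  have hcal : ∀ p q, ((κ.triple (b p) (b (c (u, 1))) (b (c (u, 2))) *
        κ.triple (b q) (b (c (v, 1))) (b (c (v, 2))) +
      κ.triple (b p) (b (c (v, 1))) (b (c (u, 1))) *
        κ.triple (b q) (b (c (u, 2))) (b (c (v, 2))) +
      κ.triple (b p) (b (c (u, 2))) (b (c (v, 1))) *
        κ.triple (b q) (b (c (u, 1))) (b (c (v, 2)))) * κ.form (κ.dual b p) (κ.dual b q)) =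
      κ.form (κ.dual b p) (κ.dual b q) * (κ.form (b p) ⁅b (c (u, 1)), b (c (u, 2))⁆ *
        κ.form (b q) ⁅b (c (v, 1)), b (c (v, 2))⁆) +
      κ.form (κ.dual b p) (κ.dual b q) * (κ.form (b p) ⁅b (c (v, 1)), b (c (u, 1))⁆ *
        κ.form (b q) ⁅b (c (u, 2)), b (c (v, 2))⁆) +
      κ.form (κ.dual b p) (κ.dual b q) * (κ.form (b p) ⁅b (c (u, 2)), b (c (v, 1))⁆ *
        κ.form (b q) ⁅b (c (u, 1)), b (c (v, 2))⁆) := by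
    intro p q
    simp only [κ.triple_eq_form]
    ring
  have hsum : ∑ p, ∑ q, ((κ.triple (b p) (b (c (u, 1))) (b (c (u, 2))) *
        κ.triple (b q) (b (c (v, 1))) (b (c (v, 2))) +
      κ.triple (b p) (b (c (v, 1))) (b (c (u, 1))) *
        κ.triple (b q) (b (c (u, 2))) (b (c (v, 2))) +
      κ.triple (b p) (b (c (u, 2))) (b (c (v, 1))) *
        κ.triple (b q) (b (c (u, 1))) (b (c (v, 2)))) * κ.form (κ.dual b p) (κ.dual b q)) = 0 := by
    simp only [hcal, Finset.sum_add_distrib]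
    rw [κ.sum_sum_form_dual_mul, κ.sum_sum_form_dual_mul, κ.sum_sum_form_dual_mul,
      κ.triple_jacobi]
  have hne : ∀ w i, (i : Fin 3) ≠ 0 → ((w, i) : Fin n × Fin 3) ≠ (u, 0) ∧
      ((w, i) : Fin n × Fin 3) ≠ (v, 0) := fun w i hi =>
    ⟨fun hc => hi (Prod.ext_iff.1 hc).2, fun hc => hi (Prod.ext_iff.1 hc).2⟩
  have huv' : ((u, 0) : Fin n × Fin 3) ≠ (v, 0) := fun hc => huv (Prod.ext_iff.1 hc).1
  simp only [Function.update_self, Function.update_of_ne huv',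
    Function.update_of_ne (hne _ 1 (by decide)).1, Function.update_of_ne (hne _ 1 (by decide)).2,
    Function.update_of_ne (hne _ 2 (by decide)).1, Function.update_of_ne (hne _ 2 (by decide)).2]
  rw [← zero_mul ((∏ r ∈ (edgePairs D.edge).erase s((u, 0), D.edge (u, 0)),
        κ.edgeForm (r.map fun h => κ.dual b (c h))) * ∏ w ∈ (Finset.univ.erase u).erase v,
        κ.triple (b (c (w, 0))) (b (c (w, 1))) (b (c (w, 2)))), ← hsum, Finset.sum_mul]
  refine Finset.sum_congr rfl fun p _ => ?_
  rw [Finset.sum_mul]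
  refine Finset.sum_congr rfl fun q _ => ?_
  ring

end Weight

end

/-! ### Multiplicativity, STU and symmetrization of the weight tensor. -/

noncomputable section

section Multiplicativity

open JacobiDiagram

variable {𝔤 : Type*} [LieRing 𝔤] [LieAlgebra ℚ 𝔤] {H : Type*} (κ : LieMetric 𝔤)

/-- The half-edges of a union of diagrams. -/
def unionHalfEdges (n n' : ℕ) : (Fin n × Fin 3) ⊕ (Fin n' × Fin 3) ≃ Fin (n + n') × Fin 3 :=
  (Equiv.sumProdDistrib (Fin n) (Fin n') (Fin 3)).symm.trans (unionHalf n n')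

theorem LieMetric.edgeWeight_union {n n' e e' : ℕ} (D : JacobiDiagram (Fin n) (Fin e) H)
    (D' : JacobiDiagram (Fin n') (Fin e') H) (y : Fin (n + n') × Fin 3 → 𝔤) :
    κ.edgeWeight (D.union D') y =
      κ.edgeWeight D (fun h => y (unionHalfEdges n n' (Sum.inl h))) *
        κ.edgeWeight D' (fun h => y (unionHalfEdges n n' (Sum.inr h))) :=
  (edgeProduct_conj κ.edgeForm (Sum.map D.edge D'.edge) (unionHalfEdges n n') y).trans
    (edgeProduct_sumMap κ.edgeForm D.edge D'.edge _)

theorem LieMetric.vertexWeight_union {n n' : ℕ} (x : Fin (n + n') × Fin 3 → 𝔤) :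
    κ.vertexWeight x = κ.vertexWeight (fun h => x (unionHalfEdges n n' (Sum.inl h))) *
      κ.vertexWeight (fun h => x (unionHalfEdges n n' (Sum.inr h))) :=
  Fin.prod_univ_add _

theorem LieMetric.edgeWeight_glue {n k e : ℕ} (D : JacobiDiagram (Fin n) (Fin k) H) (i j : Fin k)
    (hij : i ≠ j) (ψ : {k : Fin k // k ≠ i ∧ k ≠ j} ≃ Fin e) (y : Fin n × Fin 3 → 𝔤) :
    κ.edgeWeight ((D.glue i j hij).relabel (Equiv.refl _) ψ) y =
      κ.form (y (D.leg i)) (y (D.leg j)) * κ.edgeWeight D y :=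
  edgeProduct_swap_comp κ.edgeForm D.edge_edge (fun hc => hij (D.leg_injective hc))
    (D.edge_leg i) (D.edge_leg j) y

variable [AddCommGroup H] [Module ℚ H] {m : ℕ} (b : Module.Basis (Fin m) ℚ 𝔤)

theorem JacobiDiagram.legTensor_union {n n' e e' : ℕ} (D : JacobiDiagram (Fin n) (Fin e) H)
    (D' : JacobiDiagram (Fin n') (Fin e') H) (y : Fin (n + n') × Fin 3 → 𝔤) :
    (D.union D').legTensor y = Fin.append
      (D.legTensor fun h => y (unionHalfEdges n n' (Sum.inl h)))
      (D'.legTensor fun h => y (unionHalfEdges n n' (Sum.inr h))) := by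
  funext k
  induction k using Fin.addCases with
  | left k =>
    rw [Fin.append_left, legTensor, legTensor, union_leg_castAdd, union_color_castAdd]
    rfl
  | right k =>
    rw [Fin.append_right, legTensor, legTensor, union_leg_natAdd, union_color_natAdd]
    rfl

theorem weightTensor_union {n n' e e' : ℕ} (D : JacobiDiagram (Fin n) (Fin e) H)
    (D' : JacobiDiagram (Fin n') (Fin e') H) :
    weightTensor κ b (D.union D') = weightTensor κ b D * weightTensor κ b D' := by
  rw [weightTensor_eq, weightTensor_eq, weightTensor_eq, Finset.sum_mul_sum,
    ← Fintype.sum_prod_type']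
  refine Fintype.sum_equiv (((unionHalfEdges n n').arrowCongr (Equiv.refl (Fin m))).symm.trans
    (Equiv.sumArrowEquivProdArrow _ _ _)) _ _ fun c => ?_
  rw [κ.vertexWeight_union, κ.edgeWeight_union, legTensor_union, WeylAlgebra.tprod_append,
    smul_mul_smul_comm, mul_mul_mul_comm]
  rfl

theorem weightTensor_empty : weightTensor κ b (JacobiDiagram.empty H) = 1 := by
  rw [weightTensor_eq, Fintype.sum_unique]
  have h : edgePairs (JacobiDiagram.empty H).edge = ∅ := rfl
  simp [LieMetric.vertexWeight, LieMetric.edgeWeight, edgeProduct, h]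

/-- For a fixed labeling, exchanging the letters i and j produces the scalar κ ⊗ ω of these letters.
Its factor κ is the contribution of the edge created by gluing, its factor ω the coefficient in STU.
-/
theorem weightTensor_stu (ω : LinearMap.BilinForm ℚ H) {n k e : ℕ}
    (D : JacobiDiagram (Fin n) (Fin k) H) (i j : Fin k) (hij : i ≠ j) (hj : (i : ℕ) + 1 = j)
    (ψ : {k : Fin k // k ≠ i ∧ k ≠ j} ≃o Fin e) :
    WeylAlgebra.proj (κ.tensorForm ω) (weightTensor κ b D) -
      WeylAlgebra.proj (κ.tensorForm ω)
        (weightTensor κ b (D.relabel (Equiv.refl _) (Equiv.swap i j))) =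
      ω (D.color i) (D.color j) • WeylAlgebra.proj (κ.tensorForm ω)
        (weightTensor κ b ((D.glue i j hij).relabel (Equiv.refl _) ψ.toEquiv)) := by
  rw [weightTensor_perm, weightTensor_eq, weightTensor_eq, map_sum, map_sum, map_sum,
    ← Finset.sum_sub_distrib, Finset.smul_sum]
  refine Finset.sum_congr rfl fun c _ => ?_
  rw [map_smul, map_smul, map_smul, ← smul_sub, κ.edgeWeight_glue, Equiv.symm_swap,
    WeylAlgebra.proj_tprod_sub_swap _ _ i j hj ψ, smul_smul, smul_smul]
  congr 1
  change _ * (ω (D.color i) (D.color j) *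
    κ.form (κ.dual b (c (D.leg i))) (κ.dual b (c (D.leg j)))) = _
  ring

theorem algHom_tprod {V : Type*} [AddCommGroup V] [Module ℚ V] {e : ℕ} (a : Fin e → V) :
    SymmetricAlgebra.algHom ℚ V (TensorAlgebra.tprod ℚ V e a) =
      ∏ i, SymmetricAlgebra.ι ℚ V (a i) := by
  rw [TensorAlgebra.tprod_apply, map_list_prod, List.map_ofFn, List.prod_ofFn]
  rfl

theorem algHom_weightTensor_iso {n n' e e' : ℕ} (D : JacobiDiagram (Fin n) (Fin e) H)
    (π : Fin n ≃ Fin n') (s : Fin n → Fin 3) (ψ : Fin e ≃ Fin e') :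
    SymmetricAlgebra.algHom ℚ _ (weightTensor κ b (D.relabel (halfEdgeIso π s) ψ)) =
      SymmetricAlgebra.algHom ℚ _ (weightTensor κ b D) := by
  rw [weightTensor_iso, weightTensor_eq, map_sum, map_sum]
  refine Finset.sum_congr rfl fun c _ => ?_
  rw [map_smul, map_smul, algHom_tprod, algHom_tprod]
  congr 1
  exact Fintype.prod_equiv ψ.symm _ _ fun k => rfl

/-- For each labeling, both sides average the same word over all orders of its letters. -/
theorem symmetrization_algHom_weightTensor (ω : LinearMap.BilinForm ℚ H) {n e : ℕ}
    (D : JacobiDiagram (Fin n) (Fin e) H) :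
    WeylAlgebra.symmetrization (κ.tensorForm ω)
        (SymmetricAlgebra.algHom ℚ _ (weightTensor κ b D)) =
      (e.factorial : ℚ)⁻¹ • ∑ σ : Equiv.Perm (Fin e), WeylAlgebra.proj (κ.tensorForm ω)
        (weightTensor κ b (D.relabel (Equiv.refl _) σ)) := by
  simp only [weightTensor_perm, map_sum, map_smul]
  rw [weightTensor_eq, map_sum, map_sum, Finset.sum_comm, Finset.smul_sum]
  refine Finset.sum_congr rfl fun c _ => ?_
  rw [map_smul, map_smul, algHom_tprod, WeylAlgebra.symmetrization_prod, ← Finset.smul_sum,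
    smul_comm]
  congr 2
  -- Relabeling by σ reads the letters through σ⁻¹, hence the inversion of the summation index.
  refine Fintype.sum_equiv (Equiv.inv _) _ _ fun σ => ?_
  rw [TensorAlgebra.tprod_apply, map_list_prod, List.map_ofFn]
  rfl

end Multiplicativity

/-! ### Independence of the basis of the Lie algebra. -/

section BasisIndependence

open JacobiDiagram

variable {𝔤 : Type*} [LieRing 𝔤] [LieAlgebra ℚ 𝔤] {H : Type*} (κ : LieMetric 𝔤)

/-- Every half-edge belongs to exactly one vertex, and B is linear in each argument. -/
theorem LieMetric.exists_multilinearMap_vertexWeight (n : ℕ) :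
    ∃ Φ : MultilinearMap ℚ (fun _ : Fin n × Fin 3 => 𝔤) ℚ, ∀ x, Φ x = κ.vertexWeight x := by
  refine exists_multilinearMap_of_update _ fun x h => ?_
  obtain ⟨v, i⟩ := h
  have hsplit : ∀ y, κ.vertexWeight (Function.update x (v, i) y) =
      κ.triple (Function.update x (v, i) y (v, 0)) (Function.update x (v, i) y (v, 1))
        (Function.update x (v, i) y (v, 2)) *
      ∏ w ∈ Finset.univ.erase v, κ.triple (x (w, 0)) (x (w, 1)) (x (w, 2)) := by
    intro y
    rw [LieMetric.vertexWeight, ← Finset.mul_prod_erase _ _ (Finset.mem_univ v)]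
    congr 1
    refine Finset.prod_congr rfl fun w hw => ?_
    have hw' := Finset.ne_of_mem_erase hw
    simp [hw']
  set r := ∏ w ∈ Finset.univ.erase v, κ.triple (x (w, 0)) (x (w, 1)) (x (w, 2))
  fin_cases i
  · refine ⟨r • κ.form ⁅x (v, 1), x (v, 2)⁆, fun y => ?_⟩
    rw [hsplit]
    simp only [Fin.zero_eta, Function.update_self, ne_eq, Prod.mk.injEq, one_ne_zero, and_false,
      not_false_eq_true, Function.update_of_ne, Fin.reduceEq, LinearMap.smul_apply, smul_eq_mul]
    rw [← κ.triple_rotate, mul_comm]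
    rfl
  · refine ⟨r • κ.form ⁅x (v, 2), x (v, 0)⁆, fun y => ?_⟩
    rw [hsplit]
    simp only [Fin.mk_one, Function.update_self, ne_eq, Prod.mk.injEq, zero_ne_one, and_false,
      not_false_eq_true, Function.update_of_ne, Fin.reduceEq, LinearMap.smul_apply, smul_eq_mul]
    rw [κ.triple_rotate (x (v, 2)), mul_comm]
    rfl
  · refine ⟨r • κ.form ⁅x (v, 0), x (v, 1)⁆, fun y => ?_⟩
    rw [hsplit]
    simp [triple, mul_comm]

variable [AddCommGroup H] [Module ℚ H]

/-- Each half-edge is either a leg, entering one tensor factor, or an end of a single internal edge,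
entering one value of κ. A loop causes no trouble: its two ends are distinct half-edges. -/
theorem LieMetric.exists_multilinearMap_edgeWeight_smul_tprod {n e : ℕ}
    (D : JacobiDiagram (Fin n) (Fin e) H) :
    ∃ Ψ : MultilinearMap ℚ (fun _ : Fin n × Fin 3 => 𝔤) (TensorAlgebra ℚ (𝔤 ⊗[ℚ] H)),
      ∀ y, Ψ y = κ.edgeWeight D y • TensorAlgebra.tprod ℚ (𝔤 ⊗[ℚ] H) e (D.legTensor y) := by
  refine exists_multilinearMap_of_update _ fun y h => ?_
  by_cases hh : ∃ k, D.leg k = h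
  · obtain ⟨k, rfl⟩ := hh
    refine ⟨κ.edgeWeight D y • (TensorAlgebra.tprod ℚ (𝔤 ⊗[ℚ] H) e).toLinearMap
      (D.legTensor y) k ∘ₗ (TensorProduct.mk ℚ 𝔤 H).flip (D.color k), fun z => ?_⟩
    rw [LinearMap.smul_apply, LinearMap.comp_apply, MultilinearMap.toLinearMap_apply]
    congr 1
    · refine edgeProduct_congr _ D.edge_edge fun x hx => ?_
      rw [Function.update_of_ne]
      rintro rfl
      exact hx (D.edge_leg k)
    · congr 1
      funext l
      by_cases hl : l = k
      · subst hl; simp [legTensor]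
      · simp [legTensor, hl, D.leg_injective.eq_iff]
  · have hh' : D.edge h ≠ h := fun hc => hh ((D.edge_eq_self_iff h).1 hc)
    refine ⟨((∏ r ∈ (edgePairs D.edge).erase s(h, D.edge h), κ.edgeForm (r.map y)) •
      κ.form (y (D.edge h))).smulRight
        (TensorAlgebra.tprod ℚ (𝔤 ⊗[ℚ] H) e (D.legTensor y)), fun z => ?_⟩
    rw [LinearMap.smulRight_apply]
    congr 1
    · rw [LieMetric.edgeWeight, edgeProduct_eq_mul _ hh',
        prod_erase_edgePairs_congr (y' := y) _ D.edge_edge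
          (fun x hx _ => Function.update_of_ne hx _ _), Function.update_self,
        Function.update_of_ne hh', mul_comm, LinearMap.smul_apply, smul_eq_mul]
      congr 1
      exact κ.symm _ _
    · congr 1
      funext l
      have hl : D.leg l ≠ h := fun hc => hh ⟨l, hc⟩
      simp [legTensor, hl]

theorem weightTensor_basis_eq {n e m m' : ℕ} (D : JacobiDiagram (Fin n) (Fin e) H)
    (b : Module.Basis (Fin m) ℚ 𝔤) (b' : Module.Basis (Fin m') ℚ 𝔤) :
    weightTensor κ b D = weightTensor κ b' D := by
  obtain ⟨Φ, hΦ⟩ := κ.exists_multilinearMap_vertexWeight n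
  obtain ⟨Ψ, hΨ⟩ := κ.exists_multilinearMap_edgeWeight_smul_tprod D
  have h := κ.sum_smul_eq_sum_smul Φ Ψ b b'
  simp only [hΦ, hΨ, smul_smul] at h
  rw [weightTensor_eq, weightTensor_eq, h]

end BasisIndependence

/-! ### The two weight systems and their compatibility with χ. -/

section WeightSystem

open JacobiDiagram

variable {𝔤 : Type*} [LieRing 𝔤] [LieAlgebra ℚ 𝔤] {H : Type*} [AddCommGroup H] [Module ℚ H]
  (κ : LieMetric 𝔤) {m : ℕ} (b : Module.Basis (Fin m) ℚ 𝔤)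

/-- The local relations already hold in the tensor algebra, so any algebra map out of it will do.
This serves the Weyl and the symmetric algebra at once. -/
theorem linearCombination_weightTensor_of_local {A : Type*} [Ring A] [Algebra ℚ A]
    (g : TensorAlgebra ℚ (𝔤 ⊗[ℚ] H) →ₐ[ℚ] A) {x : FreeJacobi H} (hx : LocalRelation x) :
    Finsupp.linearCombination ℚ (fun D : Σ n e : ℕ, JacobiDiagram (Fin n) (Fin e) H =>
      Polynomial.monomial D.1 (g (weightTensor κ b D.2.2))) x = 0 := by
  rcases hx with (⟨D, v⟩ | ⟨D, u, v, huv, h⟩ | ⟨D, k, x, y⟩ | ⟨D, k, q, x⟩)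
  · simp only [map_add, OrderedJacobi.linearCombination_toFree]
    rw [← map_add, ← map_add, weightTensor_antisymmetry, map_zero, map_zero]
  · simp only [map_add, OrderedJacobi.linearCombination_toFree]
    rw [← map_add, ← map_add, ← map_add, ← map_add, weightTensor_ihx κ b D u v huv h, map_zero,
      map_zero]
  · simp only [map_sub, OrderedJacobi.linearCombination_toFree]
    obtain ⟨f, hf⟩ := exists_weightTensor_setColor κ b D k
    rw [hf, hf, hf, map_add, map_add, map_add]
    abel
  · simp only [map_sub, map_smul, OrderedJacobi.linearCombination_toFree]
    obtain ⟨f, hf⟩ := exists_weightTensor_setColor κ b D k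
    rw [hf, hf, map_smul, map_smul, Polynomial.smul_monomial, sub_self]

/-- The weight system on diagrams with ordered external vertices, as a linear map. -/
def orderedWeightLin (ω : LinearMap.BilinForm ℚ H) :
    OrderedJacobi ω →ₗ[ℚ] (WeylAlgebra (κ.tensorForm ω))[X] :=
  OrderedJacobi.liftLin (fun D =>
    Polynomial.monomial D.1 (WeylAlgebra.proj (κ.tensorForm ω) (weightTensor κ b D.2.2))) (by
    rintro x (@⟨_, hx⟩ | ⟨D, π, s, ψ⟩ | ⟨D, i, j, hij, hj, ψ⟩)
    · exact linearCombination_weightTensor_of_local κ b _ hx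
    · rename_i n n' e e'
      simp only [map_sub, OrderedJacobi.linearCombination_toFree]
      obtain rfl : n = n' := by simpa using Fintype.card_congr π
      rw [weightTensor_iso_order, sub_self]
    · simp only [map_sub, map_smul, OrderedJacobi.linearCombination_toFree]
      rw [Polynomial.smul_monomial, ← weightTensor_stu κ b ω D i j hij hj ψ, map_sub, sub_self])

theorem orderedWeightLin_cls (ω : LinearMap.BilinForm ℚ H) {n e : ℕ}
    (D : JacobiDiagram (Fin n) (Fin e) H) :
    orderedWeightLin κ b ω (OrderedJacobi.cls ω D) =
      Polynomial.monomial n (WeylAlgebra.proj (κ.tensorForm ω) (weightTensor κ b D)) :=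
  OrderedJacobi.liftLin_cls _ _ D

/-- The weight system on diagrams with ordered external vertices. -/
def orderedWeight (ω : LinearMap.BilinForm ℚ H) :
    OrderedJacobi ω →ₐ[ℚ] (WeylAlgebra (κ.tensorForm ω))[X] :=
  AlgHom.ofLinearMap (orderedWeightLin κ b ω)
    (by
      change orderedWeightLin κ b ω (OrderedJacobi.cls ω (JacobiDiagram.empty H)) = 1
      rw [orderedWeightLin_cls, weightTensor_empty, map_one, Polynomial.monomial_zero_one])
    (by
      have h : (OrderedJacobi.mulLin ω).compr₂ (orderedWeightLin κ b ω) =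
          (LinearMap.mul ℚ _).compl₁₂ (orderedWeightLin κ b ω) (orderedWeightLin κ b ω) := by
        refine OrderedJacobi.hom_ext fun n e D => OrderedJacobi.hom_ext fun n' e' D' => ?_
        simp only [LinearMap.compr₂_apply, LinearMap.compl₁₂_apply, LinearMap.mul_apply',
          OrderedJacobi.mulLin_cls, orderedWeightLin_cls, weightTensor_union, map_mul,
          Polynomial.monomial_mul_monomial]
      exact fun x y => congrArg (fun f => f x y) h)

theorem orderedWeight_cls (ω : LinearMap.BilinForm ℚ H) {n e : ℕ}
    (D : JacobiDiagram (Fin n) (Fin e) H) :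
    orderedWeight κ b ω (OrderedJacobi.cls ω D) =
      Polynomial.monomial n (WeylAlgebra.proj (κ.tensorForm ω) (weightTensor κ b D)) :=
  orderedWeightLin_cls κ b ω D

/-- The weight system on diagrams with unordered external vertices. -/
def unorderedWeight : UnorderedJacobi H →ₗ[ℚ] (SymmetricAlgebra ℚ (𝔤 ⊗[ℚ] H))[X] :=
  UnorderedJacobi.liftLin (fun D =>
    Polynomial.monomial D.1 (SymmetricAlgebra.algHom ℚ _ (weightTensor κ b D.2.2))) (by
    rintro x (@⟨_, hx⟩ | ⟨D, π, s, ψ⟩)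
    · exact linearCombination_weightTensor_of_local κ b _ hx
    · rename_i n n' e e'
      simp only [map_sub, OrderedJacobi.linearCombination_toFree]
      obtain rfl : n = n' := by simpa using Fintype.card_congr π
      rw [algHom_weightTensor_iso, sub_self])

theorem unorderedWeight_cls {n e : ℕ} (D : JacobiDiagram (Fin n) (Fin e) H) :
    unorderedWeight κ b (UnorderedJacobi.cls D) =
      Polynomial.monomial n (SymmetricAlgebra.algHom ℚ _ (weightTensor κ b D)) :=
  UnorderedJacobi.liftLin_cls _ _ D

theorem orderedWeight_symmetrization (ω : LinearMap.BilinForm ℚ H) (x : UnorderedJacobi H) :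
    orderedWeight κ b ω (UnorderedJacobi.symmetrization ω x) =
      WeylAlgebra.symmetrizationPoly (κ.tensorForm ω) (unorderedWeight κ b x) := by
  have h : (orderedWeight κ b ω).toLinearMap ∘ₗ UnorderedJacobi.symmetrization ω =
      WeylAlgebra.symmetrizationPolyLin (κ.tensorForm ω) ∘ₗ unorderedWeight κ b := by
    refine UnorderedJacobi.hom_ext fun n e D => ?_
    rw [LinearMap.comp_apply, LinearMap.comp_apply, UnorderedJacobi.symmetrization_cls,
      unorderedWeight_cls]
    refine Eq.trans ?_ (WeylAlgebra.symmetrizationPoly_monomial _ _).symm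
    rw [symmetrization_algHom_weightTensor, map_smul, map_sum]
    simp only [AlgHom.toLinearMap_apply, orderedWeight_cls]
    rw [← map_sum, Polynomial.smul_monomial]
  exact congrArg (fun f => f x) h

theorem exists_monomial_of_mem_span {U A : Type*} [AddCommGroup U] [Module ℚ U] [Ring A]
    [Algebra ℚ A] (f : U →ₗ[ℚ] A[X]) (n : ℕ) {S : Set U}
    (hS : ∀ x ∈ S, ∃ a, f x = Polynomial.monomial n a) {x : U} (hx : x ∈ Submodule.span ℚ S) :
    ∃ a, f x = Polynomial.monomial n a := by
  induction hx using Submodule.span_induction with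
  | mem x hx => exact hS x hx
  | zero => exact ⟨0, by simp⟩
  | add x y _ _ hx hy =>
    obtain ⟨a, ha⟩ := hx
    obtain ⟨c, hc⟩ := hy
    exact ⟨a + c, by rw [map_add, map_add, ha, hc]⟩
  | smul q x _ hx =>
    obtain ⟨a, ha⟩ := hx
    exact ⟨q • a, by rw [map_smul, ha, Polynomial.smul_monomial]⟩

/-- Symmetric times antisymmetric is antisymmetric, as one checks on pure tensors; over ℚ this
implies alternating. -/
theorem LieMetric.tensorForm_isAlt {ω : LinearMap.BilinForm ℚ H} (hω : ω.IsAlt) :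
    (κ.tensorForm ω).IsAlt := by
  have h : ∀ t t', κ.tensorForm ω t t' = - κ.tensorForm ω t' t := by
    intro t t'
    induction t using TensorProduct.induction_on with
    | zero => simp
    | add x y hx hy => rw [map_add, LinearMap.add_apply, map_add, hx, hy, neg_add]
    | tmul x h =>
      induction t' using TensorProduct.induction_on with
      | zero => simp
      | add x y hx hy => rw [map_add, map_add, LinearMap.add_apply, hx, hy, neg_add]
      | tmul y k =>
        change ω h k * κ.form x y = -(ω k h * κ.form y x)
        rw [κ.symm y x, ← hω.neg_eq k h, neg_mul]
  intro t
  have := h t t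
  linarith

end WeightSystem

end

/-! ### Non-triviality in positive degree. -/

noncomputable section

section Nontriviality

open JacobiDiagram

/-- Recognizes a sum over labelings, with duals paired against given vectors, as a value of a
multilinear form. In this way evaluated weights become explicit brackets. -/
theorem LieMetric.map_eq_sum_dual {𝔤 : Type*} [LieRing 𝔤] [LieAlgebra ℚ 𝔤] (κ : LieMetric 𝔤)
    {ι : Type*} [Fintype ι] [DecidableEq ι] (Φ : MultilinearMap ℚ (fun _ : ι => 𝔤) ℚ) {m : ℕ}
    (b : Module.Basis (Fin m) ℚ 𝔤) (p : ι → 𝔤) :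
    Φ p = ∑ c : ι → Fin m, Φ (fun h => b (c h)) * ∏ h, κ.form (p h) (κ.dual b (c h)) := by
  conv_lhs => enter [2, h]; rw [← κ.sum_form_dual_smul b (p h)]
  rw [MultilinearMap.map_sum]
  refine Finset.sum_congr rfl fun d _ => ?_
  rw [Φ.map_smul_univ, smul_eq_mul, mul_comm]
  simp only [κ.symm (p _)]

variable {𝔤 : Type*} [LieRing 𝔤] [LieAlgebra ℚ 𝔤] {H : Type*} [AddCommGroup H] [Module ℚ H]
  (κ : LieMetric 𝔤) {m : ℕ} (b : Module.Basis (Fin m) ℚ 𝔤)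

/-- Extending a linear form φ to the symmetric algebra is evaluation of polynomials at φ; one
non-zero value certifies a non-zero element. -/
theorem lift_algHom_weightTensor (φ : 𝔤 ⊗[ℚ] H →ₗ[ℚ] ℚ) {n e : ℕ}
    (D : JacobiDiagram (Fin n) (Fin e) H) :
    SymmetricAlgebra.lift φ (SymmetricAlgebra.algHom ℚ _ (weightTensor κ b D)) =
      ∑ c : Fin n × Fin 3 → Fin m,
        (κ.vertexWeight (fun h => b (c h)) * κ.edgeWeight D fun h => κ.dual b (c h)) *
          ∏ k, φ (κ.dual b (c (D.leg k)) ⊗ₜ D.color k) := by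
  rw [weightTensor_eq, map_sum, map_sum]
  refine Finset.sum_congr rfl fun c _ => ?_
  rw [map_smul, map_smul, algHom_tprod, map_prod, smul_eq_mul]
  simp only [SymmetricAlgebra.lift_ι_apply]
  rfl

/-- The linear form `u ⊗ x ↦ κ(p, u) f(x)`. -/
def LieMetric.tensorFunctional (p : 𝔤) (f : H →ₗ[ℚ] ℚ) : 𝔤 ⊗[ℚ] H →ₗ[ℚ] ℚ :=
  TensorProduct.lift ((LinearMap.mul ℚ ℚ).compl₁₂ (κ.form p) f)

theorem LieMetric.tensorFunctional_tmul (p : 𝔤) (f : H →ₗ[ℚ] ℚ) (u : 𝔤) (x : H) :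
    κ.tensorFunctional p f (u ⊗ₜ x) = κ.form p u * f x := rfl

/-- The diagram with a single internal vertex and three external vertices. -/
def tripod {H : Type*} (x : Fin 3 → H) : JacobiDiagram (Fin 1) (Fin 3) H where
  edge := id
  leg k := (0, k)
  color := x
  edge_edge _ := rfl
  leg_injective _ _ h := (Prod.ext_iff.1 h).2
  edge_eq_self_iff h := ⟨fun _ => ⟨h.2, Prod.ext (Subsingleton.elim _ _) rfl⟩, fun _ => rfl⟩

/-- Nondegeneracy turns a non-zero bracket into vectors with κ([p, q], r) ≠ 0. The functionals f
tell the three colors apart, so a single form φ feeds p, q, r to the legs 0, 1, 2, and the value at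
φ is κ([p, q], r). -/
theorem weightTensor_tripod_ne_zero {x : Fin 3 → H} {f : Fin 3 → H →ₗ[ℚ] ℚ}
    (hf : ∀ i j, f i (x j) = if i = j then 1 else 0) (h : ¬ IsLieAbelian 𝔤) :
    SymmetricAlgebra.algHom ℚ _ (weightTensor κ b (tripod x)) ≠ 0 := by
  obtain ⟨p, q, hpq⟩ : ∃ p q : 𝔤, ⁅p, q⁆ ≠ 0 := by
    by_contra! hc
    exact h ⟨hc⟩
  obtain ⟨r, hr⟩ : ∃ r, κ.form ⁅p, q⁆ r ≠ 0 := by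
    by_contra! hc
    exact hpq (κ.nondegenerate.1 _ hc)
  obtain ⟨Φ, hΦ⟩ := κ.exists_multilinearMap_vertexWeight 1
  intro hc
  have h1 := lift_algHom_weightTensor κ b
    (∑ i, κ.tensorFunctional (![p, q, r] i) (f i)) (tripod x)
  rw [hc, map_zero] at h1
  have h2 := κ.map_eq_sum_dual Φ b fun h => ![p, q, r] h.2
  have h3 : edgePairs (tripod x).edge = ∅ := rfl
  have h4 : ∀ (u : 𝔤) (k : Fin 3), (∑ i, κ.tensorFunctional (![p, q, r] i) (f i)) (u ⊗ₜ x k) =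
      κ.form (![p, q, r] k) u := by
    intro u k
    simp [LinearMap.sum_apply, LieMetric.tensorFunctional_tmul, hf]
  refine hr ?_
  calc κ.form ⁅p, q⁆ r = Φ fun h => ![p, q, r] h.2 := by
        rw [hΦ]; simp [LieMetric.vertexWeight, LieMetric.triple]
    _ = 0 := by
      rw [h2, h1]
      refine Finset.sum_congr rfl fun c _ => ?_
      rw [hΦ, LieMetric.edgeWeight, edgeProduct, h3, Finset.prod_empty, mul_one,
        Fintype.prod_prod_type, Fin.prod_univ_one]
      congr 1
      refine Finset.prod_congr rfl fun k _ => ?_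
      exact (h4 _ k).symm

/-- The diagram with two internal vertices that are joined by two edges, and with two external
vertices. -/
def bubble {H : Type*} (x : H) : JacobiDiagram (Fin 2) (Fin 2) H where
  edge h := (if h.2 = 0 then h.1 else Fin.rev h.1, h.2)
  leg k := (k, 0)
  color _ := x
  edge_edge := by decide
  leg_injective _ _ h := (Prod.ext_iff.1 h).1
  edge_eq_self_iff := by decide

/-- By invariance ad p is skew for κ, so the sum is minus the trace of (ad p)², computed with b and
its dual. -/
theorem LieMetric.sum_form_lie_lie_dual (p : 𝔤) :
    ∑ q, κ.form ⁅p, b q⁆ ⁅p, κ.dual b q⁆ = - killingForm ℚ 𝔤 p p := by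
  rw [killingForm_apply_apply, LinearMap.trace_eq_matrix_trace ℚ b, Matrix.trace,
    ← Finset.sum_neg_distrib]
  refine Finset.sum_congr rfl fun q _ => ?_
  rw [Matrix.diag_apply, LinearMap.toMatrix_apply, LinearMap.comp_apply, LieAlgebra.ad_apply,
    LieAlgebra.ad_apply]
  have h : ∀ y, b.repr y q = κ.form (κ.dual b q) y := by
    intro y
    conv_lhs => rw [← κ.sum_form_dual_smul b y]
    simp [Finsupp.single_apply]
  rw [h, κ.symm _ ⁅p, ⁅p, b q⁆⁆, ← lie_skew p ⁅p, b q⁆, map_neg, LinearMap.neg_apply, neg_neg]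
  exact (κ.invariant _ _ _).symm

/-- Both legs are fed the same p; contracting along the two edges gives minus the Killing form at
(p, p). A non-zero symmetric form over ℚ has such a non-zero diagonal value. -/
theorem weightTensor_bubble_ne_zero {x : H} {f : H →ₗ[ℚ] ℚ} (hf : f x = 1)
    (h : killingForm ℚ 𝔤 ≠ 0) :
    SymmetricAlgebra.algHom ℚ _ (weightTensor κ b (bubble x)) ≠ 0 := by
  obtain ⟨p, hp⟩ := LinearMap.BilinForm.exists_bilinForm_self_ne_zero h
    (LieModule.traceForm_isSymm ℚ 𝔤 𝔤)
  obtain ⟨Φ, hΦ⟩ := κ.exists_multilinearMap_vertexWeight 2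
  intro hc
  have h1 := lift_algHom_weightTensor κ b (κ.tensorFunctional p f) (bubble x)
  rw [hc, map_zero] at h1
  have h3 : edgePairs (bubble x).edge = {s((0, 1), (1, 1)), s((0, 2), (1, 2))} := by
    change edgePairs (fun h : Fin 2 × Fin 3 => (if h.2 = 0 then h.1 else Fin.rev h.1, h.2)) = _
    decide
  -- Each of the two edges is opened into a pair of dual basis vectors, b at the first vertex and b*
  -- at the second; p sits at both legs.
  let P : Fin m → Fin m → Fin 2 × Fin 3 → 𝔤 := fun q r h =>
    ![![p, b q, b r], ![p, κ.dual b q, κ.dual b r]] h.1 h.2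
  have h4 : ∑ q, ∑ r, Φ (P q r) = 0 := by
    rw [Finset.sum_congr rfl fun q _ => Finset.sum_congr rfl fun r _ =>
      κ.map_eq_sum_dual Φ b (P q r)]
    refine Eq.trans ?_ h1.symm
    rw [← Fintype.sum_prod_type', Finset.sum_comm]
    refine Finset.sum_congr rfl fun c _ => ?_
    rw [← Finset.mul_sum, Fintype.sum_prod_type, hΦ, mul_assoc]
    congr 1
    have h5 : κ.edgeWeight (bubble x) (fun h => κ.dual b (c h)) =
        κ.form (κ.dual b (c (0, 1))) (κ.dual b (c (1, 1))) *
          κ.form (κ.dual b (c (0, 2))) (κ.dual b (c (1, 2))) := by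
      rw [LieMetric.edgeWeight, edgeProduct, h3, Finset.prod_pair (by decide)]
      rfl
    rw [h5, ← κ.sum_form_mul_form b, ← κ.sum_form_mul_form b, Finset.sum_mul_sum, Finset.sum_mul]
    refine Finset.sum_congr rfl fun q _ => ?_
    rw [Finset.sum_mul]
    refine Finset.sum_congr rfl fun r _ => ?_
    simp only [Fintype.prod_prod_type, Fin.prod_univ_two, Fin.prod_univ_three,
      LieMetric.tensorFunctional_tmul, bubble, hf, P]
    simp
    ring
  have h6 : ∑ q, ∑ r, Φ (P q r) = - killingForm ℚ 𝔤 p p := by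
    rw [← κ.sum_form_lie_lie_dual b]
    refine Finset.sum_congr rfl fun q _ => ?_
    rw [← κ.sum_form_mul_form b]
    refine Finset.sum_congr rfl fun r _ => ?_
    rw [hΦ]
    simp [LieMetric.vertexWeight, LieMetric.triple, P, κ.symm ⁅p, _⁆]
  rw [h4, eq_comm, neg_eq_zero] at h6
  exact hp h6

end Nontriviality

end

/-! ### Assembly of the theorem. -/

theorem theorem3p8 {𝔤 : Type*} [LieRing 𝔤] [LieAlgebra ℚ 𝔤] [FiniteDimensional ℚ 𝔤]
    (κ : LieMetric 𝔤) {H : Type*} [AddCommGroup H] [Module ℚ H] [FiniteDimensional ℚ H]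
    (ω : LinearMap.BilinForm ℚ H) (hω : ω.IsAlt) (hω' : ω.Nondegenerate) :
    Function.Bijective (UnorderedJacobi.symmetrization ω) ∧
    Function.Bijective (WeylAlgebra.symmetrization (κ.tensorForm ω)) ∧
    ∃ (W : OrderedJacobi ω →ₐ[ℚ] Polynomial (WeylAlgebra (κ.tensorForm ω)))
      (W' : UnorderedJacobi H →ₗ[ℚ] Polynomial (SymmetricAlgebra ℚ (TensorProduct ℚ 𝔤 H))),
      -- the values on diagrams, computed in any basis of the Lie algebra
      (∀ (m : ℕ) (b : Module.Basis (Fin m) ℚ 𝔤) (n e : ℕ) (D : JacobiDiagram (Fin n) (Fin e) H),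
        W (OrderedJacobi.cls ω D) =
            Polynomial.monomial n (WeylAlgebra.proj (κ.tensorForm ω) (weightTensor κ b D)) ∧
          W' (UnorderedJacobi.cls D) =
            Polynomial.monomial n (SymmetricAlgebra.algHom ℚ _ (weightTensor κ b D))) ∧
      -- the second map is a homomorphism of unital algebras for the products `⋆`
      W' (UnorderedJacobi.cls (JacobiDiagram.empty H)) = 1 ∧
      (∀ x y, W' (UnorderedJacobi.star ω x y) =
        WeylAlgebra.moyalPoly (κ.tensorForm ω) (W' x) (W' y)) ∧
      -- the internal degree is sent to the degree in `t`
      (∀ n, ∀ x ∈ OrderedJacobi.degreePart ω n, ∃ a, W x = Polynomial.monomial n a) ∧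
      (∀ n, ∀ x ∈ UnorderedJacobi.degreePart H n, ∃ a, W' x = Polynomial.monomial n a) ∧
      -- the diagram of graded algebras commutes
      (∀ n, ∀ x ∈ UnorderedJacobi.degreePart H n,
        UnorderedJacobi.symmetrization ω x ∈ OrderedJacobi.degreePart ω n) ∧
      (∀ x, W (UnorderedJacobi.symmetrization ω x) =
        WeylAlgebra.symmetrizationPoly (κ.tensorForm ω) (W' x)) ∧
      -- non-triviality
      (∃ x, W x ≠ 0) ∧ (∃ x, W' x ≠ 0) ∧
      ((¬ IsLieAbelian 𝔤 ∧ 2 < Module.finrank ℚ H) ∨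
          (killingForm ℚ 𝔤 ≠ 0 ∧ 0 < Module.finrank ℚ H) →
        ∃ n, 0 < n ∧ ∃ x ∈ UnorderedJacobi.degreePart H n,
          W' x ≠ 0 ∧ W (UnorderedJacobi.symmetrization ω x) ≠ 0) := by
  have hs := κ.tensorForm_isAlt hω
  have hW := WeylAlgebra.nontrivial_of_isAlt hs
  set b₀ := Module.finBasis ℚ 𝔤 with hb₀
  have hone : unorderedWeight κ b₀ (UnorderedJacobi.cls (JacobiDiagram.empty H)) = 1 := by
    rw [unorderedWeight_cls, weightTensor_empty, map_one, Polynomial.monomial_zero_one]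
  have hcomm := orderedWeight_symmetrization κ b₀ ω
  -- χ is injective coefficient by coefficient, so non-vanishing is only ever checked in the
  -- symmetric algebra.
  have hne : ∀ x, unorderedWeight κ b₀ x ≠ 0 →
      orderedWeight κ b₀ ω (UnorderedJacobi.symmetrization ω x) ≠ 0 := by
    intro x hx hc
    rw [hcomm] at hc
    refine hx (WeylAlgebra.symmetrizationPoly_injective hs (hc.trans ?_))
    exact (map_zero (WeylAlgebra.symmetrizationPolyLin (κ.tensorForm ω))).symm
  refine ⟨UnorderedJacobi.symmetrization_bijective hω, WeylAlgebra.symmetrization_bijective hs,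
    orderedWeight κ b₀ ω, unorderedWeight κ b₀, ?_, hone, ?_, ?_, ?_, ?_, hcomm,
    ⟨1, by rw [map_one]; exact one_ne_zero⟩, ⟨_, by rw [hone]; exact one_ne_zero⟩, ?_⟩
  · intro m b n e D
    rw [weightTensor_basis_eq κ D b b₀]
    exact ⟨orderedWeight_cls κ b₀ ω D, unorderedWeight_cls κ b₀ D⟩
  · intro x y
    -- Both star products are pulled back by χ, so after applying χ the claim is multiplicativity of
    -- the ordered weight.
    apply WeylAlgebra.symmetrizationPoly_injective hs
    rw [← hcomm, UnorderedJacobi.symmetrization_star, map_mul, hcomm, hcomm,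
      WeylAlgebra.symmetrizationPoly_moyalPoly]
  · intro n x hx
    refine exists_monomial_of_mem_span (orderedWeight κ b₀ ω).toLinearMap n ?_ hx
    rintro _ ⟨e, D, rfl⟩
    exact ⟨_, orderedWeight_cls κ b₀ ω D⟩
  · intro n x hx
    refine exists_monomial_of_mem_span (unorderedWeight κ b₀) n ?_ hx
    rintro _ ⟨e, D, rfl⟩
    exact ⟨_, unorderedWeight_cls κ b₀ D⟩
  · exact fun n x hx => UnorderedJacobi.symmetrization_mem_degreePart ω n hx
  · have key : ∀ {n e : ℕ}, 0 < n → ∀ D : JacobiDiagram (Fin n) (Fin e) H,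
        SymmetricAlgebra.algHom ℚ _ (weightTensor κ b₀ D) ≠ 0 →
        ∃ n, 0 < n ∧ ∃ x ∈ UnorderedJacobi.degreePart H n, unorderedWeight κ b₀ x ≠ 0 ∧
          orderedWeight κ b₀ ω (UnorderedJacobi.symmetrization ω x) ≠ 0 := by
      intro n e hn D hD
      have h : unorderedWeight κ b₀ (UnorderedJacobi.cls D) ≠ 0 := by
        rw [unorderedWeight_cls]
        exact fun hc => hD ((Polynomial.monomial_eq_zero_iff _ _).1 hc)
      exact ⟨n, hn, _, Submodule.subset_span ⟨e, D, rfl⟩, h, hne _ h⟩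
    rintro (⟨h𝔤, hH⟩ | ⟨h𝔤, hH⟩)
    · let b := Module.finBasis ℚ H
      -- Three distinct basis vectors exist since the dimension exceeds 2; their coordinate forms
      -- separate the colors.
      refine key one_pos (tripod fun i => b (Fin.castLE hH i))
        (weightTensor_tripod_ne_zero κ b₀ (f := fun i => b.coord (Fin.castLE hH i)) ?_ h𝔤)
      intro i j
      simp [Finsupp.single_apply, eq_comm]
    · let b := Module.finBasis ℚ H
      exact key two_pos (bubble (b ⟨0, hH⟩))
        (weightTensor_bubble_ne_zero κ b₀ (f := b.coord ⟨0, hH⟩) (by simp) h𝔤)
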